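/- Let $\mathbb{Q}^\theta\langle\langle x\rangle\rangle$ be the algebra of formal power series of bounded total degree over $\mathbb{Q}$ in variables $x=(x_1,x_2,\ldots)$ and $\theta=(\theta_1,\theta_2,\ldots)$ subject to $x_i\theta_j=\theta_jx_i$ and $\theta_i\theta_j=-\theta_j\theta_i$ (so $\theta_i^2=0$; the $x_i$ do not commute). Its monic monomials are $u=\theta_{i_1}\cdots\theta_{i_m}x_{j_1}\cdots x_{j_n}$ with $i_1<\cdots<i_m$. The standardization $\operatorname{std}(u)$ replaces the indices of $u$, in increasing order, by $1,2,\ldots,k$, where $k$ is the number of distinct indices occurring in $u$. Let $\mathrm{sNCQSym}$ be the algebra of all $f\in\mathbb{Q}^\theta\langle\langle x\rangle\rangle$ in which monomials with the same standardization have the same coefficient, and let $\mathrm{sNCSym}$ be the space of all $f$ with $f(x,\theta)=f(\sigma x,\sigma\theta)$ for every $n$ and every $\sigma\in\mathfrak{S}_n$, where $\sigma$ permutes the indices of $x$ and $\theta$ simultaneously. $\mathrm{sNCQSym}$ is $\mathbb{Z}_2$-graded by the parity of the number of $\theta$'s. Its coproduct $\Delta$ is defined as follows: evaluate $f$ on the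 ordered alphabets $x_1<x_2<\cdots<y_1<y_2<\cdots$ and $\theta_1<\theta_2<\cdots<\vartheta_1<\vartheta_2<\cdots$, impose $x_iy_j=y_jx_i$, and write the result as an element of $\mathrm{sNCQSym}\otimes\mathrm{sNCQSym}$, where $g\otimes h$ stands for $g(x,\theta)\,h(y,\vartheta)$. Its counit $\varepsilon$ takes the constant coefficient. The tensor product carries the multiplication $(a\otimes b)(c\otimes d)=(-1)^{|b||c|}ac\otimes bd$. A set supercomposition is a finite sequence $I=(I_1,\ldots,I_k)$ of nonempty subsets of $\{0,\ldots,n\}$, for some $n\geq0$, that pairwise meet at most in $0$ and whose nonzero elements together form $\{1,\ldots,n\}$. A block $I_p$ is fermionic if $0\in I_p$. $I$ is a set superpartition if moreover, for all $i<j$, $I_i\neq I_j$ and $\min(I_i\setminus I_j)<\min(I_j\setminus I_i)$, with $\min\emptyset=0$. For a set supercomposition $I$, let $M_I\in\mathrm{sNCQSym}$ be the sum of all monic monomials $u$ such that, if $\operatorname{std}(u)=\theta_{i_1}\cdots\theta_{i_m}x_{j_1}\cdots x_{j_n}$ has $k$ distinct indices, then $I_r=\{t\in\{1,\ldots,n\}\mid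 j_t=r\}\cup\{0\mid r\in\{i_1,\ldots,i_m\}\}$ for $r=1,\ldots,k$. For a set superpartition $I=(I_1,\ldots,I_k)$ put \[m_I=\sum_{\sigma\in\mathfrak{S}_k}(-1)^{\operatorname{inv}_I(\sigma)}M_{(I_{\sigma(1)},\ldots,I_{\sigma(k)})},\] where $\operatorname{inv}_I(\sigma)$ is the number of pairs $p<q$ with $I_p,I_q$ fermionic and $\sigma^{-1}(p)>\sigma^{-1}(q)$. For a subset $A=\{i_1<\cdots<i_s\}$ of $[k]=\{1,\ldots,k\}$ let $I_A=(I_{i_1},\ldots,I_{i_s})$, and let $\operatorname{std}(I_A)$ be obtained by replacing the nonzero elements that occur, in increasing order, by $1,2,\ldots$. Proposition. (1) $\mathrm{sNCQSym}$, with the above product, grading, coproduct $\Delta$ and counit $\varepsilon$ and a suitable (necessarily unique) antipode $S$, is a Hopf superalgebra, and $\mathrm{sNCSym}$ is a sub-Hopf superalgebra of it: $\mathrm{sNCSym}\subseteq\mathrm{sNCQSym}$ is a subalgebra containing $1$, it contains the even and the odd part of each of its elements, $\Delta(\mathrm{sNCSym})\subseteq\mathrm{sNCSym}\otimes\mathrm{sNCSym}$,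 and $S(\mathrm{sNCSym})\subseteq\mathrm{sNCSym}$. (2) The $m_I$, with $I$ running over all set superpartitions, form a basis of $\mathrm{sNCSym}$, and for every set superpartition $I=(I_1,\ldots,I_k)$ \[\Delta(m_I)=\sum_{A\subseteq[k]}(-1)^{\operatorname{inv}_I(A)}\,m_{\operatorname{std}(I_A)}\otimes m_{\operatorname{std}(I_{A^c})},\] where $\operatorname{inv}_I(A)$ is the number of pairs $(p,q)$ with $p\in A^c$, $q\in A$, $p<q$ and both $I_p$ and $I_q$ fermionic. -/

import Mathlib

open scoped TensorProduct

namespace SuperNC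

/-! ### Monomials and formal power series -/

/-- Monic monomials `θ_{i₁} ⋯ θ_{iₘ} x_{j₁} ⋯ x_{jₙ}` in normal form (`i₁ < ⋯ < iₘ`) over variables
`x_a, θ_a` indexed by `a : α`: `odd = {i₁, …, iₘ}` and `word = [j₁, …, jₙ]`. -/
@[ext]
structure SMonomial (α : Type*) where
  odd : Finset α
  word : List α

/-- The total degree `m + n`. -/
def SMonomial.degree {α : Type*} (u : SMonomial α) : ℕ := u.odd.card + u.word.length

/-- The families of coefficients of the formal power series of bounded degree. -/
def boundedSeries (α : Type*) : Submodule ℚ (SMonomial α → ℚ) where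
  carrier := {f | ∃ d : ℕ, ∀ u, f u ≠ 0 → u.degree ≤ d}
  zero_mem' := ⟨0, fun u hu => absurd rfl hu⟩
  add_mem' := by
    rintro f g ⟨d, hd⟩ ⟨e, he⟩
    refine ⟨max d e, fun u hu => ?_⟩
    by_cases h : f u = 0
    · exact (he u (fun h' => hu (by simp [h, h']))).trans (le_max_right _ _)
    · exact (hd u h).trans (le_max_left _ _)
  smul_mem' := by
    rintro c f ⟨d, hd⟩
    exact ⟨d, fun u hu => hd u (fun h => hu (by simp [h]))⟩

/-- The space `ℚ^θ⟨⟨x⟩⟩` of formal power series of bounded degree in the variables `x_a`, `θ_a`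
(`a : α`); `f.1 u` is the coefficient of the monic monomial `u`.  For the variables
`x₁, x₂, …; θ₁, θ₂, …` we take `α = ℕ` (so that indices are counted from `0`). -/
abbrev SuperSeries (α : Type*) : Type _ := ↥(boundedSeries α)

section Product

variable {α : Type*} [LinearOrder α]

/-- The number of pairs `(a, b) ∈ A × B` with `a > b`. -/
def crossings (A B : Finset α) : ℕ := ((A ×ˢ B).filter (fun p => p.2 < p.1)).card

/-- For disjoint `A`, `B`: the sign with `θ_A θ_B = crossSign A B • θ_{A ∪ B}`. -/
def crossSign (A B : Finset α) : ℚ := (-1) ^ crossings A B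

/-- The coefficients of the product: the sum over all ways of writing a monomial `w`, up to sign, as
a product `u v` of two monic monomials. -/
def mulCoeff (f g : SMonomial α → ℚ) (w : SMonomial α) : ℚ :=
  ∑ S ∈ w.odd.powerset, ∑ i ∈ Finset.range (w.word.length + 1),
    crossSign S (w.odd \ S) * f ⟨S, w.word.take i⟩ * g ⟨w.odd \ S, w.word.drop i⟩

theorem crossings_union_left {A B C : Finset α} (h : Disjoint A B) :
    crossings (A ∪ B) C = crossings A C + crossings B C := by
  unfold crossings
  rw [Finset.union_product, Finset.filter_union, Finset.card_union_of_disjoint]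
  apply Finset.disjoint_filter_filter
  exact Finset.disjoint_product.2 (Or.inl h)

theorem crossings_union_right {A B C : Finset α} (h : Disjoint B C) :
    crossings A (B ∪ C) = crossings A B + crossings A C := by
  unfold crossings
  rw [Finset.product_union, Finset.filter_union, Finset.card_union_of_disjoint]
  apply Finset.disjoint_filter_filter
  exact Finset.disjoint_product.2 (Or.inr h)

theorem sum_powerset_assoc (U : Finset α) (G : Finset α → Finset α → Finset α → ℚ) :
    ∑ S ∈ U.powerset, ∑ A ∈ S.powerset, G A (S \ A) (U \ S) =
      ∑ A ∈ U.powerset, ∑ B ∈ (U \ A).powerset, G A B ((U \ A) \ B) := by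
  rw [Finset.sum_sigma', Finset.sum_sigma']
  refine Finset.sum_bij' (fun p _ => ⟨p.2, p.1 \ p.2⟩) (fun p _ => ⟨p.1 ∪ p.2, p.1⟩) ?_ ?_ ?_ ?_ ?_
  · rintro ⟨S, A⟩ h
    simp only [Finset.mem_sigma, Finset.mem_powerset] at h ⊢
    exact ⟨h.2.trans h.1, Finset.sdiff_subset_sdiff h.1 le_rfl⟩
  · rintro ⟨A, B⟩ h
    simp only [Finset.mem_sigma, Finset.mem_powerset] at h ⊢
    exact ⟨Finset.union_subset h.1 (h.2.trans Finset.sdiff_subset), Finset.subset_union_left⟩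
  · rintro ⟨S, A⟩ h
    simp only [Finset.mem_sigma, Finset.mem_powerset] at h ⊢
    simp [Finset.union_sdiff_of_subset h.2]
  · rintro ⟨A, B⟩ h
    simp only [Finset.mem_sigma, Finset.mem_powerset] at h ⊢
    have hd : Disjoint A B := (Finset.subset_sdiff.1 h.2).2.symm
    simp [Finset.union_sdiff_cancel_left hd]
  · rintro ⟨S, A⟩ h
    simp only [Finset.mem_sigma, Finset.mem_powerset] at h ⊢
    congr 1
    rw [sdiff_sdiff, Finset.sup_eq_union, Finset.union_sdiff_of_subset h.2]

theorem sum_splits_assoc {α : Type*} (w : List α) (G : List α → List α → List α → ℚ) :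
    ∑ i ∈ Finset.range (w.length + 1), ∑ j ∈ Finset.range ((w.take i).length + 1),
        G ((w.take i).take j) ((w.take i).drop j) (w.drop i) =
      ∑ j ∈ Finset.range (w.length + 1), ∑ k ∈ Finset.range ((w.drop j).length + 1),
        G (w.take j) ((w.drop j).take k) ((w.drop j).drop k) := by
  rw [Finset.sum_sigma', Finset.sum_sigma']
  refine Finset.sum_bij' (fun p _ => ⟨p.2, p.1 - p.2⟩) (fun p _ => ⟨p.1 + p.2, p.1⟩) ?_ ?_ ?_ ?_ ?_
  · rintro ⟨i, j⟩ h
    simp only [Finset.mem_sigma, Finset.mem_range, List.length_take, List.length_drop] at h ⊢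
    omega
  · rintro ⟨i, j⟩ h
    simp only [Finset.mem_sigma, Finset.mem_range, List.length_take, List.length_drop] at h ⊢
    omega
  · rintro ⟨i, j⟩ h
    simp only [Finset.mem_sigma, Finset.mem_range, List.length_take] at h ⊢
    have : j + (i - j) = i := by omega
    simp [this]
  · rintro ⟨i, j⟩ h
    simp
  · rintro ⟨i, j⟩ h
    simp only [Finset.mem_sigma, Finset.mem_range, List.length_take] at h ⊢
    have h1 : j + (i - j) = i := by omega
    rw [List.take_take, List.drop_take, List.drop_drop, h1, min_eq_left (by omega)]

theorem mulCoeff_assoc (f g h : SMonomial α → ℚ) :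
    mulCoeff (mulCoeff f g) h = mulCoeff f (mulCoeff g h) := by
  funext w
  have key := fun A B C => sum_splits_assoc w.word (fun a b c =>
    crossSign (A ∪ B) C * crossSign A B * f ⟨A, a⟩ * g ⟨B, b⟩ * h ⟨C, c⟩)
  have key2 := sum_powerset_assoc w.odd (fun A B C =>
    ∑ i ∈ Finset.range (w.word.length + 1), ∑ j ∈ Finset.range ((w.word.take i).length + 1),
      crossSign (A ∪ B) C * crossSign A B * f ⟨A, (w.word.take i).take j⟩ *
        g ⟨B, (w.word.take i).drop j⟩ * h ⟨C, w.word.drop i⟩)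
  unfold mulCoeff
  trans (∑ S ∈ w.odd.powerset, ∑ A ∈ S.powerset,
    ∑ i ∈ Finset.range (w.word.length + 1), ∑ j ∈ Finset.range ((w.word.take i).length + 1),
      crossSign (A ∪ (S \ A)) (w.odd \ S) * crossSign A (S \ A) *
        f ⟨A, (w.word.take i).take j⟩ *
        g ⟨S \ A, (w.word.take i).drop j⟩ * h ⟨w.odd \ S, w.word.drop i⟩)
  · refine Finset.sum_congr rfl fun S hS => ?_
    rw [Finset.sum_comm]
    refine Finset.sum_congr rfl fun i hi => ?_
    rw [Finset.mul_sum, Finset.sum_mul]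
    refine Finset.sum_congr rfl fun A hA => ?_
    rw [Finset.mul_sum, Finset.sum_mul]
    refine Finset.sum_congr rfl fun j hj => ?_
    rw [Finset.union_sdiff_of_subset (Finset.mem_powerset.1 hA)]
    ring
  · rw [key2]
    refine Finset.sum_congr rfl fun A hA => ?_
    rw [Finset.sum_congr rfl (fun B _ => key A B ((w.odd \ A) \ B)), Finset.sum_comm]
    refine Finset.sum_congr rfl fun j hj => ?_
    rw [Finset.mul_sum]
    refine Finset.sum_congr rfl fun B hB => ?_
    rw [Finset.mul_sum]
    refine Finset.sum_congr rfl fun k hk => ?_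
    have hB' := Finset.mem_powerset.1 hB
    have hAB : Disjoint A B := (Finset.subset_sdiff.1 hB').2.symm
    have hsign : crossSign (A ∪ B) ((w.odd \ A) \ B) * crossSign A B =
        crossSign A (w.odd \ A) * crossSign B ((w.odd \ A) \ B) := by
      have h2 : w.odd \ A = B ∪ ((w.odd \ A) \ B) := (Finset.union_sdiff_of_subset hB').symm
      have h3 : crossings A (w.odd \ A) = crossings A B + crossings A ((w.odd \ A) \ B) := by
        conv_lhs => rw [h2]
        exact crossings_union_right Finset.disjoint_sdiff
      unfold crossSign
      rw [crossings_union_left hAB, h3]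
      ring
    rw [hsign]
    ring

/-- The coefficients of `1`. -/
def oneCoeff (u : SMonomial α) : ℚ := if u.odd = ∅ ∧ u.word = [] then 1 else 0

theorem oneCoeff_mk (S : Finset α) (w : List α) :
    oneCoeff ⟨S, w⟩ = (if S = ∅ then 1 else 0) * (if w = [] then 1 else 0) := by
  unfold oneCoeff
  by_cases h : S = ∅ <;> by_cases h' : w = [] <;> simp [h, h']

theorem one_mulCoeff (f : SMonomial α → ℚ) : mulCoeff oneCoeff f = f := by
  funext w
  unfold mulCoeff
  rw [Finset.sum_eq_single ∅, Finset.sum_eq_single 0]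
  · simp [oneCoeff, crossSign, crossings]
  · intro i hi h0
    have : w.word.take i ≠ [] := by
      rw [Ne, List.take_eq_nil_iff]
      rintro (h | h)
      · exact h0 h
      · rw [h] at hi; simp at hi; exact h0 hi
    simp [oneCoeff, this]
  · simp
  · intro S _ hS
    exact Finset.sum_eq_zero fun i _ => by simp [oneCoeff, hS]
  · simp

theorem mulCoeff_one (f : SMonomial α → ℚ) : mulCoeff f oneCoeff = f := by
  funext w
  unfold mulCoeff
  rw [Finset.sum_eq_single w.odd, Finset.sum_eq_single w.word.length]
  · simp [oneCoeff, crossSign, crossings]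
  · intro i hi h0
    have : w.word.drop i ≠ [] := by
      rw [Ne, List.drop_eq_nil_iff]
      simp at hi; omega
    simp [oneCoeff, this]
  · simp
  · intro S hS hne
    have : w.odd \ S ≠ ∅ := by
      rw [Ne, Finset.sdiff_eq_empty_iff_subset]
      exact fun h => hne (Finset.Subset.antisymm (Finset.mem_powerset.1 hS) h)
    exact Finset.sum_eq_zero fun i _ => by simp [oneCoeff, this]
  · simp

theorem mulCoeff_mem {f g : SMonomial α → ℚ} (hf : f ∈ boundedSeries α)
    (hg : g ∈ boundedSeries α) : mulCoeff f g ∈ boundedSeries α := by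
  obtain ⟨d, hd⟩ := hf
  obtain ⟨e, he⟩ := hg
  refine ⟨d + e, fun w hw => ?_⟩
  obtain ⟨S, hS, h1⟩ := Finset.exists_ne_zero_of_sum_ne_zero hw
  obtain ⟨i, hi, h2⟩ := Finset.exists_ne_zero_of_sum_ne_zero h1
  have h3 := hd _ (right_ne_zero_of_mul (left_ne_zero_of_mul h2))
  have h4 := he _ (right_ne_zero_of_mul h2)
  have h5 := Finset.card_sdiff_add_card_eq_card (Finset.mem_powerset.1 hS)
  simp only [SMonomial.degree, List.length_take, List.length_drop] at h3 h4 ⊢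
  omega

theorem oneCoeff_mem : (oneCoeff : SMonomial α → ℚ) ∈ boundedSeries α := by
  refine ⟨0, fun u hu => ?_⟩
  unfold oneCoeff at hu
  simp only [ne_eq, ite_eq_right_iff, one_ne_zero, imp_false, not_not] at hu
  simp [SMonomial.degree, hu.1, hu.2]

noncomputable instance : Mul (SuperSeries α) := ⟨fun f g => ⟨mulCoeff f.1 g.1, mulCoeff_mem f.2 g.2⟩⟩
noncomputable instance : One (SuperSeries α) := ⟨⟨oneCoeff, oneCoeff_mem⟩⟩

theorem SuperSeries.mul_def (f g : SuperSeries α) : (f * g).1 = mulCoeff f.1 g.1 := rfl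
theorem SuperSeries.one_def : (1 : SuperSeries α).1 = oneCoeff := rfl

/-- `ℚ^θ⟨⟨x⟩⟩` is an associative unital ring. -/
noncomputable instance : Ring (SuperSeries α) where
  mul_assoc f g h := Subtype.ext (mulCoeff_assoc f.1 g.1 h.1)
  one_mul f := Subtype.ext (one_mulCoeff f.1)
  mul_one f := Subtype.ext (mulCoeff_one f.1)
  left_distrib f g h := by
    apply Subtype.ext
    funext w
    change mulCoeff f.1 (g.1 + h.1) w = mulCoeff f.1 g.1 w + mulCoeff f.1 h.1 w
    simp [mulCoeff, mul_add, Finset.sum_add_distrib]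
  right_distrib f g h := by
    apply Subtype.ext
    funext w
    change mulCoeff (f.1 + g.1) h.1 w = mulCoeff f.1 h.1 w + mulCoeff g.1 h.1 w
    simp [mulCoeff, mul_add, add_mul, Finset.sum_add_distrib]
  zero_mul f := by
    apply Subtype.ext
    funext w
    change mulCoeff 0 f.1 w = 0
    simp [mulCoeff]
  mul_zero f := by
    apply Subtype.ext
    funext w
    change mulCoeff f.1 0 w = 0
    simp [mulCoeff]
  zsmul := fun n f => n • f
  zsmul_zero' := SubNegMonoid.zsmul_zero'
  zsmul_succ' := SubNegMonoid.zsmul_succ'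
  zsmul_neg' := SubNegMonoid.zsmul_neg'
  nsmul := fun n f => n • f
  nsmul_zero := AddMonoid.nsmul_zero
  nsmul_succ := AddMonoid.nsmul_succ
  neg_add_cancel := neg_add_cancel
  sub_eq_add_neg := sub_eq_add_neg

noncomputable instance : Algebra ℚ (SuperSeries α) :=
  Algebra.ofModule
    (fun r f g => by
      apply Subtype.ext
      funext w
      change mulCoeff (r • f.1) g.1 w = r * mulCoeff f.1 g.1 w
      simp only [mulCoeff, Finset.mul_sum, Pi.smul_apply, smul_eq_mul]
      exact Finset.sum_congr rfl fun _ _ => Finset.sum_congr rfl fun _ _ => by ring)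
    (fun r f g => by
      apply Subtype.ext
      funext w
      change mulCoeff f.1 (r • g.1) w = r * mulCoeff f.1 g.1 w
      simp only [mulCoeff, Finset.mul_sum, Pi.smul_apply, smul_eq_mul]
      exact Finset.sum_congr rfl fun _ _ => Finset.sum_congr rfl fun _ _ => by ring)

end Product

/-! ### Standardization and quasisymmetric functions -/

/-- Renaming of indices in a monomial (used for injective renamings). -/
def SMonomial.map {α β : Type*} [DecidableEq β] (φ : α → β) (u : SMonomial α) : SMonomial β :=
  ⟨u.odd.image φ, u.word.map φ⟩

section Quasi

variable {α : Type*} [LinearOrder α]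

/-- The set of indices of a monomial. -/
def SMonomial.ind (u : SMonomial α) : Finset α := u.odd ∪ u.word.toFinset

/-- The position (counted from `0`) of `a` in the increasing enumeration of `s`, for `a ∈ s`. -/
def rank (s : Finset α) (a : α) : ℕ := (s.filter (· < a)).card

/-- The standardization of a monomial: its `r`th smallest index is replaced by the `r`th index. -/
def SMonomial.std (u : SMonomial α) : SMonomial ℕ := u.map (rank u.ind)

theorem rank_strictMonoOn (s : Finset α) : StrictMonoOn (rank s) s := by
  intro a ha b hb hab
  apply Finset.card_lt_card
  rw [Finset.ssubset_iff_of_subset]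
  · exact ⟨a, by simpa using ⟨ha, hab⟩, by simp⟩
  · intro c hc
    simp only [Finset.mem_filter] at hc ⊢
    exact ⟨hc.1, hc.2.trans hab⟩

theorem SMonomial.ind_map {β : Type*} [LinearOrder β] (φ : α → β) (u : SMonomial α) :
    (u.map φ).ind = u.ind.image φ := by
  ext x
  simp [SMonomial.map, SMonomial.ind, or_and_right, exists_or]

theorem SMonomial.std_map {β : Type*} [LinearOrder β] (φ : α → β) (u : SMonomial α)
    (h : StrictMonoOn φ u.ind) : (u.map φ).std = u.std := by
  have hr : ∀ a ∈ u.ind, rank (u.map φ).ind (φ a) = rank u.ind a := by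
    intro a ha
    unfold rank
    rw [SMonomial.ind_map, Finset.filter_image, Finset.card_image_of_injOn]
    · congr 1
      apply Finset.filter_congr
      intro b hb
      exact h.lt_iff_lt hb ha
    · exact h.injOn.mono fun b hb => (Finset.mem_filter.1 (Finset.mem_coe.1 hb)).1
  unfold SMonomial.std
  apply SMonomial.ext
  · ext x
    simp only [SMonomial.map, Finset.image_image, Finset.mem_image, Function.comp]
    refine exists_congr fun a => and_congr_right fun ha => ?_
    have := hr a (Finset.mem_union_left _ ha)
    simp only [SMonomial.map] at this
    rw [this]
  · simp only [SMonomial.map, List.map_map]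
    apply List.map_congr_left
    intro a ha
    exact hr a (Finset.mem_union_right _ (by simpa using ha))

theorem crossings_image {β : Type*} [LinearOrder β] (φ : α → β) (A B : Finset α)
    (h : StrictMonoOn φ (A ∪ B : Finset α)) : crossings (A.image φ) (B.image φ) = crossings A B := by
  unfold crossings
  symm
  refine Finset.card_bij (fun p _ => (φ p.1, φ p.2)) ?_ ?_ ?_
  · rintro ⟨a, b⟩ hp
    simp only [Finset.mem_filter, Finset.mem_product] at hp ⊢
    refine ⟨⟨Finset.mem_image_of_mem _ hp.1.1, Finset.mem_image_of_mem _ hp.1.2⟩, ?_⟩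
    exact h (Finset.mem_union_right _ hp.1.2) (Finset.mem_union_left _ hp.1.1) hp.2
  · rintro ⟨a, b⟩ hp ⟨c, d⟩ hq he
    simp only [Finset.mem_filter, Finset.mem_product, Prod.mk.injEq] at hp hq he ⊢
    exact ⟨h.injOn (Finset.mem_union_left _ hp.1.1) (Finset.mem_union_left _ hq.1.1) he.1,
      h.injOn (Finset.mem_union_right _ hp.1.2) (Finset.mem_union_right _ hq.1.2) he.2⟩
  · rintro ⟨x, y⟩ hp
    simp only [Finset.mem_filter, Finset.mem_product, Finset.mem_image] at hp
    obtain ⟨⟨⟨a, ha, rfl⟩, ⟨b, hb, rfl⟩⟩, hlt⟩ := hp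
    refine ⟨(a, b), ?_, rfl⟩
    simp only [Finset.mem_filter, Finset.mem_product]
    exact ⟨⟨ha, hb⟩,
      (h.lt_iff_lt (Finset.mem_union_right _ hb) (Finset.mem_union_left _ ha)).1 hlt⟩

theorem mulCoeff_map {β : Type*} [LinearOrder β] (φ : α → β) (f g : SMonomial β → ℚ)
    (u : SMonomial α) (h : StrictMonoOn φ u.ind) :
    mulCoeff f g (u.map φ) = mulCoeff (fun v => f (v.map φ)) (fun v => g (v.map φ)) u := by
  have hodd : StrictMonoOn φ (u.odd : Set α) :=
    h.mono (by exact_mod_cast Finset.subset_union_left)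
  unfold mulCoeff
  simp only [SMonomial.map, Finset.powerset_image, List.length_map]
  rw [Finset.sum_image]
  · refine Finset.sum_congr rfl fun S hS => Finset.sum_congr rfl fun i _ => ?_
    have hS' := Finset.mem_powerset.1 hS
    have h1 : u.odd.image φ \ S.image φ = (u.odd \ S).image φ := by
      ext x
      simp only [Finset.mem_sdiff, Finset.mem_image]
      constructor
      · rintro ⟨⟨a, ha, rfl⟩, hn⟩
        exact ⟨a, ⟨ha, fun hs => hn ⟨a, hs, rfl⟩⟩, rfl⟩
      · rintro ⟨a, ⟨ha, hn⟩, rfl⟩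
        refine ⟨⟨a, ha, rfl⟩, ?_⟩
        rintro ⟨b, hb, hab⟩
        exact hn (hodd.injOn (hS' hb) ha hab ▸ hb)
    have h2 : crossSign (S.image φ) ((u.odd \ S).image φ) = crossSign S (u.odd \ S) := by
      unfold crossSign
      rw [crossings_image]
      rw [Finset.union_sdiff_of_subset hS']
      exact hodd
    rw [h1, h2, List.map_take, List.map_drop]
  · intro S hS T hT hST
    have hS' := Finset.mem_powerset.1 hS
    have hT' := Finset.mem_powerset.1 hT
    have aux : ∀ S T : Finset α, S ⊆ u.odd → T ⊆ u.odd → S.image φ = T.image φ → S ⊆ T := by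
      intro S T hS hT he a ha
      have : φ a ∈ T.image φ := he ▸ Finset.mem_image_of_mem φ ha
      obtain ⟨b, hb, hba⟩ := Finset.mem_image.1 this
      exact hodd.injOn (hT hb) (hS ha) hba ▸ hb
    exact Finset.Subset.antisymm (aux S T hS' hT' hST) (aux T S hT' hS' hST.symm)

theorem mulCoeff_congr {f f' g g' : SMonomial α → ℚ} (u : SMonomial α)
    (hf : ∀ v : SMonomial α, v.ind ⊆ u.ind → f v = f' v)
    (hg : ∀ v : SMonomial α, v.ind ⊆ u.ind → g v = g' v) : mulCoeff f g u = mulCoeff f' g' u := by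
  unfold mulCoeff
  refine Finset.sum_congr rfl fun S hS => Finset.sum_congr rfl fun i _ => ?_
  rw [hf, hg]
  · apply Finset.union_subset_union Finset.sdiff_subset
    intro x hx
    simp only [List.mem_toFinset] at hx ⊢
    exact List.mem_of_mem_drop hx
  · apply Finset.union_subset_union (Finset.mem_powerset.1 hS)
    intro x hx
    simp only [List.mem_toFinset] at hx ⊢
    exact List.mem_of_mem_take hx

/-- `f` is quasisymmetric: monomials with the same standardization have the same coefficient. -/
def IsQuasisymmetric (f : SuperSeries α) : Prop :=
  ∀ u v : SMonomial α, u.std = v.std → f.1 u = f.1 v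

theorem IsQuasisymmetric.mul {f g : SuperSeries α} (hf : IsQuasisymmetric f)
    (hg : IsQuasisymmetric g) : IsQuasisymmetric (f * g) := by
  have ext' : ∀ f : SuperSeries α, IsQuasisymmetric f →
      ∃ F : SMonomial ℕ → ℚ, ∀ u, f.1 u = F u.std := by
    intro f hf
    have : Function.FactorsThrough f.1 (SMonomial.std (α := α)) := fun u v h => hf u v h
    exact ⟨Function.extend SMonomial.std f.1 0, fun u => (this.extend_apply 0 u).symm⟩
  obtain ⟨F, hF⟩ := ext' f hf
  obtain ⟨G, hG⟩ := ext' g hg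
  have key : ∀ u : SMonomial α,
      (f * g).1 u = mulCoeff (fun m => F m.std) (fun m => G m.std) u.std := by
    intro u
    rw [SuperSeries.mul_def]
    conv_rhs => rw [SMonomial.std]
    rw [mulCoeff_map _ _ _ _ (rank_strictMonoOn _)]
    have hs : ∀ v : SMonomial α, v.ind ⊆ u.ind → (v.map (rank u.ind)).std = v.std :=
      fun v hv => SMonomial.std_map _ _ ((rank_strictMonoOn _).mono (by exact_mod_cast hv))
    apply mulCoeff_congr
    · intro v hv
      rw [hF, hs v hv]
    · intro v hv
      rw [hG, hs v hv]
  intro u v h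
  rw [key, key, h]

theorem SMonomial.degree_std (u : SMonomial α) : u.std.degree = u.degree := by
  unfold SMonomial.std SMonomial.degree SMonomial.map
  rw [Finset.card_image_of_injOn, List.length_map]
  exact (rank_strictMonoOn u.ind).injOn.mono (by exact_mod_cast Finset.subset_union_left)

theorem SMonomial.odd_card_std (u : SMonomial α) : u.std.odd.card = u.odd.card := by
  unfold SMonomial.std SMonomial.map
  rw [Finset.card_image_of_injOn]
  exact (rank_strictMonoOn u.ind).injOn.mono (by exact_mod_cast Finset.subset_union_left)

/-- The algebra of quasisymmetric functions in noncommuting variables in superspace over an ordered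
alphabet. -/
def sNCQSymOver (α : Type*) [LinearOrder α] : Subalgebra ℚ (SuperSeries α) where
  carrier := {f | IsQuasisymmetric f}
  mul_mem' hf hg := hf.mul hg
  add_mem' hf hg := fun u v h => by
    exact congrArg₂ (· + ·) (hf u v h) (hg u v h)
  algebraMap_mem' r := fun u v h => by
    rw [Algebra.algebraMap_eq_smul_one]
    change r * oneCoeff u = r * oneCoeff v
    have aux : ∀ u : SMonomial α, oneCoeff u = oneCoeff u.std := by
      intro u
      simp [oneCoeff, SMonomial.std, SMonomial.map]
    rw [aux, aux v, h]

/-- The algebra `sNCQSym`, over the alphabet `x₁ < x₂ < ⋯`, `θ₁ < θ₂ < ⋯`. -/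
abbrev sNCQSym : Subalgebra ℚ (SuperSeries ℕ) := sNCQSymOver ℕ

/-! ### The `ℤ₂`-grading by the parity of the number of `θ`'s -/

/-- The part of parity `i`: the monomials that occur have a number of `θ`'s congruent to `i`. -/
def parityPart (i : ZMod 2) : Submodule ℚ (sNCQSymOver α) where
  carrier := {f | ∀ u, f.1.1 u ≠ 0 → (u.odd.card : ZMod 2) = i}
  zero_mem' := fun u hu => absurd rfl hu
  add_mem' := by
    intro f g hf hg u hu
    by_cases h : f.1.1 u = 0
    · refine hg u fun h' => hu ?_
      change f.1.1 u + g.1.1 u = 0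
      rw [h, h', add_zero]
    · exact hf u h
  smul_mem' := by
    intro c f hf u hu
    refine hf u fun h => hu ?_
    change c * f.1.1 u = 0
    rw [h, mul_zero]

/-- The component of parity `i`. -/
def parityProj (i : ZMod 2) : sNCQSymOver α →ₗ[ℚ] parityPart (α := α) i where
  toFun f := ⟨⟨⟨fun u => if (u.odd.card : ZMod 2) = i then f.1.1 u else 0, by
      obtain ⟨d, hd⟩ := f.1.2
      exact ⟨d, fun u hu => hd u fun h => hu (by simp [h])⟩⟩, by
      intro u v h
      have h1 : u.odd.card = v.odd.card := by
        rw [← SMonomial.odd_card_std, ← SMonomial.odd_card_std v, h]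
      change (if _ then _ else _) = (if _ then _ else _)
      rw [h1, f.2 u v h]⟩, by
      intro u hu
      by_contra hne
      exact hu (if_neg hne)⟩
  map_add' f g := by
    apply Subtype.ext; apply Subtype.ext; apply Subtype.ext
    funext u
    change (if _ then f.1.1 u + g.1.1 u else 0) = (if _ then f.1.1 u else 0) + (if _ then g.1.1 u else 0)
    split_ifs <;> simp
  map_smul' c f := by
    apply Subtype.ext; apply Subtype.ext; apply Subtype.ext
    funext u
    change (if _ then c * f.1.1 u else 0) = c * (if _ then f.1.1 u else 0)
    split_ifs <;> simp

theorem parityPart_gradedMonoid : SetLike.GradedMonoid (parityPart (α := α)) where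
  one_mem := by
    intro u hu
    change oneCoeff u ≠ 0 at hu
    unfold oneCoeff at hu
    simp only [ne_eq, ite_eq_right_iff, one_ne_zero, imp_false, not_not] at hu
    simp [hu.1]
  mul_mem := by
    intro i j f g hf hg w hw
    change mulCoeff f.1.1 g.1.1 w ≠ 0 at hw
    obtain ⟨S, hS, h1⟩ := Finset.exists_ne_zero_of_sum_ne_zero hw
    obtain ⟨k, hk, h2⟩ := Finset.exists_ne_zero_of_sum_ne_zero h1
    have h3 := hf _ (right_ne_zero_of_mul (left_ne_zero_of_mul h2))
    have h4 := hg _ (right_ne_zero_of_mul h2)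
    have h5 := Finset.card_sdiff_add_card_eq_card (Finset.mem_powerset.1 hS)
    rw [← h3, ← h4, ← h5]
    push_cast
    ring

noncomputable instance parityDecomposition : DirectSum.Decomposition (parityPart (α := α)) :=
  DirectSum.Decomposition.ofLinearMap _
    (∑ i : ZMod 2, DirectSum.lof ℚ (ZMod 2) (fun i => parityPart (α := α) i) i ∘ₗ parityProj i)
    (by
      ext1 f
      apply Subtype.ext; apply Subtype.ext
      funext u
      simp only [LinearMap.comp_apply, LinearMap.sum_apply, map_sum, DirectSum.coeLinearMap_lof,
        LinearMap.id_apply]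
      have h2 : ∀ F : ZMod 2 → sNCQSymOver α, ∑ i, F i = F 0 + F 1 := fun F => Fin.sum_univ_two F
      rw [h2]
      change (if (u.odd.card : ZMod 2) = 0 then f.1.1 u else 0) +
        (if (u.odd.card : ZMod 2) = 1 then f.1.1 u else 0) = f.1.1 u
      have h3 : ∀ c : ZMod 2, c = 0 ∨ c = 1 := by decide
      rcases h3 (u.odd.card : ZMod 2) with h | h <;> rw [h] <;> simp)
    (by
      apply DirectSum.linearMap_ext
      intro i
      ext1 f
      simp only [LinearMap.comp_apply, LinearMap.sum_apply, DirectSum.coeLinearMap_lof,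
        LinearMap.id_apply]
      rw [Finset.sum_eq_single i]
      · congr 1
        apply Subtype.ext; apply Subtype.ext; apply Subtype.ext
        funext u
        change (if (u.odd.card : ZMod 2) = i then f.1.1.1 u else 0) = f.1.1.1 u
        split_ifs with h
        · rfl
        · by_contra h'
          exact h (f.2 u (Ne.symm h'))
      · intro j _ hj
        have : parityProj j f.1 = 0 := by
          apply Subtype.ext; apply Subtype.ext; apply Subtype.ext
          funext u
          change (if (u.odd.card : ZMod 2) = j then f.1.1.1 u else 0) = 0
          split_ifs with h
          · by_contra h'
            exact hj (h.symm.trans (f.2 u h'))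
          · rfl
        rw [this, map_zero]
      · simp)

/-- `sNCQSym` is a superalgebra. -/
noncomputable instance parityGraded : GradedAlgebra (parityPart (α := α)) :=
  { parityPart_gradedMonoid, parityDecomposition with }

end Quasi

/-! ### Hopf superalgebras -/

section Hopf

variable {A : Type*} [Ring A] [Algebra ℚ A]

/-- The part `⨁_{j + k = i} A_j ⊗ A_k` of parity `i` of `A ⊗ A`. -/
def tensorParityPart (𝒜 : ZMod 2 → Submodule ℚ A) (i : ZMod 2) : Submodule ℚ (A ⊗[ℚ] A) :=
  ⨆ j : ZMod 2, LinearMap.range (TensorProduct.map (𝒜 j).subtype (𝒜 (i - j)).subtype)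

/-- The structure of a Hopf superalgebra on the superalgebra `A = A₀ ⊕ A₁`.  Here
`GradedTensorProduct` is `A ⊗ A` with the multiplication
`(a ⊗ b) (c ⊗ d) = (-1)^{|b||c|} ac ⊗ bd`. -/
structure HopfSuperalgebra (𝒜 : ZMod 2 → Submodule ℚ A) [GradedAlgebra 𝒜]
    extends Coalgebra ℚ A where
  comul_even : ∀ (i : ZMod 2) (a : A), a ∈ 𝒜 i → comul a ∈ tensorParityPart 𝒜 i
  counit_even : ∀ a ∈ 𝒜 1, counit a = 0
  comul_one : comul 1 = 1 ⊗ₜ[ℚ] 1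
  comul_mul : ∀ a b : A, GradedTensorProduct.of ℚ 𝒜 𝒜 (comul (a * b)) =
    GradedTensorProduct.of ℚ 𝒜 𝒜 (comul a) * GradedTensorProduct.of ℚ 𝒜 𝒜 (comul b)
  counit_one : counit 1 = 1
  counit_mul : ∀ a b : A, counit (a * b) = counit a * counit b
  antipode : A →ₗ[ℚ] A
  antipode_even : ∀ (i : ZMod 2) (a : A), a ∈ 𝒜 i → antipode a ∈ 𝒜 i
  mul_antipode_right : LinearMap.mul' ℚ A ∘ₗ antipode.lTensor A ∘ₗ comul =
    Algebra.linearMap ℚ A ∘ₗ counit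
  mul_antipode_left : LinearMap.mul' ℚ A ∘ₗ antipode.rTensor A ∘ₗ comul =
    Algebra.linearMap ℚ A ∘ₗ counit

/-- The subspace `B` is a sub-Hopf superalgebra: a graded subalgebra with `Δ(B) ⊆ B ⊗ B` and
`S(B) ⊆ B`. -/
structure IsSubHopfSuperalgebra {𝒜 : ZMod 2 → Submodule ℚ A} [GradedAlgebra 𝒜]
    (H : HopfSuperalgebra 𝒜) (B : Submodule ℚ A) : Prop where
  one_mem : 1 ∈ B
  mul_mem : ∀ a ∈ B, ∀ b ∈ B, a * b ∈ B
  graded : ∀ a ∈ B, ∀ i : ZMod 2, (DirectSum.decompose 𝒜 a i : A) ∈ B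
  comul_mem : ∀ a ∈ B, H.comul a ∈ LinearMap.range (TensorProduct.map B.subtype B.subtype)
  antipode_mem : ∀ a ∈ B, H.antipode a ∈ B

end Hopf

/-! ### The coproduct of `sNCQSym` by duplication of the alphabet -/

section Coproduct

/-- The natural map from `sNCQSym` to the quasisymmetric functions over another ordered alphabet:
the coefficient of `u` in `f(α)` is the coefficient of `std u` in `f`. -/
def evalAlphabet (α : Type*) [LinearOrder α] : sNCQSym →ₗ[ℚ] sNCQSymOver α where
  toFun f := ⟨⟨fun u => f.1.1 u.std, by
      obtain ⟨d, hd⟩ := f.1.2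
      exact ⟨d, fun u hu => (SMonomial.degree_std u) ▸ hd _ hu⟩⟩,
    fun u v h => congrArg f.1.1 h⟩
  map_add' _ _ := rfl
  map_smul' _ _ := rfl

variable {α β : Type*}

/-- The words in the duplicated alphabet `x ∪ y` that become `w · w'` (`w` in the letters `x`, `w'`
in the letters `y`) after imposing `x_i y_j = y_j x_i`. -/
def wordFibre (w : List α) (w' : List β) : Set (List (α ⊕ₗ β)) :=
  {z | z.filterMap (fun c => (ofLex c).getLeft?) = w ∧
    z.filterMap (fun c => (ofLex c).getRight?) = w'}

theorem wordFibre_finite (w : List α) (w' : List β) : (wordFibre w w').Finite := by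
  have h : ∀ (n : ℕ) (w : List α) (w' : List β), w.length + w'.length = n →
      (wordFibre w w').Finite := by
    intro n
    induction n with
    | zero =>
      intro w w' hn
      refine (Set.finite_singleton []).subset ?_
      rintro (_ | ⟨c, z⟩) hz
      · rfl
      · exfalso
        obtain ⟨rfl, rfl⟩ := hz
        rcases hc : ofLex c with a | b <;> simp [hc] at hn
    | succ n ih =>
      intro w w' hn
      have h1 : (⋃ a ∈ {a | a ∈ w.head?}, List.cons (toLex (Sum.inl a)) '' wordFibre w.tail w').Finite := by
        refine Set.Finite.biUnion ?_ fun a ha => Set.Finite.image _ (ih _ _ ?_)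
        · cases w <;> simp
        · cases w <;> simp at ha hn ⊢; omega
      have h2 : (⋃ b ∈ {b | b ∈ w'.head?}, List.cons (toLex (Sum.inr b)) '' wordFibre w w'.tail).Finite := by
        refine Set.Finite.biUnion ?_ fun a ha => Set.Finite.image _ (ih _ _ ?_)
        · cases w' <;> simp
        · cases w' <;> simp at ha hn ⊢; omega
      refine ((h1.union h2).union (Set.finite_singleton [])).subset ?_
      rintro (_ | ⟨c, z⟩) hz
      · right; rfl
      · left
        obtain ⟨rfl, rfl⟩ := hz
        rcases hc : ofLex c with a | b
        · left
          obtain rfl : c = toLex (Sum.inl a) := hc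
          simp [wordFibre, List.filterMap_cons]
        · right
          obtain rfl : c = toLex (Sum.inr b) := hc
          simp [wordFibre, List.filterMap_cons]
  exact h _ w w' rfl

/-- The monomial `θ_S ϑ_T z` over the duplicated alphabet, where `u = θ_S w` and `v = ϑ_T w'`. -/
def dupMonomial [DecidableEq α] [DecidableEq β] (u : SMonomial α) (v : SMonomial β)
    (z : List (α ⊕ₗ β)) : SMonomial (α ⊕ₗ β) :=
  ⟨u.odd.map ⟨fun a => toLex (Sum.inl a), fun _ _ h => Sum.inl_injective (toLex.injective h)⟩ ∪
    v.odd.map ⟨fun b => toLex (Sum.inr b), fun _ _ h => Sum.inr_injective (toLex.injective h)⟩, z⟩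

/-- The projection `ℚ^{θ,ϑ}⟨⟨x, y⟩⟩ → ℚ^{θ,ϑ}⟨⟨x × y⟩⟩` to the quotient by `x_i y_j = y_j x_i`.  The
monic monomials of the quotient are the products `u v` of a monic monomial `u` in `x, θ` and a monic
monomial `v` in `y, ϑ`; the coefficient of `u v` is the (finite) sum of the coefficients of the
monomials that become equal to `u v`. -/
noncomputable def projCommute [DecidableEq α] [DecidableEq β] (f : SuperSeries (α ⊕ₗ β)) :
    SMonomial α × SMonomial β → ℚ :=
  fun p => ∑ z ∈ (wordFibre_finite p.1.word p.2.word).toFinset, f.1 (dupMonomial p.1 p.2 z)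

/-- The embedding `ℚ^θ⟨⟨x⟩⟩ ⊗ ℚ^ϑ⟨⟨y⟩⟩ → ℚ^{θ,ϑ}⟨⟨x × y⟩⟩`, `f ⊗ g ↦ f(x, θ) g(y, ϑ)`. -/
noncomputable def tensorToSeries :
    SuperSeries α ⊗[ℚ] SuperSeries β →ₗ[ℚ] (SMonomial α × SMonomial β → ℚ) :=
  TensorProduct.lift (LinearMap.mk₂ ℚ (fun f g p => f.1 p.1 * g.1 p.2)
    (fun f f' g => by funext p; exact add_mul _ _ _)
    (fun c f g => by funext p; exact mul_assoc _ _ _)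
    (fun f g g' => by funext p; exact mul_add _ _ _)
    (fun c f g => by funext p; exact mul_left_comm _ _ _))

/-- `Δ` is the coproduct of `sNCQSym`: `Δ(f)`, as a series in two mutually commuting alphabets, is
the image of `f(x, y; θ, ϑ)`, where `x_i < y_j` and `θ_i < ϑ_j`. -/
def IsDuplicationCoproduct (Δ : sNCQSym →ₗ[ℚ] sNCQSym ⊗[ℚ] sNCQSym) : Prop :=
  ∀ f : sNCQSym,
    tensorToSeries (TensorProduct.map sNCQSym.val.toLinearMap sNCQSym.val.toLinearMap (Δ f)) =
      projCommute (evalAlphabet (ℕ ⊕ₗ ℕ) f).1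

end Coproduct

/-! ### Symmetric functions -/

section Symmetric

variable {α : Type*} [LinearOrder α]

/-- The sign with `θ_{σ(i₁)} ⋯ θ_{σ(iₘ)} = permSign σ S • θ_{σ(S)}` for `S = {i₁ < ⋯ < iₘ}`. -/
def permSign (σ : Equiv.Perm α) (S : Finset α) : ℚ :=
  (-1) ^ ((S ×ˢ S).filter (fun p => p.1 < p.2 ∧ σ p.2 < σ p.1)).card

/-- The series `f(σx, σθ)`: the monomial `u = θ_S w` of `f` contributes to the coefficient of
`σ(u)`. -/
def substPerm (σ : Equiv.Perm α) (f : SuperSeries α) : SuperSeries α :=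
  ⟨fun v => permSign σ (v.map σ.symm).odd * f.1 (v.map σ.symm), by
    obtain ⟨d, hd⟩ := f.2
    refine ⟨d, fun v hv => ?_⟩
    have h := hd _ (right_ne_zero_of_mul hv)
    simpa [SMonomial.degree, SMonomial.map, Finset.card_image_of_injective _ σ.symm.injective]
      using h⟩

/-- The space `sNCSym` of symmetric functions in noncommuting variables in superspace:
`f(σx, σθ) = f` for all `n` and all permutations `σ` of the first `n` indices. -/
def sNCSym : Submodule ℚ (SuperSeries ℕ) where
  carrier := {f | ∀ (n : ℕ) (σ : Equiv.Perm ℕ), (∀ i, n ≤ i → σ i = i) → substPerm σ f = f}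
  zero_mem' := by
    intro n σ _
    apply Subtype.ext
    funext v
    exact mul_zero _
  add_mem' := by
    intro f g hf hg n σ hσ
    apply Subtype.ext
    funext v
    have h1 := congrFun (congrArg Subtype.val (hf n σ hσ)) v
    have h2 := congrFun (congrArg Subtype.val (hg n σ hσ)) v
    change _ * (f.1 _ + g.1 _) = f.1 v + g.1 v
    rw [← h1, ← h2, mul_add]
    rfl
  smul_mem' := by
    intro c f hf n σ hσ
    apply Subtype.ext
    funext v
    have h1 := congrFun (congrArg Subtype.val (hf n σ hσ)) v
    change _ * (c * f.1 _) = c * f.1 v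
    rw [← h1, mul_left_comm]
    rfl

end Symmetric

/-! ### Set supercompositions and the monomial functions -/

section Monomial

/-- The block of the index `a` in a monomial: the positions (counted from `1`) at which `x_a` occurs,
together with `0` if `θ_a` occurs. -/
def SMonomial.block (u : SMonomial ℕ) (a : ℕ) : Finset ℕ :=
  (Finset.Icc 1 u.word.length).filter (fun t => u.word[t - 1]? = some a) ∪
    (if a ∈ u.odd then {0} else ∅)

/-- The set supercomposition `I(u)` of a monomial. -/
def SMonomial.blocks (u : SMonomial ℕ) : List (Finset ℕ) :=
  (List.range u.std.ind.card).map u.std.block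

/-- `I` is a set supercomposition: for some `n` the blocks are nonempty subsets of `{0, …, n}` whose
nonzero elements partition `{1, …, n}`. -/
def IsSetSupercomposition (I : List (Finset ℕ)) : Prop :=
  (∀ B ∈ I, B.Nonempty) ∧ I.Pairwise (fun B C => B ∩ C ⊆ {0}) ∧
    ∃ n : ℕ, ∀ t : ℕ, t ≠ 0 → (t ≤ n ↔ ∃ B ∈ I, t ∈ B)

/-- The minimum of a finite set of natural numbers, with `min ∅ = 0`. -/
noncomputable def minZero (B : Finset ℕ) : ℕ := sInf (B : Set ℕ)

/-- `I` is a set superpartition. -/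
def IsSetSuperpartition (I : List (Finset ℕ)) : Prop :=
  IsSetSupercomposition I ∧
    I.Pairwise (fun B C => B ≠ C ∧ minZero (B \ C) < minZero (C \ B))

theorem degree_le_of_blocks (u : SMonomial ℕ) :
    u.degree ≤ u.blocks.length + (u.blocks.map (fun B => B.sup id)).sum := by
  rw [← SMonomial.degree_std]
  have hodd : u.std.odd.card ≤ u.blocks.length := by
    have h : u.std.odd.card ≤ u.std.ind.card := Finset.card_le_card Finset.subset_union_left
    simpa [SMonomial.blocks] using h
  have hword : u.std.word.length ≤ (u.blocks.map (fun B => B.sup id)).sum := by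
    rcases Nat.eq_zero_or_pos u.std.word.length with h0 | hpos
    · omega
    set n := u.std.word.length with hn
    obtain ⟨a, ha⟩ : ∃ a, u.std.word[n - 1]? = some a :=
      ⟨_, List.getElem?_eq_getElem (by omega)⟩
    have hmem : a ∈ u.std.ind :=
      Finset.mem_union_right _ (List.mem_toFinset.2 (List.mem_of_getElem? ha))
    have hlt : a < u.std.ind.card := by
      have hi : u.std.ind = u.ind.image (rank u.ind) := SMonomial.ind_map _ _
      rw [hi, Finset.card_image_of_injOn (rank_strictMonoOn _).injOn]
      rw [hi] at hmem
      obtain ⟨b, hb, rfl⟩ := Finset.mem_image.1 hmem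
      apply Finset.card_lt_card
      rw [Finset.ssubset_iff_of_subset (Finset.filter_subset _ _)]
      exact ⟨b, hb, by simp⟩
    have hblock : n ∈ u.std.block a :=
      Finset.mem_union_left _ (Finset.mem_filter.2 ⟨Finset.mem_Icc.2 ⟨hpos, le_rfl⟩, ha⟩)
    have hB : u.std.block a ∈ u.blocks := List.mem_map.2 ⟨a, List.mem_range.2 hlt, rfl⟩
    calc n ≤ (u.std.block a).sup id := Finset.le_sup (f := id) hblock
      _ ≤ _ := List.le_sum_of_mem (List.mem_map.2 ⟨_, hB, rfl⟩)
  exact Nat.add_le_add hodd hword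

/-- The monomial quasisymmetric function `M_I`, the sum of all monomials `u` with `I(u) = I`. -/
noncomputable def monomialM (I : List (Finset ℕ)) : sNCQSym :=
  ⟨⟨fun u => if u.blocks = I then 1 else 0, by
      refine ⟨I.length + (I.map (fun B => B.sup id)).sum, fun u hu => ?_⟩
      have h : u.blocks = I := by
        by_contra h
        exact hu (if_neg h)
      exact h ▸ degree_le_of_blocks u⟩,
    fun u v h => by
      have hb : u.blocks = v.blocks := by unfold SMonomial.blocks; rw [h]
      change (if u.blocks = I then (1 : ℚ) else 0) = if v.blocks = I then 1 else 0
      rw [hb]⟩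

/-- The blocks `(I_{i_1}, …, I_{i_s})` of `I` with `A = {i_1 < ⋯ < i_s}`. -/
def subBlocks (I : List (Finset ℕ)) (A : Finset (Fin I.length)) : List (Finset ℕ) :=
  (A.sort (· ≤ ·)).map I.get

/-- The standardization of a sequence of sets: the nonzero elements of the union are replaced by
`1, …, n` in increasing order, and `0` by `0`. -/
def stdBlocks (I : List (Finset ℕ)) : List (Finset ℕ) :=
  I.map (Finset.image (fun t =>
    ((I.foldr (· ∪ ·) ∅).filter (fun s => 0 < s ∧ s ≤ t)).card))

/-- `inv_I(σ)`. -/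
def invPerm (I : List (Finset ℕ)) (σ : Equiv.Perm (Fin I.length)) : ℕ :=
  (Finset.univ.filter (fun p : Fin I.length × Fin I.length =>
    p.1 < p.2 ∧ 0 ∈ I.get p.1 ∧ 0 ∈ I.get p.2 ∧ σ.symm p.2 < σ.symm p.1)).card

/-- `inv_I(A)`: the number of pairs `p < q` of indices of fermionic blocks, `p ∉ A`, `q ∈ A`. -/
def invSubset (I : List (Finset ℕ)) (A : Finset (Fin I.length)) : ℕ :=
  ((Aᶜ ×ˢ A).filter (fun p => p.1 < p.2 ∧ 0 ∈ I.get p.1 ∧ 0 ∈ I.get p.2)).card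

/-- The monomial symmetric function `m_I = ∑_σ (-1)^{inv_I(σ)} M_{I^σ}`. -/
noncomputable def monomialSym (I : List (Finset ℕ)) : sNCQSym :=
  ∑ σ : Equiv.Perm (Fin I.length),
    (-1 : ℚ) ^ invPerm I σ • monomialM (List.ofFn fun r => I.get (σ r))

end Monomial

end SuperNC

/-!
Everything is reduced to lists of indices.  For a standard monomial `s` let `M_s` be the sum of all
monomials with standardization `s`; these functions form a basis of `sNCQSym` (`stdBasis`).  More
generally a monomial `t` and a list `L` of some of its indices give the standard monomial
`t.relabel L`, obtained by keeping the letters of `L` and renaming each to its position in `L`.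

*Coproduct.*  A product of a monomial in `x, θ` and a monomial in `y, ϑ` has its indices in `x, θ`
first, so the product monomials with standardization `t.relabel L` correspond to the ways of cutting
`L` in two (`sum_wordFibre_std_eq`).  Hence the evaluation on two alphabets is the deconcatenation
`M_{t.relabel L} ↦ ∑ M_{t.relabel (L.take i)} ⊗ M_{t.relabel (L.drop i)}`, which gives
coassociativity and the counit.  Comparing coefficients embeds `sNCQSym ⊗ sNCQSym` into the series
in two commuting alphabets (`tensorCoeff_injective`), in which the sign rule of the graded tensor
product is the anticommutation of `θ` and `ϑ`.  Since both the evaluation and the passage to commuting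
alphabets are multiplicative (`evalAlphabet_mul`, `projCommute_mul`), so is the coproduct.

*Antipode.*  Deconcatenation shortens lists, so `ηε - id` is locally nilpotent for convolution
(`convDefect_pow_stdM`), and the antipode is the geometric series `∑ (ηε - id)ⁿ`.  It therefore
preserves parity, and every subspace that is both a subalgebra and a subcoalgebra
(`convInverse_mem`).

*Symmetric functions.*  The function `m_I` is a signed sum over the orderings of the index set, the
sign being that of sorting the odd letters.  Read as a formula for coefficients
(`monomialSym_apply_eq_sum_orderings`) this shows that `m_I` is symmetric.  Read as a combination of
the `M_{t.relabel L}` (`monomialSym_stdBlocks_subBlocks`) it gives the coproduct of `m_I`: an ordering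
of `[k]` that is cut in two is a subset `A` with an ordering of `A` and one of its complement, and
the signs multiply up to the pairs with one member in each (`sum_orderings_deconcatenation`).

*Basis.*  Set superpartitions are sorted sequences of distinct blocks, so the coefficients of `m_I`
at the monomials of set superpartitions form the identity matrix.  A symmetric function that
vanishes at those monomials is zero (`eq_zero_of_mem_sNCSym`): a monomial with distinct blocks can be
sorted by a permutation, and if two blocks are equal, both are `{0}`, and the transposition of their
indices fixes the monomial but changes the sign.  So the `m_I` form a basis of `sNCSym`, and the
formula for their coproduct shows that `sNCSym` is a subcoalgebra.
-/

namespace SuperNC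

/-! ### Relabelling monomials along lists of indices -/

section Relabel
variable {α β : Type*} [LinearOrder α] [LinearOrder β]

/-- The monomial obtained from `u` by keeping only the letters in the list `L` and renaming each of
them to its position in `L`. -/
def SMonomial.relabel (u : SMonomial α) (L : List α) : SMonomial ℕ :=
  ⟨(u.odd.filter (· ∈ L)).image (fun a => L.idxOf a),
    (u.word.filter (· ∈ L)).map (fun a => L.idxOf a)⟩

/-- `L` lists, without repetition, some of the indices of `u`. -/
def SMonomial.Lists (u : SMonomial α) (L : List α) : Prop := L.Nodup ∧ ∀ a ∈ L, a ∈ u.ind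

theorem SMonomial.Lists.take {u : SMonomial α} {L : List α} (h : u.Lists L) (i : ℕ) :
    u.Lists (L.take i) :=
  ⟨h.1.sublist (List.take_sublist _ _), fun a ha => h.2 a (List.mem_of_mem_take ha)⟩

theorem SMonomial.Lists.drop {u : SMonomial α} {L : List α} (h : u.Lists L) (i : ℕ) :
    u.Lists (L.drop i) :=
  ⟨h.1.sublist (List.drop_sublist _ _), fun a ha => h.2 a (List.mem_of_mem_drop ha)⟩

theorem SMonomial.mem_ind {u : SMonomial α} {a : α} : a ∈ u.ind ↔ a ∈ u.odd ∨ a ∈ u.word := by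
  simp [SMonomial.ind]

theorem SMonomial.mem_ind_relabel {u : SMonomial α} {L : List α} {n : ℕ} :
    n ∈ (u.relabel L).ind ↔ ∃ a ∈ L, a ∈ u.ind ∧ L.idxOf a = n := by
  simp only [mem_ind, relabel, Finset.mem_image, Finset.mem_filter, List.mem_map, List.mem_filter,
    decide_eq_true_eq]
  constructor
  · rintro (⟨a, h, rfl⟩ | ⟨a, h, rfl⟩)
    · exact ⟨a, h.2, Or.inl h.1, rfl⟩
    · exact ⟨a, h.2, Or.inr h.1, rfl⟩
  · rintro ⟨a, h, h1 | h1, rfl⟩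
    · exact Or.inl ⟨a, ⟨h1, h⟩, rfl⟩
    · exact Or.inr ⟨a, ⟨h1, h⟩, rfl⟩

theorem SMonomial.ind_relabel {u : SMonomial α} {L : List α} (h : u.Lists L) :
    (u.relabel L).ind = Finset.range L.length := by
  ext n
  rw [mem_ind_relabel, Finset.mem_range]
  constructor
  · rintro ⟨a, ha, -, rfl⟩
    exact List.idxOf_lt_length_of_mem ha
  · intro hn
    exact ⟨L[n], List.getElem_mem hn, h.2 _ (List.getElem_mem hn), h.1.idxOf_getElem n hn⟩

theorem rank_range {k a : ℕ} (h : a < k) : rank (Finset.range k) a = a := by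
  unfold rank
  have : (Finset.range k).filter (· < a) = Finset.range a := by
    ext x; simp; omega
  rw [this, Finset.card_range]

/-- In an increasing list, the position of an entry is its rank. -/
theorem idxOf_eq_rank {L : List α} (h : L.Pairwise (· < ·)) {a : α} (ha : a ∈ L) :
    L.idxOf a = rank L.toFinset a := by
  induction L with
  | nil => simp at ha
  | cons b L ih =>
    rw [List.pairwise_cons] at h
    have hb : b ∉ L := fun hb => lt_irrefl _ (h.1 b hb)
    rcases eq_or_ne b a with rfl | hne
    · rw [List.idxOf_cons_self, rank]
      symm
      rw [Finset.card_eq_zero, Finset.filter_eq_empty_iff]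
      intro x hx
      rw [List.mem_toFinset, List.mem_cons] at hx
      rcases hx with rfl | hx
      · exact lt_irrefl _
      · exact (h.1 x hx).le.not_gt
    · have ha' : a ∈ L := by simpa [hne.symm] using ha
      rw [List.idxOf_cons_ne _ hne, ih h.2 ha', rank, rank, List.toFinset_cons,
        Finset.filter_insert, if_pos (h.1 a ha'), Finset.card_insert_of_notMem]
      simp [hb]

theorem SMonomial.relabel_eq_map {u : SMonomial α} {L : List α} (h : ∀ a ∈ u.ind, a ∈ L) :
    u.relabel L = u.map (fun a => L.idxOf a) := by
  unfold relabel map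
  rw [Finset.filter_true_of_mem fun a ha => h a (mem_ind.2 (Or.inl ha)), List.filter_eq_self.2]
  intro a ha
  simpa using h a (mem_ind.2 (Or.inr ha))

/-- Standardization is relabelling along the increasing list of indices. -/
theorem SMonomial.std_eq_relabel (u : SMonomial α) : u.std = u.relabel (u.ind.sort (· ≤ ·)) := by
  rw [relabel_eq_map (by simp)]
  have h : ∀ a ∈ u.ind, rank u.ind a = (u.ind.sort (· ≤ ·)).idxOf a := by
    intro a ha
    rw [idxOf_eq_rank (Finset.sortedLT_sort _).pairwise ((Finset.mem_sort _).2 ha),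
      Finset.sort_toFinset]
  unfold std map
  congr 1
  · exact Finset.image_congr fun a ha => h a (mem_ind.2 (Or.inl ha))
  · exact List.map_congr_left fun a ha => h a (mem_ind.2 (Or.inr ha))

theorem SMonomial.lists_sort (u : SMonomial α) : u.Lists (u.ind.sort (· ≤ ·)) :=
  ⟨Finset.sort_nodup _ _, fun _ ha => (Finset.mem_sort _).1 ha⟩

theorem SMonomial.ind_std (u : SMonomial α) : u.std.ind = Finset.range u.ind.card := by
  rw [std_eq_relabel, ind_relabel u.lists_sort, Finset.length_sort]

theorem SMonomial.std_of_ind_eq_range {u : SMonomial ℕ} {k : ℕ} (h : u.ind = Finset.range k) :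
    u.std = u := by
  have h1 : ∀ a ∈ u.ind, rank u.ind a = a := fun a ha => by
    rw [h] at ha ⊢
    exact rank_range (Finset.mem_range.1 ha)
  unfold std map
  apply SMonomial.ext
  · change u.odd.image _ = _
    rw [Finset.image_congr (g := id) fun a ha => h1 a (mem_ind.2 (Or.inl ha)), Finset.image_id]
  · change u.word.map _ = _
    rw [List.map_congr_left (g := id) fun a ha => h1 a (mem_ind.2 (Or.inr ha)), List.map_id]

theorem SMonomial.std_std (u : SMonomial α) : u.std.std = u.std := std_of_ind_eq_range u.ind_std

theorem SMonomial.std_relabel {u : SMonomial α} {L : List α} (h : u.Lists L) :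
    (u.relabel L).std = u.relabel L := std_of_ind_eq_range (ind_relabel h)

/-- Relabelling is insensitive to injective renamings. -/
theorem SMonomial.relabel_map {u : SMonomial α} {N : List α} (φ : α → β)
    (h : Set.InjOn φ {a | a ∈ u.ind ∨ a ∈ N}) : (u.map φ).relabel (N.map φ) = u.relabel N := by
  have hmem : ∀ a ∈ u.ind, (φ a ∈ N.map φ ↔ a ∈ N) := by
    intro a ha
    refine ⟨fun hm => ?_, List.mem_map_of_mem⟩
    obtain ⟨b, hb, hab⟩ := List.mem_map.1 hm
    exact h (Or.inr hb) (Or.inl ha) hab ▸ hb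
  have hidx : ∀ a ∈ u.ind, (N.map φ).idxOf (φ a) = N.idxOf a := by
    intro a ha
    have : ∀ N' : List α, (∀ b ∈ N', b ∈ N) → (N'.map φ).idxOf (φ a) = N'.idxOf a := by
      intro N'
      induction N' with
      | nil => simp
      | cons b N' ih =>
        intro hN'
        rcases eq_or_ne b a with rfl | hne
        · simp
        · have hne' : φ b ≠ φ a := fun he => hne (h (Or.inr (hN' b (by simp))) (Or.inl ha) he)
          rw [List.map_cons, List.idxOf_cons_ne _ hne, List.idxOf_cons_ne _ hne',
            ih fun c hc => hN' c (by simp [hc])]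
    exact this N fun _ => id
  unfold relabel map
  apply SMonomial.ext
  · simp only [Finset.filter_image, Finset.image_image]
    rw [Finset.filter_congr fun a ha => hmem a (mem_ind.2 (Or.inl ha))]
    exact Finset.image_congr fun a ha =>
      hidx a (mem_ind.2 (Or.inl (Finset.mem_filter.1 (Finset.mem_coe.1 ha)).1))
  · simp only [List.filter_map, List.map_map]
    rw [List.filter_congr (q := fun a => decide (a ∈ N)) fun a ha => by
      simpa [Function.comp] using hmem a (mem_ind.2 (Or.inr ha))]
    exact List.map_congr_left fun a ha => hidx a (mem_ind.2 (Or.inr (List.mem_filter.1 ha).1))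

/-- Relabelling in two steps. -/
theorem SMonomial.relabel_relabel (u : SMonomial α) {L N : List α} (h : ∀ a ∈ N, a ∈ L) :
    (u.relabel L).relabel (N.map fun a => L.idxOf a) = u.relabel N := by
  have h1 : u.relabel L = SMonomial.map (fun a => L.idxOf a)
      ⟨u.odd.filter (· ∈ L), u.word.filter (· ∈ L)⟩ := rfl
  rw [h1, relabel_map]
  · unfold relabel
    apply SMonomial.ext
    · change Finset.image _ _ = Finset.image _ _
      congr 1
      ext a
      simp only [Finset.mem_filter]
      exact ⟨fun ⟨h1, h2⟩ => ⟨h1.1, h2⟩, fun ⟨h1, h2⟩ => ⟨⟨h1, h a h2⟩, h2⟩⟩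
    · change List.map _ _ = List.map _ _
      congr 1
      rw [List.filter_filter]
      refine List.filter_congr fun a _ => ?_
      by_cases ha : a ∈ N
      · simp [ha, h a ha]
      · simp [ha]
  · intro a ha b _ hab
    refine (List.idxOf_inj ?_).1 hab
    rcases ha with ha | ha
    · rw [mem_ind] at ha
      simpa using ha.elim (fun h => (Finset.mem_filter.1 h).2)
        (fun h => by simpa using (List.mem_filter.1 h).2)
    · exact h a ha

theorem map_idxOf_self {L : List α} (h : L.Nodup) :
    (L.map fun a => L.idxOf a) = List.range L.length := by
  apply List.ext_getElem
  · simp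
  · intro i h1 h2
    simpa using h.idxOf_getElem i (by simpa using h1)

theorem SMonomial.relabel_relabel_of_eq (u : SMonomial α) {L : List α} {N : List ℕ}
    {N' : List α} (hN : N = N'.map fun a => L.idxOf a) (hN' : ∀ a ∈ N', a ∈ L) :
    (u.relabel L).relabel N = u.relabel N' := by
  rw [hN, relabel_relabel u hN']

theorem SMonomial.relabel_take (u : SMonomial α) {L : List α} (h : L.Nodup) (i : ℕ) :
    (u.relabel L).relabel ((List.range L.length).take i) = u.relabel (L.take i) :=
  relabel_relabel_of_eq u (by rw [List.map_take, map_idxOf_self h]) fun _ => List.mem_of_mem_take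

theorem SMonomial.relabel_drop (u : SMonomial α) {L : List α} (h : L.Nodup) (i : ℕ) :
    (u.relabel L).relabel ((List.range L.length).drop i) = u.relabel (L.drop i) :=
  relabel_relabel_of_eq u (by rw [List.map_drop, map_idxOf_self h]) fun _ => List.mem_of_mem_drop

theorem SMonomial.length_eq_of_relabel_eq {u : SMonomial α} {v : SMonomial β} {L : List α}
    {N : List β} (hu : u.Lists L) (hv : v.Lists N) (h : u.relabel L = v.relabel N) :
    L.length = N.length := by
  have := congrArg SMonomial.ind h
  rw [ind_relabel hu, ind_relabel hv] at this
  simpa using congrArg Finset.card this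

/-- The odd letters of a relabelling along a concatenation; those listed in the second part are
shifted by the length of the first. -/
theorem SMonomial.odd_relabel_append (u : SMonomial α) {L N : List α} (h : L.Disjoint N) :
    (u.relabel (L ++ N)).odd =
      (u.relabel L).odd ∪ (u.relabel N).odd.image (L.length + ·) := by
  ext n
  simp only [relabel, Finset.mem_image, Finset.mem_filter, List.mem_append, Finset.mem_union]
  constructor
  · rintro ⟨a, ⟨ha, h1 | h1⟩, rfl⟩
    · exact Or.inl ⟨a, ⟨ha, h1⟩, (List.idxOf_append_of_mem h1).symm⟩
    · refine Or.inr ⟨_, ⟨a, ⟨ha, h1⟩, rfl⟩, ?_⟩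
      rw [List.idxOf_append_of_notMem fun h2 => h h2 h1]
  · rintro (⟨a, ⟨ha, h1⟩, rfl⟩ | ⟨_, ⟨a, ⟨ha, h1⟩, rfl⟩, rfl⟩)
    · exact ⟨a, ⟨ha, Or.inl h1⟩, List.idxOf_append_of_mem h1⟩
    · exact ⟨a, ⟨ha, Or.inr h1⟩, List.idxOf_append_of_notMem fun h2 => h h2 h1⟩

end Relabel

/-! ### Monomials over the duplicated alphabet -/

section Words
variable {α β : Type*}

theorem forall_lex_sum {p : α ⊕ₗ β → Prop} :
    (∀ c, p c) ↔ (∀ a, p (toLex (Sum.inl a))) ∧ ∀ b, p (toLex (Sum.inr b)) := by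
  refine ⟨fun h => ⟨fun a => h _, fun b => h _⟩, fun h c => ?_⟩
  rcases hc : ofLex c with a | b
  · exact (congrArg p (show c = toLex (Sum.inl a) from hc)).mpr (h.1 a)
  · exact (congrArg p (show c = toLex (Sum.inr b) from hc)).mpr (h.2 b)

theorem mem_of_mem_wordFibre_inl {w : List α} {w' : List β} {z : List (α ⊕ₗ β)}
    (h : z ∈ wordFibre w w') {a : α} : toLex (Sum.inl a) ∈ z ↔ a ∈ w := by
  rw [← h.1, List.mem_filterMap]
  constructor
  · intro ha
    exact ⟨_, ha, by simp⟩
  · rintro ⟨c, hc, hca⟩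
    rw [Sum.getLeft?_eq_some_iff] at hca
    rw [← hca]
    exact hc

theorem mem_of_mem_wordFibre_inr {w : List α} {w' : List β} {z : List (α ⊕ₗ β)}
    (h : z ∈ wordFibre w w') {b : β} : toLex (Sum.inr b) ∈ z ↔ b ∈ w' := by
  rw [← h.2, List.mem_filterMap]
  constructor
  · intro ha
    exact ⟨_, ha, by simp⟩
  · rintro ⟨c, hc, hca⟩
    rw [Sum.getRight?_eq_some_iff] at hca
    rw [← hca]
    exact hc

theorem inl_lex_injective : Function.Injective (fun a : α => (toLex (Sum.inl a) : α ⊕ₗ β)) :=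
  fun _ _ h => Sum.inl_injective (toLex.injective h)

theorem inr_lex_injective : Function.Injective (fun b : β => (toLex (Sum.inr b) : α ⊕ₗ β)) :=
  fun _ _ h => Sum.inr_injective (toLex.injective h)

end Words

section Duplication
variable {α β : Type*} [LinearOrder α] [LinearOrder β]

theorem mem_odd_dupMonomial_inl {u : SMonomial α} {v : SMonomial β} {z : List (α ⊕ₗ β)} {a : α} :
    toLex (Sum.inl a) ∈ (dupMonomial u v z).odd ↔ a ∈ u.odd := by
  simp only [dupMonomial, Finset.mem_union, Finset.mem_map]
  constructor
  · rintro (⟨b, hb, h⟩ | ⟨b, hb, h⟩)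
    · exact inl_lex_injective h ▸ hb
    · exact absurd (toLex.injective h) (by simp)
  · exact fun h => Or.inl ⟨a, h, rfl⟩

theorem mem_odd_dupMonomial_inr {u : SMonomial α} {v : SMonomial β} {z : List (α ⊕ₗ β)} {b : β} :
    toLex (Sum.inr b) ∈ (dupMonomial u v z).odd ↔ b ∈ v.odd := by
  simp only [dupMonomial, Finset.mem_union, Finset.mem_map]
  constructor
  · rintro (⟨a, ha, h⟩ | ⟨a, ha, h⟩)
    · exact absurd (toLex.injective h) (by simp)
    · exact inr_lex_injective h ▸ ha
  · exact fun h => Or.inr ⟨b, h, rfl⟩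

/-- A word is determined by its relabelling along a list that contains its letters. -/
theorem word_eq_of_relabel_eq {u v : SMonomial α} {L : List α} (hu : ∀ a ∈ u.word, a ∈ L)
    (hv : ∀ a ∈ v.word, a ∈ L) (h : u.relabel L = v.relabel L) : u.word = v.word := by
  have h1 := congrArg SMonomial.word h
  simp only [SMonomial.relabel] at h1
  rw [List.filter_eq_self.2 fun c hc => by simpa using hu c hc,
    List.filter_eq_self.2 fun c hc => by simpa using hv c hc] at h1
  have hlen : u.word.length = v.word.length := by simpa using congrArg List.length h1
  apply List.ext_getElem hlen
  intro i hi hi'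
  have h2 : (u.word.map fun a => L.idxOf a)[i]? = (v.word.map fun a => L.idxOf a)[i]? := by rw [h1]
  simp only [List.getElem?_map, List.getElem?_eq_getElem hi, List.getElem?_eq_getElem hi',
    Option.map_some, Option.some.injEq] at h2
  exact (List.idxOf_inj (hu _ (List.getElem_mem hi))).1 h2

theorem idxOf_map_of_injective {γ δ : Type*} [DecidableEq γ] [DecidableEq δ] {φ : γ → δ}
    (h : Function.Injective φ) (N : List γ) (a : γ) : (N.map φ).idxOf (φ a) = N.idxOf a := by
  induction N with
  | nil => simp
  | cons b N ih =>
    rcases eq_or_ne b a with rfl | hne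
    · simp
    · rw [List.map_cons, List.idxOf_cons_ne _ hne, List.idxOf_cons_ne _ (h.ne hne), ih]

/-- The letters `x, θ` of `u` are recovered from a product monomial over the duplicated alphabet. -/
theorem relabel_dupMonomial_inl {u : SMonomial α} {v : SMonomial β} {z : List (α ⊕ₗ β)}
    (hz : z ∈ wordFibre u.word v.word) (N : List α) :
    (dupMonomial u v z).relabel (N.map fun a => toLex (Sum.inl a)) = u.relabel N := by
  apply SMonomial.ext
  · ext n
    simp only [SMonomial.relabel, Finset.mem_image, Finset.mem_filter]
    constructor
    · rintro ⟨c, ⟨h1, h2⟩, rfl⟩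
      obtain ⟨a, ha, rfl⟩ := List.mem_map.1 h2
      exact ⟨a, ⟨mem_odd_dupMonomial_inl.1 h1, ha⟩,
        (idxOf_map_of_injective inl_lex_injective N a).symm⟩
    · rintro ⟨a, ⟨h1, h2⟩, rfl⟩
      exact ⟨toLex (Sum.inl a), ⟨mem_odd_dupMonomial_inl.2 h1, List.mem_map.2 ⟨a, h2, rfl⟩⟩,
        idxOf_map_of_injective inl_lex_injective N a⟩
  · change (z.filter _).map _ = (u.word.filter _).map _
    rw [← hz.1]
    clear hz
    induction z with
    | nil => rfl
    | cons c z ih =>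
      revert c
      rw [forall_lex_sum]
      refine ⟨fun a => ?_, fun b => ?_⟩
      · have hi := idxOf_map_of_injective (inl_lex_injective (β := β)) N a
        by_cases ha : a ∈ N
        · have : (toLex (Sum.inl a) : α ⊕ₗ β) ∈ N.map fun a => toLex (Sum.inl a) :=
            List.mem_map.2 ⟨a, ha, rfl⟩
          rw [List.filter_cons_of_pos (by simpa using ha)]
          simp only [List.map_cons, List.filterMap_cons, ofLex_toLex, Sum.getLeft?_inl]
          rw [List.filter_cons_of_pos (by simpa using ha), List.map_cons, ih]
          exact congrArg (· :: _) hi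
        · rw [List.filter_cons_of_neg (by simpa using ha)]
          simp only [List.filterMap_cons, ofLex_toLex, Sum.getLeft?_inl]
          rw [List.filter_cons_of_neg (by simpa using ha), ih]
      · rw [List.filter_cons_of_neg (by simp)]
        simp only [List.filterMap_cons, ofLex_toLex, Sum.getLeft?_inr]
        exact ih

/-- The letters `y, ϑ` of `v` are recovered from a product monomial over the duplicated alphabet. -/
theorem relabel_dupMonomial_inr {u : SMonomial α} {v : SMonomial β} {z : List (α ⊕ₗ β)}
    (hz : z ∈ wordFibre u.word v.word) (N : List β) :
    (dupMonomial u v z).relabel (N.map fun b => toLex (Sum.inr b)) = v.relabel N := by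
  apply SMonomial.ext
  · ext n
    simp only [SMonomial.relabel, Finset.mem_image, Finset.mem_filter]
    constructor
    · rintro ⟨c, ⟨h1, h2⟩, rfl⟩
      obtain ⟨a, ha, rfl⟩ := List.mem_map.1 h2
      exact ⟨a, ⟨mem_odd_dupMonomial_inr.1 h1, ha⟩,
        (idxOf_map_of_injective inr_lex_injective N a).symm⟩
    · rintro ⟨a, ⟨h1, h2⟩, rfl⟩
      exact ⟨toLex (Sum.inr a), ⟨mem_odd_dupMonomial_inr.2 h1, List.mem_map.2 ⟨a, h2, rfl⟩⟩,
        idxOf_map_of_injective inr_lex_injective N a⟩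
  · change (z.filter _).map _ = (v.word.filter _).map _
    rw [← hz.2]
    clear hz
    induction z with
    | nil => rfl
    | cons c z ih =>
      revert c
      rw [forall_lex_sum]
      refine ⟨fun a => ?_, fun b => ?_⟩
      · rw [List.filter_cons_of_neg (by simp)]
        simp only [List.filterMap_cons, ofLex_toLex, Sum.getRight?_inl]
        exact ih
      · have hi := idxOf_map_of_injective (inr_lex_injective (α := α)) N b
        by_cases ha : b ∈ N
        · rw [List.filter_cons_of_pos (by simpa using ha)]
          simp only [List.map_cons, List.filterMap_cons, ofLex_toLex, Sum.getRight?_inr]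
          rw [List.filter_cons_of_pos (by simpa using ha), List.map_cons, ih]
          exact congrArg (· :: _) hi
        · rw [List.filter_cons_of_neg (by simpa using ha)]
          simp only [List.filterMap_cons, ofLex_toLex, Sum.getRight?_inr]
          rw [List.filter_cons_of_neg (by simpa using ha), ih]

/-- The increasing list of the indices of a product monomial over the duplicated alphabet. -/
def dupIndices (u : SMonomial α) (v : SMonomial β) : List (α ⊕ₗ β) :=
  (u.ind.sort (· ≤ ·)).map (fun a => toLex (Sum.inl a)) ++
    (v.ind.sort (· ≤ ·)).map (fun b => toLex (Sum.inr b))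

theorem pairwise_dupIndices (u : SMonomial α) (v : SMonomial β) :
    (dupIndices u v).Pairwise (· < ·) := by
  unfold dupIndices
  rw [List.pairwise_append, List.pairwise_map, List.pairwise_map]
  refine ⟨(Finset.sortedLT_sort _).pairwise.imp fun h => Sum.Lex.inl_lt_inl_iff.2 h,
    (Finset.sortedLT_sort _).pairwise.imp fun h => Sum.Lex.inr_lt_inr_iff.2 h, ?_⟩
  intro x hx y hy
  obtain ⟨a, -, rfl⟩ := List.mem_map.1 hx
  obtain ⟨b, -, rfl⟩ := List.mem_map.1 hy
  exact Sum.Lex.inl_lt_inr a b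

theorem sort_ind_dupMonomial {u : SMonomial α} {v : SMonomial β} {z : List (α ⊕ₗ β)}
    (hz : z ∈ wordFibre u.word v.word) :
    (dupMonomial u v z).ind.sort (· ≤ ·) = dupIndices u v := by
  have h1 : (dupMonomial u v z).ind = (dupIndices u v).toFinset := by
    rw [Finset.ext_iff, forall_lex_sum]
    constructor
    · intro a
      rw [SMonomial.mem_ind, mem_odd_dupMonomial_inl, List.mem_toFinset]
      change _ ∨ _ ∈ z ↔ _
      rw [mem_of_mem_wordFibre_inl hz]
      simp [dupIndices, SMonomial.mem_ind]
    · intro a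
      rw [SMonomial.mem_ind, mem_odd_dupMonomial_inr, List.mem_toFinset]
      change _ ∨ _ ∈ z ↔ _
      rw [mem_of_mem_wordFibre_inr hz]
      simp [dupIndices, SMonomial.mem_ind]
  rw [h1, (List.toFinset_sort _ ((pairwise_dupIndices u v).imp fun h => h.ne)).2
    ((pairwise_dupIndices u v).imp fun h => h.le)]

theorem std_dupMonomial {u : SMonomial α} {v : SMonomial β} {z : List (α ⊕ₗ β)}
    (hz : z ∈ wordFibre u.word v.word) :
    (dupMonomial u v z).std = (dupMonomial u v z).relabel (dupIndices u v) := by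
  rw [SMonomial.std_eq_relabel, sort_ind_dupMonomial hz]

theorem lists_dupIndices {u : SMonomial α} {v : SMonomial β} {z : List (α ⊕ₗ β)}
    (hz : z ∈ wordFibre u.word v.word) : (dupMonomial u v z).Lists (dupIndices u v) :=
  sort_ind_dupMonomial hz ▸ SMonomial.lists_sort _

/-- A word over the duplicated alphabet is determined by the standardization of the product
monomial and its two commuting factors. -/
theorem eq_of_std_dupMonomial_eq {u : SMonomial α} {v : SMonomial β} {z z' : List (α ⊕ₗ β)}
    (hz : z ∈ wordFibre u.word v.word) (hz' : z' ∈ wordFibre u.word v.word)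
    (h : (dupMonomial u v z).std = (dupMonomial u v z').std) : z = z' := by
  have key : ∀ y ∈ wordFibre u.word v.word, ∀ c ∈ y, c ∈ dupIndices u v := by
    intro y hy c hc
    rw [← sort_ind_dupMonomial hy, Finset.mem_sort, SMonomial.mem_ind]
    exact Or.inr hc
  rw [std_dupMonomial hz, std_dupMonomial hz'] at h
  exact word_eq_of_relabel_eq (key z hz) (key z' hz') h

/-- Cutting a product monomial between the two alphabets. -/
theorem relabel_of_std_dupMonomial_eq {γ : Type*} [LinearOrder γ] {u : SMonomial α}
    {v : SMonomial β} {z : List (α ⊕ₗ β)} (hz : z ∈ wordFibre u.word v.word) {t : SMonomial γ}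
    {L : List γ} (hL : t.Lists L) (h : (dupMonomial u v z).std = t.relabel L) :
    u.ind.card ≤ L.length ∧ u.std = t.relabel (L.take u.ind.card) ∧
      v.std = t.relabel (L.drop u.ind.card) := by
  rw [std_dupMonomial hz] at h
  have hlen := SMonomial.length_eq_of_relabel_eq (lists_dupIndices hz) hL h
  have hD := (lists_dupIndices hz).1
  have hcard : ((u.ind.sort (· ≤ ·)).map (fun a => (toLex (Sum.inl a) : α ⊕ₗ β))).length =
      u.ind.card := by simp
  refine ⟨?_, ?_, ?_⟩
  · rw [← hlen]
    simp [dupIndices]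
  · rw [← SMonomial.relabel_take t hL.1, ← h, ← hlen, SMonomial.relabel_take _ hD, dupIndices,
      List.take_left' hcard, relabel_dupMonomial_inl hz, SMonomial.std_eq_relabel]
  · rw [← SMonomial.relabel_drop t hL.1, ← h, ← hlen, SMonomial.relabel_drop _ hD, dupIndices,
      List.drop_left' hcard, relabel_dupMonomial_inr hz, SMonomial.std_eq_relabel]

theorem map_getD_idxOf (d : α) {N w : List α}
    (h : ∀ a ∈ w, a ∈ N) : (w.map fun a => N.idxOf a).map (fun n => N.getD n d) = w := by
  rw [List.map_map]
  conv_rhs => rw [← List.map_id w]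
  refine List.map_congr_left fun a ha => ?_
  have := List.idxOf_lt_length_of_mem (h a ha)
  simp [List.getElem?_eq_getElem this]

end Duplication

/-! ### Product monomials and cuts of a standard monomial -/

section Cut

theorem idxOf_getElem_of_nodup {γ : Type*} [LinearOrder γ] {L : List γ} (h : L.Nodup) {n : ℕ}
    (hn : n < L.length) : L.idxOf L[n] = n := h.idxOf_getElem n hn

theorem idxOf_range {i n : ℕ} (h : n < i) : (List.range i).idxOf n = n := by
  rw [idxOf_eq_rank List.pairwise_lt_range (List.mem_range.2 h), List.toFinset_range, rank_range h]

theorem idxOf_drop_range {k i n : ℕ} (h : i + n < k) :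
    ((List.range k).drop i).idxOf (i + n) = n := by
  have h1 : ((List.range k).drop i)[n]'(by simp; omega) = i + n := by simp
  conv_lhs => rw [← h1]
  exact List.Nodup.idxOf_getElem (List.nodup_range.sublist (List.drop_sublist _ _)) _ _

theorem getD_dupIndices_left {v w : SMonomial ℕ} {n : ℕ} (h : n < v.ind.card) (d : ℕ ⊕ₗ ℕ) :
    (dupIndices v w).getD n d = toLex (Sum.inl ((v.ind.sort (· ≤ ·)).getD n 0)) := by
  have h1 : n < (v.ind.sort (· ≤ ·)).length := by simpa using h
  simp [dupIndices, List.getElem?_append_left, h]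

theorem getD_dupIndices_right {v w : SMonomial ℕ} {n : ℕ} (h : n < w.ind.card) (d : ℕ ⊕ₗ ℕ) :
    (dupIndices v w).getD (v.ind.card + n) d =
      toLex (Sum.inr ((w.ind.sort (· ≤ ·)).getD n 0)) := by
  have h1 : n < (w.ind.sort (· ≤ ·)).length := by simpa using h
  simp [dupIndices, List.getElem?_append_right, List.getElem?_eq_getElem h1]

theorem word_relabel_take_range (s : SMonomial ℕ) {k i : ℕ} (h : i ≤ k) :
    (s.relabel ((List.range k).take i)).word = s.word.filter (· < i) := by
  simp only [SMonomial.relabel]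
  rw [List.take_range, min_eq_left h]
  have : s.word.filter (· ∈ List.range i) = s.word.filter (· < i) :=
    List.filter_congr fun n _ => by simp
  rw [this]
  conv_rhs => rw [← List.map_id (s.word.filter (· < i))]
  exact List.map_congr_left fun n hn => idxOf_range (by simpa using (List.mem_filter.1 hn).2)

theorem word_relabel_drop_range (s : SMonomial ℕ) {k i : ℕ} (hs : ∀ n ∈ s.word, n < k) :
    (s.relabel ((List.range k).drop i)).word = (s.word.filter (i ≤ ·)).map (· - i) := by
  simp only [SMonomial.relabel]
  have hmem : ∀ n, n ∈ (List.range k).drop i ↔ i ≤ n ∧ n < k := by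
    intro n
    rw [List.mem_iff_getElem]
    constructor
    · rintro ⟨j, hj, rfl⟩
      simp at hj ⊢
      omega
    · rintro ⟨h1, h2⟩
      exact ⟨n - i, by simp; omega, by simp; omega⟩
  have : s.word.filter (· ∈ (List.range k).drop i) = s.word.filter (i ≤ ·) :=
    List.filter_congr fun n hn => by simp [hmem, hs n hn]
  rw [this]
  refine List.map_congr_left fun n hn => ?_
  rw [List.mem_filter] at hn
  have h1 : i ≤ n := by simpa using hn.2
  have h2 := hs n hn.1
  obtain ⟨m, rfl⟩ := Nat.exists_eq_add_of_le h1
  rw [idxOf_drop_range h2]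
  simp

/-- When each letter `n` of a word is replaced by the `n`-th index of a product monomial with factors
`v` and `w`, the letters less than the number of indices of `v` become those of the first alphabet. -/
theorem filterMap_left_dup {v w : SMonomial ℕ} (d : ℕ ⊕ₗ ℕ) (x : List ℕ)
    (hx : ∀ n ∈ x, n < v.ind.card + w.ind.card) :
    (x.map fun n => (dupIndices v w).getD n d).filterMap (fun c => (ofLex c).getLeft?) =
      (x.filter (· < v.ind.card)).map (fun n => (v.ind.sort (· ≤ ·)).getD n 0) := by
  induction x with
  | nil => rfl
  | cons n x ih =>
    have ih' := ih fun m hm => hx m (List.mem_cons_of_mem _ hm)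
    by_cases hn : n < v.ind.card
    · rw [List.filter_cons_of_pos (by simpa using hn), List.map_cons, List.map_cons,
        getD_dupIndices_left hn, ← ih']
      exact List.filterMap_cons_some rfl
    · obtain ⟨m, rfl⟩ := Nat.exists_eq_add_of_le (not_lt.1 hn)
      have hm : m < w.ind.card := by
        have := hx _ List.mem_cons_self
        omega
      rw [List.filter_cons_of_neg (by simp), List.map_cons, getD_dupIndices_right hm, ← ih']
      exact List.filterMap_cons_none rfl

/-- When each letter `n` of a word is replaced by the `n`-th index of a product monomial with factors
`v` and `w`, the remaining letters become those of the second alphabet. -/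
theorem filterMap_right_dup {v w : SMonomial ℕ} (d : ℕ ⊕ₗ ℕ) (x : List ℕ)
    (hx : ∀ n ∈ x, n < v.ind.card + w.ind.card) :
    (x.map fun n => (dupIndices v w).getD n d).filterMap (fun c => (ofLex c).getRight?) =
      ((x.filter (v.ind.card ≤ ·)).map (· - v.ind.card)).map
        (fun n => (w.ind.sort (· ≤ ·)).getD n 0) := by
  induction x with
  | nil => rfl
  | cons n x ih =>
    have ih' := ih fun m hm => hx m (List.mem_cons_of_mem _ hm)
    by_cases hn : n < v.ind.card
    · rw [List.filter_cons_of_neg (by simpa using hn), List.map_cons,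
        getD_dupIndices_left hn, ← ih']
      exact List.filterMap_cons_none rfl
    · obtain ⟨m, rfl⟩ := Nat.exists_eq_add_of_le (not_lt.1 hn)
      have hm : m < w.ind.card := by
        have := hx _ List.mem_cons_self
        omega
      rw [List.filter_cons_of_pos (by simp), List.map_cons, getD_dupIndices_right hm,
        List.map_cons, List.map_cons, ← ih', Nat.add_sub_cancel_left]
      exact List.filterMap_cons_some rfl

theorem map_getD_word_std (v : SMonomial ℕ) :
    v.std.word.map (fun n => (v.ind.sort (· ≤ ·)).getD n 0) = v.word := by
  have hv : ∀ a ∈ v.word, a ∈ v.ind.sort (· ≤ ·) := fun a ha =>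
    (Finset.mem_sort _).2 (SMonomial.mem_ind.2 (Or.inr ha))
  rw [SMonomial.std_eq_relabel]
  simp only [SMonomial.relabel]
  rw [List.filter_eq_self.2 fun c hc => by simpa using hv c hc, map_getD_idxOf 0 hv]

/-- Two monomials with the standardizations of the two halves of `s` are the factors of exactly one
product monomial with standardization `s`. -/
theorem exists_std_dupMonomial_eq {s v w : SMonomial ℕ} {k i : ℕ} (hs : s.ind = Finset.range k)
    (hi : i ≤ k) (hv : v.std = s.relabel ((List.range k).take i))
    (hw : w.std = s.relabel ((List.range k).drop i)) :
    ∃ z ∈ wordFibre v.word w.word, (dupMonomial v w z).std = s := by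
  have hL : s.Lists (List.range k) :=
    ⟨List.nodup_range, fun a ha => hs ▸ by simpa using ha⟩
  have hvc : v.ind.card = i := by
    rw [SMonomial.std_eq_relabel] at hv
    have := SMonomial.length_eq_of_relabel_eq v.lists_sort (hL.take i) hv
    simpa [hi] using this
  have hwc : w.ind.card = k - i := by
    rw [SMonomial.std_eq_relabel] at hw
    have := SMonomial.length_eq_of_relabel_eq w.lists_sort (hL.drop i) hw
    simpa using this
  have hlt : ∀ n ∈ s.word, n < k := by
    intro n hn
    have : n ∈ s.ind := SMonomial.mem_ind.2 (Or.inr hn)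
    simpa [hs] using this
  have hlt' : ∀ n ∈ s.word, n < v.ind.card + w.ind.card := by
    intro n hn
    have := hlt n hn
    omega
  let d : ℕ ⊕ₗ ℕ := toLex (Sum.inl 0)
  -- The product monomial is obtained from `s` by replacing `n` by the `n`-th index; the default value
  -- `d` is never used, as there are `k` indices.
  have hz : (s.word.map fun n => (dupIndices v w).getD n d) ∈ wordFibre v.word w.word := by
    refine ⟨?_, ?_⟩
    · rw [filterMap_left_dup d s.word hlt', hvc, ← word_relabel_take_range s hi, ← hv,
        map_getD_word_std]
    · rw [filterMap_right_dup d s.word hlt', hvc, ← word_relabel_drop_range s hlt, ← hw,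
        map_getD_word_std]
  refine ⟨_, hz, ?_⟩
  obtain ⟨z, hzdef⟩ : ∃ z, z = s.word.map fun n => (dupIndices v w).getD n d := ⟨_, rfl⟩
  rw [← hzdef] at hz ⊢
  rw [std_dupMonomial hz]
  have hss : s = s.relabel ((List.range k).take i ++ (List.range k).drop i) := by
    rw [List.take_append_drop, SMonomial.relabel_eq_map fun a ha => (by simpa [hs] using ha)]
    unfold SMonomial.map
    apply SMonomial.ext
    · change _ = s.odd.image _
      rw [Finset.image_congr (g := id) fun a ha => ?_, Finset.image_id]
      have : a ∈ s.ind := SMonomial.mem_ind.2 (Or.inl ha)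
      exact idxOf_range (by simpa [hs] using this)
    · change _ = s.word.map _
      have h5 : s.word.map (fun a => (List.range k).idxOf a) = s.word.map id :=
        List.map_congr_left fun a ha => idxOf_range (hlt a ha)
      rw [h5, List.map_id]
  apply SMonomial.ext
  · conv_rhs => rw [hss]
    rw [SMonomial.odd_relabel_append _ (List.disjoint_take_drop List.nodup_range le_rfl), dupIndices,
      SMonomial.odd_relabel_append, relabel_dupMonomial_inl hz, relabel_dupMonomial_inr hz,
      ← SMonomial.std_eq_relabel, ← SMonomial.std_eq_relabel, hv, hw]
    · congr 2
      simp [hvc, hi]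
    · intro c h1 h2
      obtain ⟨a, -, rfl⟩ := List.mem_map.1 h1
      obtain ⟨b, -, h⟩ := List.mem_map.1 h2
      exact absurd (toLex.injective h) (by simp)
  · have hlen : (dupIndices v w).length = v.ind.card + w.ind.card := by simp [dupIndices]
    have hmem : ∀ n ∈ s.word, (dupIndices v w).getD n d ∈ dupIndices v w := by
      intro n hn
      have := hlt' n hn
      rw [List.getD_eq_getElem _ _ (by omega)]
      exact List.getElem_mem _
    change (z.filter _).map _ = _
    rw [List.filter_eq_self.2, hzdef, List.map_map]
    · conv_rhs => rw [← List.map_id s.word]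
      refine List.map_congr_left fun n hn => ?_
      have := hlt' n hn
      have hn' : n < (dupIndices v w).length := by omega
      rw [Function.comp_apply, List.getD_eq_getElem _ _ hn']
      exact idxOf_getElem_of_nodup (lists_dupIndices hz).1 hn'
    · intro c hc
      rw [hzdef] at hc
      obtain ⟨n, hn, rfl⟩ := List.mem_map.1 hc
      simpa using hmem n hn

/-- Equality of monomials is decided classically, so that it can be used in Kronecker deltas. -/
noncomputable instance {γ : Type*} : DecidableEq (SMonomial γ) := Classical.decEq _

/-- The coefficients of the coproduct of a monomial quasisymmetric function: the product monomials
with a given standardization correspond to the cuts of that standardization. -/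
theorem sum_wordFibre_std_eq {γ : Type*} [LinearOrder γ] {t : SMonomial γ} {L : List γ}
    (hL : t.Lists L) (v w : SMonomial ℕ) :
    ∑ z ∈ (wordFibre_finite v.word w.word).toFinset,
        (if (dupMonomial v w z).std = t.relabel L then (1 : ℚ) else 0) =
      ∑ i ∈ Finset.range (L.length + 1), (if v.std = t.relabel (L.take i) then 1 else 0) *
        (if w.std = t.relabel (L.drop i) then 1 else 0) := by
  have hcard : ∀ i ∈ Finset.range (L.length + 1), v.std = t.relabel (L.take i) →
      i = v.ind.card := by
    intro i hi h
    rw [SMonomial.std_eq_relabel] at h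
    have := SMonomial.length_eq_of_relabel_eq v.lists_sort (hL.take i) h
    simp at this hi
    omega
  by_cases h : v.ind.card ≤ L.length ∧ v.std = t.relabel (L.take v.ind.card) ∧
      w.std = t.relabel (L.drop v.ind.card)
  · obtain ⟨h1, h2, h3⟩ := h
    have h4 := SMonomial.ind_relabel hL
    rw [← SMonomial.relabel_take t hL.1] at h2
    rw [← SMonomial.relabel_drop t hL.1] at h3
    obtain ⟨z, hz, hzs⟩ := exists_std_dupMonomial_eq h4 h1 h2 h3
    rw [SMonomial.relabel_take t hL.1] at h2
    rw [SMonomial.relabel_drop t hL.1] at h3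
    rw [Finset.sum_eq_single z, Finset.sum_eq_single v.ind.card, if_pos hzs, if_pos h2, if_pos h3,
      mul_one]
    · intro i hi hne
      rw [if_neg fun h => hne (hcard i hi h), zero_mul]
    · intro hn
      exact absurd (Finset.mem_range.2 (by omega)) hn
    · intro z' hz' hne
      rw [if_neg]
      intro h
      exact hne (eq_of_std_dupMonomial_eq (by simpa using hz') hz (h.trans hzs.symm))
    · intro hn
      exact absurd (by simpa using hz) hn
  · rw [Finset.sum_eq_zero, Finset.sum_eq_zero]
    · intro i hi
      rw [mul_ite, mul_one, mul_zero, ← ite_and, if_neg]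
      rintro ⟨h3, h2⟩
      obtain rfl := hcard i hi h2
      exact h ⟨by simp at hi; omega, h2, h3⟩
    · intro z hz
      rw [if_neg]
      intro hzs
      exact h (relabel_of_std_dupMonomial_eq (by simpa using hz) hL hzs)

end Cut

/-! ### The monomial basis and its coproduct -/

section Basis

/-- The monomial quasisymmetric function of a standard monomial `s`: the sum of all monomials with
standardization `s`. -/
noncomputable def stdM (s : SMonomial ℕ) : sNCQSym :=
  ⟨⟨fun u => if u.std = s then 1 else 0, s.degree, fun u hu => by
      have h : u.std = s := by
        by_contra h
        exact hu (if_neg h)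
      rw [← h, SMonomial.degree_std]⟩,
    fun u v h => by
      change (if u.std = s then (1 : ℚ) else 0) = if v.std = s then 1 else 0
      rw [h]⟩

theorem stdM_apply (s u : SMonomial ℕ) : (stdM s).1.1 u = if u.std = s then 1 else 0 := rfl

/-- The standard monomials, which index a basis of `sNCQSym`. -/
abbrev StdMonomial : Type := {s : SMonomial ℕ // s.std = s}

theorem finite_stdMonomial_degree_le (d : ℕ) : {s : StdMonomial | s.1.degree ≤ d}.Finite := by
  have h1 : ((fun p : Finset ℕ × List ℕ => (⟨p.1, p.2⟩ : SMonomial ℕ)) ''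
      (((Finset.range d).powerset : Set (Finset ℕ)) ×ˢ
        (List.map (Fin.val (n := d)) '' {l | l.length ≤ d}))).Finite :=
    ((Finset.finite_toSet _).prod ((List.finite_length_le (Fin d) d).image _)).image _
  refine Set.Finite.of_finite_image (h1.subset ?_) Subtype.val_injective.injOn
  rintro _ ⟨⟨s, hs⟩, hd, rfl⟩
  have hd' : s.odd.card + s.word.length ≤ d := hd
  have hlt : ∀ a ∈ s.ind, a < d := by
    intro a ha
    have h2 := s.ind_std
    rw [hs] at h2
    rw [h2, Finset.mem_range] at ha
    refine ha.trans_le (le_trans ?_ hd')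
    exact (Finset.card_union_le _ _).trans (Nat.add_le_add_left (List.toFinset_card_le _) _)
  refine ⟨(s.odd, s.word), ⟨?_, ?_⟩, rfl⟩
  · rw [Finset.mem_coe, Finset.mem_powerset]
    exact fun a ha => Finset.mem_range.2 (hlt a (SMonomial.mem_ind.2 (Or.inl ha)))
  · refine ⟨s.word.pmap (fun a h => ⟨a, h⟩)
      fun a ha => hlt a (SMonomial.mem_ind.2 (Or.inr ha)), ?_, ?_⟩
    · simp only [Set.mem_ofPred_eq, List.length_pmap]
      omega
    · simp [List.map_pmap]

/-- The coefficients of a quasisymmetric function at the standard monomials. -/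
noncomputable def stdCoeff : sNCQSym →ₗ[ℚ] StdMonomial →₀ ℚ where
  toFun f := Finsupp.ofSupportFinite (fun s => f.1.1 s.1) (by
    obtain ⟨d, hd⟩ := f.1.2
    exact (finite_stdMonomial_degree_le d).subset fun s hs => hd _ hs)
  map_add' _ _ := Finsupp.ext fun _ => rfl
  map_smul' _ _ := Finsupp.ext fun _ => rfl

theorem stdCoeff_apply (f : sNCQSym) (s : StdMonomial) : stdCoeff f s = f.1.1 s.1 := rfl

theorem stdCoeff_stdM (s : StdMonomial) : stdCoeff (stdM s.1) = Finsupp.single s 1 := by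
  ext t
  rw [stdCoeff_apply, stdM_apply, t.2, Finsupp.single_apply]
  simp only [Subtype.ext_iff, eq_comm]

theorem stdCoeff_bijective : Function.Bijective stdCoeff := by
  constructor
  · intro f g h
    apply Subtype.ext; apply Subtype.ext
    funext u
    have h1 := DFunLike.congr_fun h ⟨u.std, u.std_std⟩
    rw [stdCoeff_apply, stdCoeff_apply] at h1
    rwa [f.2 u u.std u.std_std.symm, g.2 u u.std u.std_std.symm]
  · intro c
    refine ⟨c.sum fun s a => a • stdM s.1, ?_⟩
    simp only [Finsupp.sum, map_sum, map_smul, stdCoeff_stdM, Finsupp.smul_single, smul_eq_mul,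
      mul_one]
    exact c.sum_single

/-- The basis of `sNCQSym` formed by the monomial quasisymmetric functions. -/
noncomputable def stdBasis : Module.Basis StdMonomial ℚ sNCQSym :=
  .ofRepr (LinearEquiv.ofBijective stdCoeff stdCoeff_bijective)

theorem stdBasis_repr (f : sNCQSym) (s : StdMonomial) : stdBasis.repr f s = f.1.1 s.1 := rfl

theorem stdBasis_apply (s : StdMonomial) : stdBasis s = stdM s.1 := by
  apply stdBasis.repr.injective
  rw [Module.Basis.repr_self]
  exact (stdCoeff_stdM s).symm

/-- Every basis element is attached to a monomial with a list of its indices. -/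
theorem stdBasis_eq_relabel (s : StdMonomial) :
    stdBasis s = stdM (s.1.relabel (s.1.ind.sort (· ≤ ·))) := by
  rw [← SMonomial.std_eq_relabel, s.2, stdBasis_apply]

end Basis

section Coproduct

/-- The embedding of `sNCQSym ⊗ sNCQSym` into the series in two commuting alphabets. -/
noncomputable def tensorCoeff :
    sNCQSym ⊗[ℚ] sNCQSym →ₗ[ℚ] (SMonomial ℕ × SMonomial ℕ → ℚ) :=
  tensorToSeries ∘ₗ TensorProduct.map sNCQSym.val.toLinearMap sNCQSym.val.toLinearMap

theorem tensorCoeff_tmul (f g : sNCQSym) (p : SMonomial ℕ × SMonomial ℕ) :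
    tensorCoeff (f ⊗ₜ g) p = f.1.1 p.1 * g.1.1 p.2 := rfl

theorem tensorCoeff_injective : Function.Injective tensorCoeff := by
  rw [← LinearMap.ker_eq_bot, LinearMap.ker_eq_bot']
  intro x hx
  have key : ∀ (s t : StdMonomial) (y : sNCQSym ⊗[ℚ] sNCQSym),
      (stdBasis.tensorProduct stdBasis).repr y (s, t) = tensorCoeff y (s.1, t.1) := by
    intro s t y
    induction y with
    | zero => simp
    | tmul f g =>
      rw [Module.Basis.tensorProduct_repr_tmul_apply, tensorCoeff_tmul, stdBasis_repr, stdBasis_repr,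
        smul_eq_mul, mul_comm]
    | add y z hy hz => simp only [map_add, Finsupp.add_apply, Pi.add_apply, hy, hz]
  apply (stdBasis.tensorProduct stdBasis).repr.injective
  ext ⟨s, t⟩
  rw [key, hx, map_zero]
  rfl

/-- The coproduct of `sNCQSym`, defined on the basis of monomial functions by deconcatenation of the
increasing list of indices. -/
noncomputable def duplicationCoproduct : sNCQSym →ₗ[ℚ] sNCQSym ⊗[ℚ] sNCQSym :=
  stdBasis.constr ℚ fun s => ∑ i ∈ Finset.range (s.1.ind.card + 1),
    stdM (s.1.relabel ((List.range s.1.ind.card).take i)) ⊗ₜ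
      stdM (s.1.relabel ((List.range s.1.ind.card).drop i))

theorem duplicationCoproduct_stdM_relabel {γ : Type*} [LinearOrder γ] {t : SMonomial γ} {L : List γ}
    (hL : t.Lists L) :
    duplicationCoproduct (stdM (t.relabel L)) = ∑ i ∈ Finset.range (L.length + 1),
      stdM (t.relabel (L.take i)) ⊗ₜ stdM (t.relabel (L.drop i)) := by
  have h : stdM (t.relabel L) = stdBasis ⟨t.relabel L, SMonomial.std_relabel hL⟩ :=
    (stdBasis_apply ⟨t.relabel L, SMonomial.std_relabel hL⟩).symm
  rw [h, duplicationCoproduct, Module.Basis.constr_basis]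
  simp only [SMonomial.ind_relabel hL, Finset.card_range, SMonomial.relabel_take _ hL.1,
    SMonomial.relabel_drop _ hL.1]

/-- Deconcatenation of the increasing list of indices computes the evaluation on two commuting
alphabets. -/
theorem isDuplicationCoproduct_duplicationCoproduct :
    IsDuplicationCoproduct duplicationCoproduct := by
  let P : sNCQSym →ₗ[ℚ] (SMonomial ℕ × SMonomial ℕ → ℚ) :=
    { toFun := fun f => projCommute (evalAlphabet (ℕ ⊕ₗ ℕ) f).1
      map_add' := fun f g => by
        funext p
        exact Finset.sum_add_distrib
      map_smul' := fun c f => by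
        funext p
        exact (Finset.mul_sum _ _ _).symm }
  have h : tensorCoeff ∘ₗ duplicationCoproduct = P := by
    refine stdBasis.ext fun s => ?_
    rw [stdBasis_eq_relabel, LinearMap.comp_apply,
      duplicationCoproduct_stdM_relabel s.1.lists_sort]
    funext p
    rw [map_sum, Finset.sum_apply]
    refine Eq.trans ?_ ((sum_wordFibre_std_eq s.1.lists_sort p.1 p.2).symm.trans ?_)
    · exact Finset.sum_congr rfl fun i _ => tensorCoeff_tmul _ _ _
    · refine Finset.sum_congr rfl fun z _ => ?_
      change _ = (stdM _).1.1 (dupMonomial p.1 p.2 z).std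
      rw [stdM_apply, SMonomial.std_std]
  exact fun f => LinearMap.congr_fun h f

theorem tensorCoeff_duplicationCoproduct (f : sNCQSym) :
    tensorCoeff (duplicationCoproduct f) = projCommute (evalAlphabet (ℕ ⊕ₗ ℕ) f).1 :=
  isDuplicationCoproduct_duplicationCoproduct f

/-- The constant coefficient. -/
noncomputable def constCoeff : sNCQSym →ₗ[ℚ] ℚ where
  toFun f := f.1.1 ⟨∅, []⟩
  map_add' _ _ := rfl
  map_smul' _ _ := rfl

theorem constCoeff_stdM_relabel {γ : Type*} [LinearOrder γ] {t : SMonomial γ} {L : List γ}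
    (hL : t.Lists L) : constCoeff (stdM (t.relabel L)) = if L = [] then 1 else 0 := by
  change (if SMonomial.std ⟨∅, []⟩ = t.relabel L then (1 : ℚ) else 0) = _
  have h1 : SMonomial.std (⟨∅, []⟩ : SMonomial ℕ) = t.relabel L ↔ L = [] := by
    constructor
    · intro h
      have := congrArg SMonomial.ind h
      rw [SMonomial.ind_relabel hL, SMonomial.ind_std] at this
      have h2 := congrArg Finset.card this
      simp only [Finset.card_range] at h2
      exact List.eq_nil_of_length_eq_zero (h2.symm.trans (by simp [SMonomial.ind]))
    · rintro rfl
      apply SMonomial.ext <;> simp [SMonomial.std, SMonomial.map, SMonomial.relabel]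
  simp only [h1]

theorem stdM_relabel_nil {γ : Type*} [LinearOrder γ] (t : SMonomial γ) :
    stdM (t.relabel []) = 1 := by
  apply Subtype.ext; apply Subtype.ext
  funext u
  rw [stdM_apply]
  change _ = oneCoeff u
  unfold oneCoeff
  congr 1
  simp [SMonomial.ext_iff, SMonomial.std, SMonomial.map, SMonomial.relabel]

/-- The two ways of cutting a list into three pieces. -/
theorem sum_take_drop_assoc {γ M : Type*} [AddCommMonoid M] (w : List γ)
    (G : List γ → List γ → List γ → M) :
    ∑ i ∈ Finset.range (w.length + 1), ∑ j ∈ Finset.range ((w.take i).length + 1),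
        G ((w.take i).take j) ((w.take i).drop j) (w.drop i) =
      ∑ j ∈ Finset.range (w.length + 1), ∑ k ∈ Finset.range ((w.drop j).length + 1),
        G (w.take j) ((w.drop j).take k) ((w.drop j).drop k) := by
  rw [Finset.sum_sigma', Finset.sum_sigma']
  refine Finset.sum_bij' (fun p _ => ⟨p.2, p.1 - p.2⟩) (fun p _ => ⟨p.1 + p.2, p.1⟩) ?_ ?_ ?_ ?_ ?_
  · rintro ⟨i, j⟩ h
    simp only [Finset.mem_sigma, Finset.mem_range, List.length_take, List.length_drop] at h ⊢
    omega
  · rintro ⟨i, j⟩ h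
    simp only [Finset.mem_sigma, Finset.mem_range, List.length_take, List.length_drop] at h ⊢
    omega
  · rintro ⟨i, j⟩ h
    simp only [Finset.mem_sigma, Finset.mem_range, List.length_take] at h ⊢
    have : j + (i - j) = i := by omega
    simp [this]
  · rintro ⟨i, j⟩ h
    simp
  · rintro ⟨i, j⟩ h
    simp only [Finset.mem_sigma, Finset.mem_range, List.length_take] at h ⊢
    have h1 : j + (i - j) = i := by omega
    rw [List.take_take, List.drop_take, List.drop_drop, h1, min_eq_left (by omega)]

/-- A coproduct that deconcatenates lists is coassociative at every element attached to a list.  The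
predicate `p` allows for formulas that hold for some lists only. -/
theorem coassoc_of_deconcatenation {V γ : Type*} [AddCommGroup V] [Module ℚ V]
    (Δ : V →ₗ[ℚ] V ⊗[ℚ] V) (m : List γ → V) {p : List γ → Prop}
    (h : ∀ N, p N → Δ (m N) =
      ∑ i ∈ Finset.range (N.length + 1), m (N.take i) ⊗ₜ[ℚ] m (N.drop i))
    (hp : ∀ N i, p N → p (N.take i) ∧ p (N.drop i)) (L : List γ) (hL : p L) :
    TensorProduct.assoc ℚ V V V (Δ.rTensor V (Δ (m L))) = Δ.lTensor V (Δ (m L)) := by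
  rw [h L hL]
  simp only [map_sum, LinearMap.rTensor_tmul, LinearMap.lTensor_tmul, h _ (hp _ _ hL).1,
    h _ (hp _ _ hL).2, TensorProduct.sum_tmul, TensorProduct.tmul_sum, TensorProduct.assoc_tmul]
  exact sum_take_drop_assoc L fun a b c => m a ⊗ₜ[ℚ] (m b ⊗ₜ[ℚ] m c)

/-- The coalgebra structure of `sNCQSym`. -/
noncomputable instance duplicationCoalgebra : Coalgebra ℚ sNCQSym where
  comul := duplicationCoproduct
  counit := constCoeff
  coassoc := by
    refine stdBasis.ext fun s => ?_
    have hL := s.1.lists_sort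
    rw [stdBasis_eq_relabel]
    exact coassoc_of_deconcatenation duplicationCoproduct (fun N => stdM (s.1.relabel N))
      (fun N hN => duplicationCoproduct_stdM_relabel hN) (fun N i hN => ⟨hN.take i, hN.drop i⟩) _ hL
  rTensor_counit_comp_comul := by
    refine stdBasis.ext fun s => ?_
    have hL := s.1.lists_sort
    rw [stdBasis_eq_relabel]
    simp only [LinearMap.comp_apply]
    rw [duplicationCoproduct_stdM_relabel hL, map_sum, Finset.sum_eq_single 0]
    · rw [LinearMap.rTensor_tmul, constCoeff_stdM_relabel (hL.take _)]
      simp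
    · intro i hi h0
      rw [LinearMap.rTensor_tmul, constCoeff_stdM_relabel (hL.take _), if_neg,
        TensorProduct.zero_tmul]
      intro h
      have := congrArg List.length h
      simp only [Finset.mem_range, List.length_take, List.length_nil] at this hi
      omega
    · simp
  lTensor_counit_comp_comul := by
    refine stdBasis.ext fun s => ?_
    have hL := s.1.lists_sort
    rw [stdBasis_eq_relabel]
    simp only [LinearMap.comp_apply]
    rw [duplicationCoproduct_stdM_relabel hL, map_sum,
      Finset.sum_eq_single (s.1.ind.sort (· ≤ ·)).length]
    · rw [LinearMap.lTensor_tmul, constCoeff_stdM_relabel (hL.drop _), List.drop_length,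
        List.take_length]
      simp
    · intro i hi h0
      rw [LinearMap.lTensor_tmul, constCoeff_stdM_relabel (hL.drop _), if_neg,
        TensorProduct.tmul_zero]
      intro h
      have := congrArg List.length h
      simp only [Finset.mem_range, List.length_drop, List.length_nil] at this hi
      omega
    · simp

end Coproduct

/-! ### Multiplicativity of the coproduct -/

section PairProduct

section CutShuffle
variable {α β : Type*}

/-- Cutting a shuffle of two words is the same as cutting both words and shuffling the pieces. -/
theorem sum_wordFibre_cut (w : List α) (w' : List β)
    (G : List (α ⊕ₗ β) → List (α ⊕ₗ β) → ℚ) :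
    ∑ z ∈ (wordFibre_finite w w').toFinset, ∑ k ∈ Finset.range (z.length + 1),
        G (z.take k) (z.drop k) =
      ∑ i ∈ Finset.range (w.length + 1), ∑ j ∈ Finset.range (w'.length + 1),
        ∑ z₁ ∈ (wordFibre_finite (w.take i) (w'.take j)).toFinset,
          ∑ z₂ ∈ (wordFibre_finite (w.drop i) (w'.drop j)).toFinset, G z₁ z₂ := by
  have hl : ∀ z ∈ wordFibre w w', ∀ k, (z.take k).filterMap (fun c => (ofLex c).getLeft?) ++
      (z.drop k).filterMap (fun c => (ofLex c).getLeft?) = w := by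
    intro z hz k
    rw [← List.filterMap_append, List.take_append_drop, hz.1]
  have hr : ∀ z ∈ wordFibre w w', ∀ k, (z.take k).filterMap (fun c => (ofLex c).getRight?) ++
      (z.drop k).filterMap (fun c => (ofLex c).getRight?) = w' := by
    intro z hz k
    rw [← List.filterMap_append, List.take_append_drop, hz.2]
  have hR : ∀ i j, ∑ z₁ ∈ (wordFibre_finite (w.take i) (w'.take j)).toFinset,
      ∑ z₂ ∈ (wordFibre_finite (w.drop i) (w'.drop j)).toFinset, G z₁ z₂ =
      ∑ q ∈ (wordFibre_finite (w.take i) (w'.take j)).toFinset ×ˢ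
        (wordFibre_finite (w.drop i) (w'.drop j)).toFinset, G q.1 q.2 :=
    fun i j => (Finset.sum_product' _ _ _).symm
  simp only [hR]
  rw [← Finset.sum_product', Finset.sum_sigma', Finset.sum_sigma']
  -- A cut of the shuffle `z` determines how many letters of either word precede it.
  refine Finset.sum_bij'
    (fun q _ => ⟨(((q.1.take q.2).filterMap (fun c => (ofLex c).getLeft?)).length,
      ((q.1.take q.2).filterMap (fun c => (ofLex c).getRight?)).length),
      (q.1.take q.2, q.1.drop q.2)⟩)
    (fun q _ => ⟨q.2.1 ++ q.2.2, q.2.1.length⟩) ?_ ?_ ?_ ?_ ?_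
  · rintro ⟨z, k⟩ hq
    simp only [Finset.mem_sigma, Set.Finite.mem_toFinset, Finset.mem_range] at hq
    have h1 := hl z hq.1 k
    have h2 := hr z hq.1 k
    have h1' := congrArg List.length h1
    have h2' := congrArg List.length h2
    rw [List.length_append] at h1' h2'
    simp only [Finset.mem_sigma, Set.Finite.mem_toFinset, Finset.mem_range, Finset.mem_product]
    refine ⟨⟨by omega, by omega⟩, ⟨?_, ?_⟩, ⟨?_, ?_⟩⟩
    · conv_rhs => rw [← h1, List.take_left]
    · conv_rhs => rw [← h2, List.take_left]
    · conv_rhs => rw [← h1, List.drop_left]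
    · conv_rhs => rw [← h2, List.drop_left]
  · rintro ⟨⟨i, j⟩, z₁, z₂⟩ hq
    simp only [Finset.mem_sigma, Set.Finite.mem_toFinset, Finset.mem_range, Finset.mem_product]
      at hq ⊢
    obtain ⟨-, h1, h2⟩ := hq
    refine ⟨⟨?_, ?_⟩, by simp⟩
    · rw [List.filterMap_append, h1.1, h2.1, List.take_append_drop]
    · rw [List.filterMap_append, h1.2, h2.2, List.take_append_drop]
  · rintro ⟨z, k⟩ hq
    simp only [Finset.mem_sigma, Set.Finite.mem_toFinset, Finset.mem_range] at hq
    simp only [List.take_append_drop, List.length_take]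
    rw [min_eq_left (by omega)]
  · rintro ⟨⟨i, j⟩, z₁, z₂⟩ hq
    simp only [Finset.mem_sigma, Set.Finite.mem_toFinset, Finset.mem_range, Finset.mem_product]
      at hq
    obtain ⟨h0, h1, h2⟩ := hq
    simp only [List.take_left, List.drop_left, h1.1, h1.2, List.length_take]
    rw [min_eq_left (by omega), min_eq_left (by omega)]
  · rintro ⟨z, k⟩ hq
    rfl

end CutShuffle

variable {α β : Type*} [LinearOrder α] [LinearOrder β]

/-- The product of series in two commuting alphabets `x, θ` and `y, ϑ`, where `θ` and `ϑ` anticommute;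
`f` and `g` are given by the coefficients of the products of a monomial in `x, θ` and a monomial in
`y, ϑ`.  The last sign comes from moving the `ϑ`s of `f` past the `θ`s of `g`. -/
def pairMul (f g : SMonomial α × SMonomial β → ℚ) (p : SMonomial α × SMonomial β) : ℚ :=
  ∑ S ∈ p.1.odd.powerset, ∑ T ∈ p.2.odd.powerset,
    ∑ i ∈ Finset.range (p.1.word.length + 1), ∑ j ∈ Finset.range (p.2.word.length + 1),
      crossSign S (p.1.odd \ S) * crossSign T (p.2.odd \ T) *
        (-1) ^ (T.card * (p.1.odd \ S).card) *
        f (⟨S, p.1.word.take i⟩, ⟨T, p.2.word.take j⟩) *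
        g (⟨p.1.odd \ S, p.1.word.drop i⟩, ⟨p.2.odd \ T, p.2.word.drop j⟩)

theorem pairMul_add_left (f f' g : SMonomial α × SMonomial β → ℚ) :
    pairMul (f + f') g = pairMul f g + pairMul f' g := by
  funext p
  simp only [pairMul, Pi.add_apply, mul_add, add_mul, Finset.sum_add_distrib]

theorem pairMul_add_right (f g g' : SMonomial α × SMonomial β → ℚ) :
    pairMul f (g + g') = pairMul f g + pairMul f g' := by
  funext p
  simp only [pairMul, Pi.add_apply, mul_add, Finset.sum_add_distrib]

theorem pairMul_zero_left (g : SMonomial α × SMonomial β → ℚ) : pairMul 0 g = 0 := by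
  funext p
  simp [pairMul]

theorem pairMul_zero_right (f : SMonomial α × SMonomial β → ℚ) : pairMul f 0 = 0 := by
  funext p
  simp [pairMul]

/-- The set of the odd variables of a product monomial over the duplicated alphabet. -/
def dupOdd (A : Finset α) (B : Finset β) : Finset (α ⊕ₗ β) :=
  (dupMonomial (⟨A, []⟩ : SMonomial α) (⟨B, []⟩ : SMonomial β) []).odd

theorem inl_mem_dupOdd {A : Finset α} {B : Finset β} {a : α} :
    toLex (Sum.inl a) ∈ dupOdd A B ↔ a ∈ A := mem_odd_dupMonomial_inl

theorem inr_mem_dupOdd {A : Finset α} {B : Finset β} {b : β} :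
    toLex (Sum.inr b) ∈ dupOdd A B ↔ b ∈ B := mem_odd_dupMonomial_inr

theorem dupOdd_sdiff (A S : Finset α) (B T : Finset β) :
    dupOdd A B \ dupOdd S T = dupOdd (A \ S) (B \ T) := by
  rw [Finset.ext_iff, forall_lex_sum]
  simp only [Finset.mem_sdiff, inl_mem_dupOdd, inr_mem_dupOdd, implies_true, and_self]

theorem sum_powerset_dupOdd (A : Finset α) (B : Finset β) (G : Finset (α ⊕ₗ β) → ℚ) :
    ∑ R ∈ (dupOdd A B).powerset, G R =
      ∑ S ∈ A.powerset, ∑ T ∈ B.powerset, G (dupOdd S T) := by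
  rw [← Finset.sum_product']
  refine Finset.sum_bij' (fun R _ => (A.filter fun a => toLex (Sum.inl a) ∈ R,
    B.filter fun b => toLex (Sum.inr b) ∈ R)) (fun q _ => dupOdd q.1 q.2) ?_ ?_ ?_ ?_ ?_
  · intro R _
    simp [Finset.filter_subset]
  · rintro ⟨S, T⟩ h
    rw [Finset.mem_product, Finset.mem_powerset, Finset.mem_powerset] at h
    rw [Finset.mem_powerset, Finset.subset_iff, forall_lex_sum]
    simp only [inl_mem_dupOdd, inr_mem_dupOdd]
    exact ⟨fun a ha => h.1 ha, fun b hb => h.2 hb⟩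
  · intro R hR
    rw [Finset.mem_powerset, Finset.subset_iff, forall_lex_sum] at hR
    simp only [inl_mem_dupOdd, inr_mem_dupOdd] at hR
    rw [Finset.ext_iff, forall_lex_sum]
    simp only [inl_mem_dupOdd, inr_mem_dupOdd, Finset.mem_filter]
    exact ⟨fun a => ⟨fun h => h.2, fun h => ⟨hR.1 a h, h⟩⟩,
      fun b => ⟨fun h => h.2, fun h => ⟨hR.2 b h, h⟩⟩⟩
  · rintro ⟨S, T⟩ h
    rw [Finset.mem_product, Finset.mem_powerset, Finset.mem_powerset] at h
    simp only [inl_mem_dupOdd, inr_mem_dupOdd, Prod.mk.injEq]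
    exact ⟨by ext a; simpa using fun ha => h.1 ha, by ext a; simpa using fun ha => h.2 ha⟩
  · intro R hR
    rw [Finset.mem_powerset, Finset.subset_iff, forall_lex_sum] at hR
    simp only [inl_mem_dupOdd, inr_mem_dupOdd] at hR
    congr 1
    rw [Finset.ext_iff, forall_lex_sum]
    simp only [inl_mem_dupOdd, inr_mem_dupOdd, Finset.mem_filter]
    exact ⟨fun a => ⟨fun h => ⟨hR.1 a h, h⟩, fun h => h.2⟩,
      fun b => ⟨fun h => ⟨hR.2 b h, h⟩, fun h => h.2⟩⟩

theorem crossings_eq_sum (A B : Finset α) :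
    crossings A B = ∑ a ∈ A, ∑ b ∈ B, if b < a then 1 else 0 := by
  rw [crossings, Finset.card_filter, Finset.sum_product]

theorem sum_dupOdd (A : Finset α) (B : Finset β) (G : α ⊕ₗ β → ℕ) :
    ∑ c ∈ dupOdd A B, G c = ∑ a ∈ A, G (toLex (Sum.inl a)) + ∑ b ∈ B, G (toLex (Sum.inr b)) := by
  have h : dupOdd A B = A.map ⟨fun a => toLex (Sum.inl a), inl_lex_injective⟩ ∪
      B.map ⟨fun b => toLex (Sum.inr b), inr_lex_injective⟩ := rfl
  rw [h, Finset.sum_union, Finset.sum_map, Finset.sum_map]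
  · rfl
  · rw [Finset.disjoint_left]
    intro c h1 h2
    obtain ⟨a, -, rfl⟩ := Finset.mem_map.1 h1
    obtain ⟨b, -, h⟩ := Finset.mem_map.1 h2
    exact absurd (toLex.injective h) (by simp)

theorem crossings_dupOdd (S S' : Finset α) (T T' : Finset β) :
    crossings (dupOdd S T) (dupOdd S' T') = crossings S S' + crossings T T' + T.card * S'.card := by
  simp only [crossings_eq_sum, sum_dupOdd, Sum.Lex.inl_lt_inl_iff, Sum.Lex.inr_lt_inr_iff,
    Sum.Lex.inl_lt_inr, Sum.Lex.not_inr_lt_inl, if_false, if_true, Finset.sum_const_zero,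
    Finset.sum_add_distrib, Finset.sum_const, smul_eq_mul, mul_one]
  ring

/-- Imposing `x_i y_j = y_j x_i` is multiplicative. -/
theorem projCommute_mul (f g : SuperSeries (α ⊕ₗ β)) :
    projCommute (f * g) = pairMul (projCommute f) (projCommute g) := by
  funext ⟨u, v⟩
  have h1 : projCommute (f * g) (u, v) = ∑ z ∈ (wordFibre_finite u.word v.word).toFinset,
      ∑ S ∈ u.odd.powerset, ∑ T ∈ v.odd.powerset, ∑ k ∈ Finset.range (z.length + 1),
        crossSign (dupOdd S T) (dupOdd (u.odd \ S) (v.odd \ T)) * f.1 ⟨dupOdd S T, z.take k⟩ *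
          g.1 ⟨dupOdd (u.odd \ S) (v.odd \ T), z.drop k⟩ := by
    refine Finset.sum_congr rfl fun z _ => ?_
    have h2 : (f * g).1 (dupMonomial u v z) = ∑ R ∈ (dupOdd u.odd v.odd).powerset,
        ∑ k ∈ Finset.range (z.length + 1), crossSign R (dupOdd u.odd v.odd \ R) *
          f.1 ⟨R, z.take k⟩ * g.1 ⟨dupOdd u.odd v.odd \ R, z.drop k⟩ := rfl
    rw [h2, sum_powerset_dupOdd]
    simp only [dupOdd_sdiff]
  rw [h1, Finset.sum_comm]
  refine Finset.sum_congr rfl fun S _ => ?_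
  rw [Finset.sum_comm]
  refine Finset.sum_congr rfl fun T _ => ?_
  rw [sum_wordFibre_cut u.word v.word fun z₁ z₂ =>
    crossSign (dupOdd S T) (dupOdd (u.odd \ S) (v.odd \ T)) * f.1 ⟨dupOdd S T, z₁⟩ *
      g.1 ⟨dupOdd (u.odd \ S) (v.odd \ T), z₂⟩]
  refine Finset.sum_congr rfl fun i _ => Finset.sum_congr rfl fun j _ => ?_
  have hs : crossSign (dupOdd S T) (dupOdd (u.odd \ S) (v.odd \ T)) =
      crossSign S (u.odd \ S) * crossSign T (v.odd \ T) * (-1) ^ (T.card * (u.odd \ S).card) := by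
    simp only [crossSign, crossings_dupOdd, pow_add]
  rw [hs]
  simp only [← Finset.mul_sum, ← Finset.sum_mul]
  rfl

/-- Evaluation on an alphabet is multiplicative, because standardizing a monomial is a renaming that is
increasing on its indices and so preserves the signs of the product. -/
theorem evalAlphabet_mul (f g : sNCQSym) :
    (evalAlphabet α (f * g)).1 = (evalAlphabet α f).1 * (evalAlphabet α g).1 := by
  apply Subtype.ext
  funext u
  change mulCoeff f.1.1 g.1.1 (u.map (rank u.ind)) =
    mulCoeff (fun v => f.1.1 v.std) (fun v => g.1.1 v.std) u
  rw [mulCoeff_map _ _ _ _ (rank_strictMonoOn _)]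
  have hs : ∀ v : SMonomial α, v.ind ⊆ u.ind → (v.map (rank u.ind)).std = v.std.std := fun v hv => by
    rw [SMonomial.std_std]
    exact SMonomial.std_map _ _ ((rank_strictMonoOn _).mono (by exact_mod_cast hv))
  exact mulCoeff_congr u (fun v hv => f.2 _ _ (hs v hv)) fun v hv => g.2 _ _ (hs v hv)

end PairProduct

section Multiplicativity

/-- The sign rule of the graded tensor product is the rule for moving the `ϑ`s of one factor past the
`θ`s of the next. -/
theorem tensorCoeff_homogeneous_mul (a d : sNCQSym) {j i : ZMod 2} (b : parityPart (α := ℕ) j)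
    (c : parityPart (α := ℕ) i) :
    tensorCoeff ((-1 : ℤˣ) ^ (j * i) • ((a * c.1) ⊗ₜ[ℚ] (b.1 * d))) =
      pairMul (tensorCoeff (a ⊗ₜ b.1)) (tensorCoeff (c.1 ⊗ₜ d)) := by
  have hsign : ((-1 : ℤˣ) ^ (j * i) • ((a * c.1) ⊗ₜ[ℚ] (b.1 * d))) =
      ((((-1 : ℤˣ) ^ (j * i) : ℤˣ) : ℤ) : ℚ) • ((a * c.1) ⊗ₜ[ℚ] (b.1 * d)) := by
    rw [Units.smul_def, ← Int.cast_smul_eq_zsmul ℚ]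
  rw [hsign, map_smul]
  funext ⟨u, v⟩
  rw [Pi.smul_apply, tensorCoeff_tmul]
  change _ * (mulCoeff a.1.1 c.1.1.1 u * mulCoeff b.1.1.1 d.1.1 v) = pairMul _ _ (u, v)
  unfold mulCoeff pairMul
  rw [Finset.sum_mul_sum, Finset.mul_sum]
  refine Finset.sum_congr rfl fun S _ => ?_
  rw [Finset.mul_sum]
  refine Finset.sum_congr rfl fun T _ => ?_
  rw [Finset.sum_mul_sum, Finset.mul_sum]
  refine Finset.sum_congr rfl fun k _ => ?_
  rw [Finset.mul_sum]
  refine Finset.sum_congr rfl fun l _ => ?_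
  rw [tensorCoeff_tmul, tensorCoeff_tmul]
  -- Where the coefficients of `b` and `c` do not vanish, the numbers of odd letters have the parities
  -- `j` and `i`.
  by_cases hb : b.1.1.1 ⟨T, v.word.take l⟩ = 0
  · simp only [hb]
    ring
  by_cases hc : c.1.1.1 ⟨u.odd \ S, u.word.drop k⟩ = 0
  · simp only [hc]
    ring
  have h1 : (T.card : ZMod 2) = j := b.2 _ hb
  have h2 : ((u.odd \ S).card : ZMod 2) = i := c.2 _ hc
  have h3 : ((((-1 : ℤˣ) ^ (j * i) : ℤˣ) : ℤ) : ℚ) = (-1) ^ (T.card * (u.odd \ S).card) := by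
    rw [← h1, ← h2, ← Nat.cast_mul, uzpow_natCast]
    push_cast
    rfl
  rw [h3]
  ring

theorem tensorCoeff_mul (x y : sNCQSym ⊗[ℚ] sNCQSym) :
    tensorCoeff ((GradedTensorProduct.of ℚ (parityPart (α := ℕ)) (parityPart (α := ℕ))).symm
      (GradedTensorProduct.of ℚ (parityPart (α := ℕ)) (parityPart (α := ℕ)) x *
        GradedTensorProduct.of ℚ (parityPart (α := ℕ)) (parityPart (α := ℕ)) y)) =
      pairMul (tensorCoeff x) (tensorCoeff y) := by
  induction x with
  | zero => simp only [map_zero, zero_mul, pairMul_zero_left]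
  | add x x' hx hx' => simp only [map_add, add_mul, hx, hx', pairMul_add_left]
  | tmul a b =>
    induction y with
    | zero => simp only [map_zero, mul_zero, pairMul_zero_right]
    | add y y' hy hy' => simp only [map_add, mul_add, hy, hy', pairMul_add_right]
    | tmul c d =>
      induction b using DirectSum.Decomposition.inductionOn (parityPart (α := ℕ)) with
      | zero => simp only [TensorProduct.tmul_zero, map_zero, zero_mul, pairMul_zero_left]
      | add b b' hb hb' =>
        simp only [TensorProduct.tmul_add, map_add, add_mul, hb, hb', pairMul_add_left]
      | homogeneous b =>
        induction c using DirectSum.Decomposition.inductionOn (parityPart (α := ℕ)) with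
        | zero => simp only [TensorProduct.zero_tmul, map_zero, mul_zero, pairMul_zero_right]
        | add c c' hc hc' =>
          simp only [TensorProduct.add_tmul, map_add, mul_add, hc, hc', pairMul_add_right]
        | homogeneous c =>
          rw [← tensorCoeff_homogeneous_mul]
          congr 1
          exact GradedTensorProduct.tmul_coe_mul_coe_tmul (parityPart (α := ℕ))
            (parityPart (α := ℕ)) a b c d

/-- Both sides of the multiplicativity are compared as series in two commuting alphabets. -/
theorem duplicationCoproduct_mul (f g : sNCQSym) :
    GradedTensorProduct.of ℚ (parityPart (α := ℕ)) (parityPart (α := ℕ))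
        (duplicationCoproduct (f * g)) =
      GradedTensorProduct.of ℚ (parityPart (α := ℕ)) (parityPart (α := ℕ))
          (duplicationCoproduct f) *
        GradedTensorProduct.of ℚ (parityPart (α := ℕ)) (parityPart (α := ℕ))
          (duplicationCoproduct g) := by
  rw [← LinearEquiv.eq_symm_apply]
  apply tensorCoeff_injective
  rw [tensorCoeff_mul, tensorCoeff_duplicationCoproduct, tensorCoeff_duplicationCoproduct,
    tensorCoeff_duplicationCoproduct, evalAlphabet_mul, projCommute_mul]

end Multiplicativity

/-! ### The antipode and the Hopf superalgebra of quasisymmetric functions -/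

section Antipode
open WithConv

theorem ofConv_sum_apply {A ι : Type*} [Ring A] [Algebra ℚ A] (s : Finset ι)
    (f : ι → WithConv (A →ₗ[ℚ] A)) (a : A) :
    (∑ i ∈ s, f i).ofConv a = ∑ i ∈ s, (f i).ofConv a := by
  classical
  induction s using Finset.induction_on with
  | empty => rfl
  | insert i s hi ih =>
    rw [Finset.sum_insert hi, Finset.sum_insert hi, ← ih]
    rfl

variable {A : Type*} [Ring A] [Algebra ℚ A] [Coalgebra ℚ A]

variable (A) in
/-- The element `ηε - id` of the convolution algebra of `A`, where `ηε` is the unit. -/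
noncomputable def convDefect : WithConv (A →ₗ[ℚ] A) := 1 - toConv LinearMap.id

theorem convDefect_apply (a : A) :
    (convDefect A).ofConv a = algebraMap ℚ A (Coalgebra.counit (R := ℚ) a) - a := rfl

variable (A) in
/-- The element `ηε - id` is locally nilpotent. -/
def ConvDefectNilpotent : Prop := ∀ a : A, ∃ N, ∀ n, N ≤ n → (convDefect A ^ n).ofConv a = 0

variable (A) in
/-- The convolution inverse `∑ₙ (ηε - id)ⁿ` of the identity, a locally finite sum. -/
noncomputable def convInverse (h : ConvDefectNilpotent A) : A →ₗ[ℚ] A where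
  toFun a := ∑ᶠ n, (convDefect A ^ n).ofConv a
  map_add' a b := by
    have hf : ∀ a : A, (Function.support fun n => (convDefect A ^ n).ofConv a).Finite := fun a => by
      obtain ⟨N, hN⟩ := h a
      exact (Set.finite_Iio N).subset fun n hn => not_le.1 fun hle => hn (hN n hle)
    rw [← finsum_add_distrib (hf a) (hf b)]
    simp only [map_add]
  map_smul' c a := by
    simp only [map_smul, RingHom.id_apply, smul_finsum]

theorem convInverse_eq_sum (h : ConvDefectNilpotent A) (a : A) :
    ∃ N, ∀ n, N ≤ n → convInverse A h a =
      (∑ k ∈ Finset.range n, convDefect A ^ k).ofConv a := by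
  obtain ⟨N, hN⟩ := h a
  refine ⟨N, fun n hn => ?_⟩
  rw [ofConv_sum_apply]
  refine finsum_eq_sum_of_support_subset _ fun k hk => ?_
  rw [Finset.mem_coe, Finset.mem_range]
  by_contra hle
  exact hk (hN k (hn.trans (not_lt.1 hle)))

theorem lTensor_convInverse_eq_sum (h : ConvDefectNilpotent A) (x : A ⊗[ℚ] A) :
    ∃ N, ∀ n, N ≤ n → (convInverse A h).lTensor A x =
      (∑ k ∈ Finset.range n, convDefect A ^ k).ofConv.lTensor A x := by
  induction x with
  | zero => exact ⟨0, fun n _ => by rw [map_zero, map_zero]⟩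
  | tmul a b =>
    obtain ⟨N, hN⟩ := convInverse_eq_sum h b
    exact ⟨N, fun n hn => by rw [LinearMap.lTensor_tmul, LinearMap.lTensor_tmul, hN n hn]⟩
  | add x y hx hy =>
    obtain ⟨N, hN⟩ := hx
    obtain ⟨M, hM⟩ := hy
    exact ⟨max N M, fun n hn => by
      rw [map_add, map_add, hN n (le_of_max_le_left hn), hM n (le_of_max_le_right hn)]⟩

theorem rTensor_convInverse_eq_sum (h : ConvDefectNilpotent A) (x : A ⊗[ℚ] A) :
    ∃ N, ∀ n, N ≤ n → (convInverse A h).rTensor A x =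
      (∑ k ∈ Finset.range n, convDefect A ^ k).ofConv.rTensor A x := by
  induction x with
  | zero => exact ⟨0, fun n _ => by rw [map_zero, map_zero]⟩
  | tmul a b =>
    obtain ⟨N, hN⟩ := convInverse_eq_sum h a
    exact ⟨N, fun n hn => by rw [LinearMap.rTensor_tmul, LinearMap.rTensor_tmul, hN n hn]⟩
  | add x y hx hy =>
    obtain ⟨N, hN⟩ := hx
    obtain ⟨M, hM⟩ := hy
    exact ⟨max N M, fun n hn => by
      rw [map_add, map_add, hN n (le_of_max_le_left hn), hM n (le_of_max_le_right hn)]⟩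

theorem toConv_id_eq : (toConv LinearMap.id : WithConv (A →ₗ[ℚ] A)) = 1 - convDefect A :=
  (sub_sub_cancel _ _).symm

theorem mul_convInverse_right (h : ConvDefectNilpotent A) :
    LinearMap.mul' ℚ A ∘ₗ (convInverse A h).lTensor A ∘ₗ Coalgebra.comul =
      Algebra.linearMap ℚ A ∘ₗ Coalgebra.counit := by
  ext a
  obtain ⟨N, hN⟩ := lTensor_convInverse_eq_sum h (Coalgebra.comul a)
  obtain ⟨M, hM⟩ := h a
  rw [LinearMap.comp_apply, LinearMap.comp_apply, hN (max N M) (le_max_left _ _)]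
  change (toConv LinearMap.id * ∑ k ∈ Finset.range (max N M), convDefect A ^ k).ofConv a = _
  rw [toConv_id_eq, mul_neg_geom_sum]
  change (1 : WithConv (A →ₗ[ℚ] A)).ofConv a - (convDefect A ^ max N M).ofConv a = _
  rw [hM _ (le_max_right _ _), sub_zero]
  rfl

theorem mul_convInverse_left (h : ConvDefectNilpotent A) :
    LinearMap.mul' ℚ A ∘ₗ (convInverse A h).rTensor A ∘ₗ Coalgebra.comul =
      Algebra.linearMap ℚ A ∘ₗ Coalgebra.counit := by
  ext a
  obtain ⟨N, hN⟩ := rTensor_convInverse_eq_sum h (Coalgebra.comul a)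
  obtain ⟨M, hM⟩ := h a
  rw [LinearMap.comp_apply, LinearMap.comp_apply, hN (max N M) (le_max_left _ _)]
  change ((∑ k ∈ Finset.range (max N M), convDefect A ^ k) * toConv LinearMap.id).ofConv a = _
  rw [toConv_id_eq, geom_sum_mul_neg]
  change (1 : WithConv (A →ₗ[ℚ] A)).ofConv a - (convDefect A ^ max N M).ofConv a = _
  rw [hM _ (le_max_right _ _), sub_zero]
  rfl

theorem convDefect_pow_succ_apply (n : ℕ) (a : A) : (convDefect A ^ (n + 1)).ofConv a =
    LinearMap.mul' ℚ A (TensorProduct.map (convDefect A ^ n).ofConv (convDefect A).ofConv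
      (Coalgebra.comul a)) := by
  rw [pow_succ]
  rfl

theorem convInverse_mem_of_forall_pow_mem (h : ConvDefectNilpotent A) {B : Submodule ℚ A} {a : A}
    (ha : ∀ n, (convDefect A ^ n).ofConv a ∈ B) : convInverse A h a ∈ B := by
  obtain ⟨N, hN⟩ := convInverse_eq_sum h a
  rw [hN N le_rfl, ofConv_sum_apply]
  exact Submodule.sum_mem _ fun n _ => ha n

/-- A subspace that is a subalgebra and a subcoalgebra is stable under the convolution inverse of the
identity. -/
theorem convInverse_mem (h : ConvDefectNilpotent A) {B : Submodule ℚ A} (h1 : (1 : A) ∈ B)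
    (hm : ∀ a ∈ B, ∀ b ∈ B, a * b ∈ B)
    (hc : ∀ a ∈ B, Coalgebra.comul a ∈ LinearMap.range (TensorProduct.map B.subtype B.subtype))
    {a : A} (ha : a ∈ B) : convInverse A h a ∈ B := by
  refine convInverse_mem_of_forall_pow_mem h fun n => ?_
  have hu : ∀ b : A, algebraMap ℚ A (Coalgebra.counit (R := ℚ) b) ∈ B := fun b => by
    rw [Algebra.algebraMap_eq_smul_one]
    exact B.smul_mem _ h1
  have hd : ∀ b ∈ B, (convDefect A).ofConv b ∈ B := fun b hb => by
    rw [convDefect_apply]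
    exact B.sub_mem (hu b) hb
  induction n generalizing a with
  | zero => exact hu a
  | succ n ih =>
    rw [convDefect_pow_succ_apply]
    obtain ⟨x, hx⟩ := hc a ha
    rw [← hx]
    clear hx
    induction x with
    | zero => simp
    | tmul b c =>
      rw [TensorProduct.map_tmul, TensorProduct.map_tmul, LinearMap.mul'_apply]
      exact hm _ (ih b.2) _ (hd _ c.2)
    | add x y hx hy =>
      rw [map_add, map_add, map_add]
      exact B.add_mem hx hy

/-- The convolution inverse of the identity is even if the coproduct and the counit are. -/
theorem convInverse_mem_graded (h : ConvDefectNilpotent A) {𝒜 : ZMod 2 → Submodule ℚ A}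
    [GradedAlgebra 𝒜]
    (hc : ∀ (i : ZMod 2) (a : A), a ∈ 𝒜 i → Coalgebra.comul a ∈ tensorParityPart 𝒜 i)
    (he : ∀ a ∈ 𝒜 1, Coalgebra.counit (R := ℚ) a = 0) {i : ZMod 2} {a : A} (ha : a ∈ 𝒜 i) :
    convInverse A h a ∈ 𝒜 i := by
  refine convInverse_mem_of_forall_pow_mem h fun n => ?_
  have hu : ∀ (i : ZMod 2), ∀ b ∈ 𝒜 i, algebraMap ℚ A (Coalgebra.counit (R := ℚ) b) ∈ 𝒜 i := by
    intro i b hb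
    have h2 : ∀ i : ZMod 2, i = 0 ∨ i = 1 := by decide
    rcases h2 i with rfl | rfl
    · rw [Algebra.algebraMap_eq_smul_one]
      exact (𝒜 0).smul_mem _ SetLike.GradedOne.one_mem
    · rw [he b hb, map_zero]
      exact (𝒜 1).zero_mem
  have hd : ∀ (i : ZMod 2), ∀ b ∈ 𝒜 i, (convDefect A).ofConv b ∈ 𝒜 i := fun i b hb => by
    rw [convDefect_apply]
    exact (𝒜 i).sub_mem (hu i b hb) hb
  induction n generalizing i a with
  | zero => exact hu i a ha
  | succ n ih =>
    rw [convDefect_pow_succ_apply]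
    suffices hs : tensorParityPart 𝒜 i ≤ (𝒜 i).comap (LinearMap.mul' ℚ A ∘ₗ
        TensorProduct.map (convDefect A ^ n).ofConv (convDefect A).ofConv) from hs (hc i a ha)
    refine iSup_le fun j => ?_
    rintro _ ⟨x, rfl⟩
    rw [Submodule.mem_comap]
    induction x with
    | zero => simp
    | tmul b c =>
      rw [LinearMap.comp_apply, TensorProduct.map_tmul, TensorProduct.map_tmul,
        LinearMap.mul'_apply]
      have := SetLike.GradedMul.mul_mem (ih b.2) (hd _ _ c.2)
      rwa [add_sub_cancel] at this
    | add x y hx hy =>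
      rw [map_add, map_add]
      exact (𝒜 i).add_mem hx hy

end Antipode

section HopfStructure

theorem stdM_mem_parityPart (s : SMonomial ℕ) :
    stdM s ∈ parityPart (α := ℕ) (s.odd.card : ZMod 2) := by
  intro u hu
  rw [stdM_apply] at hu
  have h : u.std = s := by
    by_contra h
    exact hu (if_neg h)
  rw [← h, SMonomial.odd_card_std]

theorem SMonomial.odd_card_relabel_append {γ : Type*} [LinearOrder γ] (u : SMonomial γ)
    {L N : List γ} (h : L.Disjoint N) :
    (u.relabel (L ++ N)).odd.card = (u.relabel L).odd.card + (u.relabel N).odd.card := by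
  rw [odd_relabel_append u h, Finset.card_union_of_disjoint,
    Finset.card_image_of_injective _ (add_right_injective L.length)]
  rw [Finset.disjoint_left]
  intro n h1 h2
  obtain ⟨m, -, rfl⟩ := Finset.mem_image.1 h2
  simp only [relabel, Finset.mem_image, Finset.mem_filter] at h1
  obtain ⟨a, ⟨-, ha⟩, h3⟩ := h1
  have := List.idxOf_lt_length_of_mem ha
  omega

theorem duplicationCoproduct_mem_tensorParityPart {i : ZMod 2} {f : sNCQSym}
    (hf : f ∈ parityPart (α := ℕ) i) :
    duplicationCoproduct f ∈ tensorParityPart (parityPart (α := ℕ)) i := by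
  rw [← stdBasis.linearCombination_repr f, Finsupp.linearCombination_apply, Finsupp.sum, map_sum]
  refine Submodule.sum_mem _ fun s hs => ?_
  rw [map_smul]
  refine Submodule.smul_mem _ _ ?_
  have h1 : (s.1.odd.card : ZMod 2) = i := hf s.1 (Finsupp.mem_support_iff.1 hs)
  rw [stdBasis_eq_relabel, duplicationCoproduct_stdM_relabel s.1.lists_sort]
  refine Submodule.sum_mem _ fun k _ => ?_
  have h2 := SMonomial.odd_card_relabel_append s.1
    (List.disjoint_take_drop (Finset.sort_nodup s.1.ind (· ≤ ·)) (le_refl k))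
  rw [List.take_append_drop, ← SMonomial.std_eq_relabel, s.2] at h2
  refine Submodule.mem_iSup_of_mem
    ((s.1.relabel ((s.1.ind.sort (· ≤ ·)).take k)).odd.card : ZMod 2) ?_
  refine ⟨⟨_, stdM_mem_parityPart _⟩ ⊗ₜ
    ⟨stdM (s.1.relabel ((s.1.ind.sort (· ≤ ·)).drop k)), ?_⟩, rfl⟩
  have h3 := stdM_mem_parityPart (s.1.relabel ((s.1.ind.sort (· ≤ ·)).drop k))
  rw [← h1, h2]
  push_cast
  rwa [add_sub_cancel_left]

/-- Local nilpotency of `ηε - id`, by induction on the number of indices: `ηε - id` kills `1`, so only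
proper initial segments contribute to the next power. -/
theorem convDefect_pow_stdM {γ : Type*} [LinearOrder γ] {t : SMonomial γ} {L : List γ}
    (hL : t.Lists L) {n : ℕ} (hn : L.length < n) :
    (convDefect sNCQSym ^ n).ofConv (stdM (t.relabel L)) = 0 := by
  induction n generalizing L with
  | zero => omega
  | succ n ih =>
    rw [convDefect_pow_succ_apply]
    change LinearMap.mul' ℚ _ (TensorProduct.map _ _
      (duplicationCoproduct (stdM (t.relabel L)))) = 0
    rw [duplicationCoproduct_stdM_relabel hL, map_sum, map_sum]
    refine Finset.sum_eq_zero fun i hi => ?_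
    rw [TensorProduct.map_tmul, LinearMap.mul'_apply]
    have hi' : i ≤ L.length := by simpa [Nat.lt_succ_iff] using hi
    rcases hi'.eq_or_lt with rfl | hlt
    -- The last cut has the right factor `1`, which `ηε - id` kills.
    · rw [List.drop_length, convDefect_apply, stdM_relabel_nil]
      have h1 : Coalgebra.counit (R := ℚ) (1 : sNCQSym) = 1 := by
        rw [← stdM_relabel_nil t]
        exact (constCoeff_stdM_relabel (t := t) (L := []) ⟨List.nodup_nil, by simp⟩).trans
          (if_pos rfl)
      rw [h1, map_one, sub_self, mul_zero]
    · rw [ih (hL.take i) (by simp; omega), zero_mul]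

theorem convDefectNilpotent_sNCQSym : ConvDefectNilpotent sNCQSym := by
  intro f
  have h : ∀ c : StdMonomial →₀ ℚ, ∃ N, ∀ n, N ≤ n →
      (convDefect sNCQSym ^ n).ofConv (Finsupp.linearCombination ℚ stdBasis c) = 0 := by
    intro c
    induction c using Finsupp.induction_linear with
    | zero => exact ⟨0, fun n _ => by rw [map_zero, map_zero]⟩
    | add c d hc hd =>
      obtain ⟨N, hN⟩ := hc
      obtain ⟨M, hM⟩ := hd
      exact ⟨max N M, fun n hn => by
        rw [map_add, map_add, hN n (le_of_max_le_left hn), hM n (le_of_max_le_right hn), add_zero]⟩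
    | single s a =>
      refine ⟨(s.1.ind.sort (· ≤ ·)).length + 1, fun n hn => ?_⟩
      rw [Finsupp.linearCombination_single, map_smul, stdBasis_eq_relabel,
        convDefect_pow_stdM s.1.lists_sort (by omega), smul_zero]
  have := h (stdBasis.repr f)
  rwa [stdBasis.linearCombination_repr] at this

theorem constCoeff_eq_zero_of_odd {f : sNCQSym} (hf : f ∈ parityPart (α := ℕ) 1) :
    constCoeff f = 0 := by
  by_contra h
  have := hf _ h
  simp at this

/-- The Hopf superalgebra `sNCQSym`. -/
noncomputable def hopfSuperalgebra : HopfSuperalgebra (parityPart (α := ℕ)) :=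
  { duplicationCoalgebra with
    comul_even := fun _ _ ha => duplicationCoproduct_mem_tensorParityPart ha
    counit_even := fun _ ha => constCoeff_eq_zero_of_odd ha
    comul_one := by
      have h := duplicationCoproduct_stdM_relabel (t := (⟨∅, []⟩ : SMonomial ℕ)) (L := [])
        ⟨List.nodup_nil, by simp⟩
      rw [stdM_relabel_nil] at h
      refine h.trans ?_
      simp only [List.length_nil, zero_add, Finset.sum_range_one, List.take_nil, List.drop_nil,
        stdM_relabel_nil]
    comul_mul := duplicationCoproduct_mul
    counit_one := rfl
    counit_mul := fun f g => by
      change mulCoeff f.1.1 g.1.1 ⟨∅, []⟩ = f.1.1 ⟨∅, []⟩ * g.1.1 ⟨∅, []⟩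
      simp [mulCoeff, crossSign, crossings]
    antipode := convInverse sNCQSym convDefectNilpotent_sNCQSym
    antipode_even := fun _ _ ha => convInverse_mem_graded _
      (fun _ _ hb => duplicationCoproduct_mem_tensorParityPart hb)
      (fun _ hb => constCoeff_eq_zero_of_odd hb) ha
    mul_antipode_right := mul_convInverse_right _
    mul_antipode_left := mul_convInverse_left _ }

theorem counit_hopfSuperalgebra (f : sNCQSym) : hopfSuperalgebra.counit f = f.1.1 ⟨∅, []⟩ := rfl

end HopfStructure

/-! ### Symmetric functions in noncommuting variables -/

section Symmetric

theorem SMonomial.map_congr {α β : Type*} [LinearOrder α] [LinearOrder β] {φ ψ : α → β}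
    {u : SMonomial α} (h : ∀ a ∈ u.ind, φ a = ψ a) : u.map φ = u.map ψ := by
  unfold map
  congr 1
  · exact Finset.image_congr fun a ha => h a (mem_ind.2 (Or.inl ha))
  · exact List.map_congr_left fun a ha => h a (mem_ind.2 (Or.inr ha))

theorem SMonomial.map_map {α β γ : Type*} [DecidableEq β] [DecidableEq γ] (φ : α → β) (ψ : β → γ)
    (u : SMonomial α) : (u.map φ).map ψ = u.map (ψ ∘ φ) := by
  simp [map, Finset.image_image]

theorem SMonomial.map_id {α : Type*} [DecidableEq α] (u : SMonomial α) : u.map id = u := by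
  simp [map]

/-- Every injective map on a finite set of indices extends to a permutation of finitely many
indices. -/
theorem exists_perm_extending {s : Finset ℕ} {φ : ℕ → ℕ} (h : Set.InjOn φ s) :
    ∃ (n : ℕ) (σ : Equiv.Perm ℕ), (∀ i, n ≤ i → σ i = i) ∧ ∀ a ∈ s, σ a = φ a := by
  induction s using Finset.induction_on with
  | empty => exact ⟨0, 1, fun _ _ => rfl, by simp⟩
  | insert a s ha ih =>
    obtain ⟨n, σ, h1, h2⟩ := ih (h.mono (by simp))
    -- A transposition corrects the value at the new index; it fixes the values at the others, since
    -- `σ` and `φ` are injective.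
    refine ⟨max n (max (σ a + 1) (φ a + 1)), Equiv.swap (σ a) (φ a) * σ, ?_, ?_⟩
    · intro i hi
      rw [Equiv.Perm.mul_apply, h1 i (by omega), Equiv.swap_apply_of_ne_of_ne (by omega) (by omega)]
    · intro b hb
      rw [Equiv.Perm.mul_apply]
      rcases Finset.mem_insert.1 hb with rfl | hb'
      · exact Equiv.swap_apply_left _ _
      · have hba : b ≠ a := fun h => ha (h ▸ hb')
        rw [h2 b hb', Equiv.swap_apply_of_ne_of_ne]
        · rw [← h2 b hb']
          exact σ.injective.ne hba
        · exact fun he => hba (h (by simp [hb']) (by simp) he)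

theorem mem_sNCSym_iff {f : SuperSeries ℕ} : f ∈ sNCSym ↔
    ∀ (n : ℕ) (σ : Equiv.Perm ℕ), (∀ i, n ≤ i → σ i = i) →
      ∀ u, f.1 (u.map σ) = permSign σ u.odd * f.1 u := by
  have h1 : ∀ (σ : Equiv.Perm ℕ) (u : SMonomial ℕ), (u.map σ).map σ.symm = u := fun σ u => by
    rw [SMonomial.map_map, Equiv.symm_comp_self, SMonomial.map_id]
  have h2 : ∀ (σ : Equiv.Perm ℕ) (u : SMonomial ℕ), (u.map σ.symm).map σ = u := fun σ u => by
    rw [SMonomial.map_map, Equiv.self_comp_symm, SMonomial.map_id]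
  constructor
  · intro hf n σ hσ u
    have h3 := congrFun (congrArg Subtype.val (hf n σ hσ)) (u.map σ)
    change permSign σ ((u.map σ).map σ.symm).odd * f.1 ((u.map σ).map σ.symm) = _ at h3
    rw [h1] at h3
    exact h3.symm
  · intro hf n σ hσ
    apply Subtype.ext
    funext v
    have h3 := hf n σ hσ (v.map σ.symm)
    rw [h2] at h3
    exact h3.symm

theorem permSign_eq_one {σ : Equiv.Perm ℕ} {S : Finset ℕ} (h : StrictMonoOn σ S) :
    permSign σ S = 1 := by
  unfold permSign
  rw [Finset.filter_false_of_mem, Finset.card_empty, pow_zero]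
  rintro ⟨a, b⟩ hab ⟨h1, h2⟩
  rw [Finset.mem_product] at hab
  exact (h hab.1 hab.2 h1).not_gt h2

theorem apply_std_of_mem_sNCSym {f : SuperSeries ℕ} (hf : f ∈ sNCSym) (u : SMonomial ℕ) :
    f.1 u.std = f.1 u := by
  obtain ⟨n, σ, h1, h2⟩ := exists_perm_extending (rank_strictMonoOn u.ind).injOn
  have h3 : u.std = u.map σ := SMonomial.map_congr fun a ha => (h2 a ha).symm
  rw [h3, mem_sNCSym_iff.1 hf n σ h1, permSign_eq_one, one_mul]
  intro a ha b hb hab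
  have ha' : a ∈ u.ind := SMonomial.mem_ind.2 (Or.inl ha)
  have hb' : b ∈ u.ind := SMonomial.mem_ind.2 (Or.inl hb)
  rw [h2 a ha', h2 b hb']
  exact rank_strictMonoOn _ ha' hb' hab

/-- Standardizing a monomial is a permutation of indices that is increasing on the odd letters, so
symmetric functions are quasisymmetric. -/
theorem sNCSym_le_sNCQSym : sNCSym ≤ Subalgebra.toSubmodule sNCQSym := by
  intro f hf u v h
  rw [← apply_std_of_mem_sNCSym hf u, ← apply_std_of_mem_sNCSym hf v, h]

theorem permSign_eq_prod (σ : Equiv.Perm ℕ) (S : Finset ℕ) :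
    permSign σ S = ∏ a ∈ S, ∏ b ∈ S, if a < b ∧ σ b < σ a then (-1 : ℚ) else 1 := by
  rw [permSign, ← Finset.prod_product', Finset.prod_ite, Finset.prod_const, Finset.prod_const_one,
    mul_one]

theorem crossSign_eq_prod {α : Type*} [LinearOrder α] (A B : Finset α) :
    crossSign A B = ∏ a ∈ A, ∏ b ∈ B, if b < a then (-1 : ℚ) else 1 := by
  rw [crossSign, crossings, ← Finset.prod_product', Finset.prod_ite, Finset.prod_const,
    Finset.prod_const_one, mul_one]

/-- Permuting the odd variables is compatible with the signs of the product. -/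
theorem crossSign_image_perm (σ : Equiv.Perm ℕ) {S T : Finset ℕ} (h : Disjoint S T) :
    crossSign (S.image σ) (T.image σ) * (permSign σ S * permSign σ T) =
      permSign σ (S ∪ T) * crossSign S T := by
  simp only [crossSign_eq_prod, permSign_eq_prod, Finset.prod_union h, Finset.prod_mul_distrib,
    Finset.prod_image σ.injective.injOn]
  have hc : ∏ a ∈ T, ∏ b ∈ S, (if a < b ∧ σ b < σ a then (-1 : ℚ) else 1) =
      ∏ a ∈ S, ∏ b ∈ T, if b < a ∧ σ a < σ b then (-1 : ℚ) else 1 := Finset.prod_comm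
  have hp : ∏ a ∈ S, ∏ b ∈ T, (if σ b < σ a then (-1 : ℚ) else 1) =
      (∏ a ∈ S, ∏ b ∈ T, if a < b ∧ σ b < σ a then (-1 : ℚ) else 1) *
        (∏ a ∈ S, ∏ b ∈ T, if b < a ∧ σ a < σ b then (-1 : ℚ) else 1) *
        ∏ a ∈ S, ∏ b ∈ T, if b < a then (-1 : ℚ) else 1 := by
    simp only [← Finset.prod_mul_distrib]
    refine Finset.prod_congr rfl fun a ha => Finset.prod_congr rfl fun b hb => ?_
    have hab : a ≠ b := fun hab => Finset.disjoint_left.1 h ha (hab ▸ hb)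
    have hab' : σ a ≠ σ b := σ.injective.ne hab
    rcases lt_or_gt_of_ne hab with h1 | h1 <;> rcases lt_or_gt_of_ne hab' with h2 | h2 <;>
      simp [h1, h2, h1.not_gt, h2.not_gt]
  rw [hc, hp]
  ring

theorem sNCSym_mul_mem {f g : SuperSeries ℕ} (hf : f ∈ sNCSym) (hg : g ∈ sNCSym) :
    f * g ∈ sNCSym := by
  rw [mem_sNCSym_iff] at hf hg ⊢
  intro n σ hσ u
  change mulCoeff f.1 g.1 (u.map σ) = _ * mulCoeff f.1 g.1 u
  unfold mulCoeff
  simp only [SMonomial.map, Finset.powerset_image, List.length_map]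
  rw [Finset.sum_image (Finset.image_injective σ.injective).injOn, Finset.mul_sum]
  refine Finset.sum_congr rfl fun S hS => ?_
  rw [Finset.mul_sum]
  refine Finset.sum_congr rfl fun i _ => ?_
  have h1 := hf n σ hσ ⟨S, u.word.take i⟩
  have h2 := hg n σ hσ ⟨u.odd \ S, u.word.drop i⟩
  have h3 := crossSign_image_perm σ (Finset.disjoint_sdiff : Disjoint S (u.odd \ S))
  rw [Finset.union_sdiff_of_subset (Finset.mem_powerset.1 hS)] at h3
  simp only [SMonomial.map] at h1 h2
  rw [← Finset.image_sdiff _ _ σ.injective, ← List.map_take, ← List.map_drop, h1, h2]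
  linear_combination f.1 ⟨S, u.word.take i⟩ * g.1 ⟨u.odd \ S, u.word.drop i⟩ * h3

theorem one_mem_sNCSym : (1 : SuperSeries ℕ) ∈ sNCSym := by
  rw [mem_sNCSym_iff]
  intro n σ _ u
  change oneCoeff _ = _ * oneCoeff u
  by_cases h : u.odd = ∅ ∧ u.word = []
  · simp [oneCoeff, SMonomial.map, h.1, h.2, permSign]
  · simp [oneCoeff, SMonomial.map, h]

theorem decompose_parityPart (f : sNCQSym) (i : ZMod 2) :
    DirectSum.decompose (parityPart (α := ℕ)) f i = parityProj i f := by
  have h : DirectSum.decompose (parityPart (α := ℕ)) f =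
      ∑ j : ZMod 2, DirectSum.lof ℚ (ZMod 2) (fun j => parityPart (α := ℕ) j) j (parityProj j f) := by
    change (∑ j : ZMod 2, DirectSum.lof ℚ (ZMod 2) (fun i => parityPart (α := ℕ) i) j ∘ₗ
      parityProj j) f = _
    rw [LinearMap.sum_apply]
    rfl
  rw [h, DFinsupp.finsetSum_apply, Finset.sum_eq_single i]
  · exact DirectSum.of_eq_same _ _
  · intro j _ hj
    exact DirectSum.of_eq_of_ne _ _ _ hj.symm
  · simp

theorem parityProj_mem_sNCSym {f : sNCQSym} (hf : f.1 ∈ sNCSym) (i : ZMod 2) :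
    (parityProj i f).1.1 ∈ sNCSym := by
  rw [mem_sNCSym_iff] at hf ⊢
  intro n σ hσ u
  change (if ((u.map σ).odd.card : ZMod 2) = i then f.1.1 (u.map σ) else 0) =
    permSign σ u.odd * if (u.odd.card : ZMod 2) = i then f.1.1 u else 0
  have h : (u.map σ).odd.card = u.odd.card := Finset.card_image_of_injective _ σ.injective
  rw [h, hf n σ hσ u, mul_ite, mul_zero]

end Symmetric

/-! ### Blocks of a monomial and set supercompositions -/

section Blocks

theorem zero_mem_block {u : SMonomial ℕ} {a : ℕ} : 0 ∈ u.block a ↔ a ∈ u.odd := by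
  unfold SMonomial.block
  by_cases h : a ∈ u.odd <;> simp [h]

theorem succ_mem_block {u : SMonomial ℕ} {a t : ℕ} :
    t + 1 ∈ u.block a ↔ u.word[t]? = some a := by
  unfold SMonomial.block
  rw [Finset.mem_union, Finset.mem_filter, Finset.mem_Icc, Nat.add_sub_cancel]
  constructor
  · rintro (h | h)
    · exact h.2
    · by_cases ha : a ∈ u.odd <;> simp [ha] at h
  · intro h
    obtain ⟨hl, -⟩ := List.getElem?_eq_some_iff.1 h
    exact Or.inl ⟨⟨by omega, by omega⟩, h⟩

theorem mem_ind_iff_block_nonempty {u : SMonomial ℕ} {a : ℕ} : a ∈ u.ind ↔ (u.block a).Nonempty := by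
  rw [SMonomial.mem_ind]
  constructor
  · rintro (h | h)
    · exact ⟨0, zero_mem_block.2 h⟩
    · obtain ⟨t, ht⟩ := List.getElem?_of_mem h
      exact ⟨t + 1, succ_mem_block.2 ht⟩
  · rintro ⟨_ | t, ht⟩
    · exact Or.inl (zero_mem_block.1 ht)
    · exact Or.inr (List.mem_of_getElem? (succ_mem_block.1 ht))

/-- A monomial is determined by its blocks. -/
theorem eq_of_block_eq {u v : SMonomial ℕ} (h : ∀ a, u.block a = v.block a) : u = v := by
  apply SMonomial.ext
  · ext a
    rw [← zero_mem_block, h, zero_mem_block]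
  · apply List.ext_getElem?
    intro t
    apply Option.ext
    intro a
    rw [← succ_mem_block, h, succ_mem_block]

theorem blocks_of_ind_eq_range {s : SMonomial ℕ} {k : ℕ} (h : s.ind = Finset.range k) :
    s.blocks = (List.range k).map s.block := by
  rw [SMonomial.blocks, SMonomial.std_of_ind_eq_range h, h, Finset.card_range]

/-- The blocks depend only on the standardization. -/
theorem blocks_std (u : SMonomial ℕ) : u.std.blocks = u.blocks := by
  rw [SMonomial.blocks, SMonomial.std_std, SMonomial.blocks]

theorem std_eq_of_blocks_eq {u v : SMonomial ℕ} (h : u.blocks = v.blocks) : u.std = v.std := by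
  rw [← blocks_std u, ← blocks_std v, blocks_of_ind_eq_range u.ind_std,
    blocks_of_ind_eq_range v.ind_std] at h
  have hlen : u.ind.card = v.ind.card := by simpa using congrArg List.length h
  rw [hlen] at h
  refine eq_of_block_eq fun a => ?_
  by_cases ha : a < v.ind.card
  · exact List.map_inj_left.1 h a (List.mem_range.2 ha)
  · have h1 : ¬ (u.std.block a).Nonempty := by
      rw [← mem_ind_iff_block_nonempty, SMonomial.ind_std, hlen]
      simpa using ha
    have h2 : ¬ (v.std.block a).Nonempty := by
      rw [← mem_ind_iff_block_nonempty, SMonomial.ind_std]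
      simpa using ha
    rw [Finset.not_nonempty_iff_eq_empty.1 h1, Finset.not_nonempty_iff_eq_empty.1 h2]

theorem monomialM_blocks (u : SMonomial ℕ) : monomialM u.blocks = stdM u.std := by
  apply Subtype.ext; apply Subtype.ext
  funext v
  change (if v.blocks = u.blocks then (1 : ℚ) else 0) = if v.std = u.std then 1 else 0
  have : v.blocks = u.blocks ↔ v.std = u.std :=
    ⟨std_eq_of_blocks_eq, fun h => by rw [← blocks_std v, h, blocks_std]⟩
  simp only [this]

/-- The occurrences of `a` in a filtered list, in terms of those in the list. -/
theorem getElem?_filter_eq_some_iff {α : Type*} (p : α → Bool) (w : List α) {a : α} (ha : p a)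
    (j : ℕ) : (w.filter p)[j]? = some a ↔
      ∃ t, w[t]? = some a ∧ j = ((w.take t).filter p).length := by
  induction w generalizing j with
  | nil => simp
  | cons b w ih =>
    by_cases hb : p b
    · rw [List.filter_cons_of_pos hb]
      cases j with
      | zero =>
        constructor
        · intro h
          exact ⟨0, by simpa using h, by simp⟩
        · rintro ⟨_ | t, h1, h2⟩
          · simpa using h1
          · simp [hb] at h2
      | succ j =>
        rw [List.getElem?_cons_succ, ih]
        constructor
        · rintro ⟨t, h1, h2⟩
          exact ⟨t + 1, by simpa using h1, by simp [hb, h2]⟩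
        · rintro ⟨_ | t, h1, h2⟩
          · simp at h2
          · exact ⟨t, by simpa using h1, by simpa [hb] using h2⟩
    · rw [List.filter_cons_of_neg hb, ih]
      constructor
      · rintro ⟨t, h1, h2⟩
        exact ⟨t + 1, by simpa using h1, by simp [hb, h2]⟩
      · rintro ⟨_ | t, h1, h2⟩
        · rw [List.getElem?_cons_zero, Option.some_inj] at h1
          exact absurd (h1 ▸ ha) hb
        · exact ⟨t, by simpa using h1, by simpa [hb] using h2⟩

theorem mem_foldr_union {I : List (Finset ℕ)} {t : ℕ} :
    t ∈ I.foldr (· ∪ ·) ∅ ↔ ∃ B ∈ I, t ∈ B := by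
  induction I with
  | nil => simp
  | cons B I ih => simp [ih]

/-- The renumbering of positions in the standardization of a sequence of sets with union `U`. -/
def posRank (U : Finset ℕ) (t : ℕ) : ℕ := (U.filter (fun s => 0 < s ∧ s ≤ t)).card

theorem stdBlocks_eq (I : List (Finset ℕ)) :
    stdBlocks I = I.map (Finset.image (posRank (I.foldr (· ∪ ·) ∅))) := rfl

theorem posRank_zero (U : Finset ℕ) : posRank U 0 = 0 := by
  unfold posRank
  rw [Finset.card_eq_zero, Finset.filter_eq_empty_iff]
  intro x _
  omega

theorem posRank_pos {U : Finset ℕ} {t : ℕ} (h : t ∈ U) (ht : t ≠ 0) : 0 < posRank U t :=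
  Finset.card_pos.2 ⟨t, Finset.mem_filter.2 ⟨h, by omega, le_rfl⟩⟩

theorem zero_mem_image_posRank {U B : Finset ℕ} (h : B ⊆ U) : 0 ∈ B.image (posRank U) ↔ 0 ∈ B := by
  rw [Finset.mem_image]
  constructor
  · rintro ⟨t, ht, h0⟩
    rcases eq_or_ne t 0 with rfl | hne
    · exact ht
    · exact absurd h0 (posRank_pos (h ht) hne).ne'
  · exact fun h => ⟨0, h, posRank_zero U⟩

theorem posRank_eq_length_filter {u : SMonomial ℕ} {L : List ℕ} {t : ℕ}
    (ht : t ≤ u.word.length) : posRank ((L.map u.block).foldr (· ∪ ·) ∅) t =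
      ((u.word.take t).filter (· ∈ L)).length := by
  induction t with
  | zero => simp [posRank_zero]
  | succ t ih =>
    have ht' : t < u.word.length := by omega
    have hU : t + 1 ∈ (L.map u.block).foldr (· ∪ ·) ∅ ↔ u.word[t] ∈ L := by
      rw [mem_foldr_union]
      constructor
      · rintro ⟨B, hB, h⟩
        obtain ⟨a, ha, rfl⟩ := List.mem_map.1 hB
        rw [succ_mem_block, List.getElem?_eq_getElem ht', Option.some_inj] at h
        exact h ▸ ha
      · intro h
        exact ⟨_, List.mem_map.2 ⟨_, h, rfl⟩, succ_mem_block.2 (List.getElem?_eq_getElem ht')⟩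
    have hs : ∀ U : Finset ℕ, posRank U (t + 1) = posRank U t + if t + 1 ∈ U then 1 else 0 := by
      intro U
      unfold posRank
      split_ifs with h
      · have : U.filter (fun s => 0 < s ∧ s ≤ t + 1) =
            insert (t + 1) (U.filter fun s => 0 < s ∧ s ≤ t) := by
          ext s
          simp only [Finset.mem_filter, Finset.mem_insert]
          constructor
          · rintro ⟨h1, h2⟩
            by_cases h3 : s = t + 1
            · exact Or.inl h3
            · exact Or.inr ⟨h1, by omega⟩
          · rintro (rfl | h1)
            · exact ⟨h, by omega⟩
            · exact ⟨h1.1, by omega⟩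
        rw [this, Finset.card_insert_of_notMem (by simp)]
      · rw [add_zero]
        congr 1
        refine Finset.filter_congr fun s hs => ?_
        have : s ≠ t + 1 := fun h' => h (h' ▸ hs)
        omega
    rw [hs, ih (by omega), List.take_succ_eq_append_getElem ht', List.filter_append,
      List.length_append]
    congr 1
    by_cases h : u.word[t] ∈ L
    · rw [if_pos (hU.2 h)]
      simp [h]
    · rw [if_neg (mt hU.1 h)]
      simp [h]

/-- The blocks of a relabelled monomial are the standardization of the corresponding blocks. -/
theorem blocks_relabel {u : SMonomial ℕ} {L : List ℕ} (hL : u.Lists L) :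
    (u.relabel L).blocks = stdBlocks (L.map u.block) := by
  rw [blocks_of_ind_eq_range (SMonomial.ind_relabel hL), stdBlocks_eq, List.map_map,
    ← map_idxOf_self hL.1, List.map_map]
  refine List.map_congr_left fun a ha => ?_
  rw [Function.comp_apply, Function.comp_apply]
  have hsub : u.block a ⊆ (L.map u.block).foldr (· ∪ ·) ∅ := fun t ht =>
    mem_foldr_union.2 ⟨_, List.mem_map.2 ⟨a, ha, rfl⟩, ht⟩
  ext j
  cases j with
  | zero =>
    rw [zero_mem_image_posRank hsub, zero_mem_block, zero_mem_block]
    simp only [SMonomial.relabel, Finset.mem_image, Finset.mem_filter]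
    constructor
    · rintro ⟨b, ⟨h1, h2⟩, h3⟩
      exact (List.idxOf_inj h2).1 h3 ▸ h1
    · exact fun h => ⟨a, ⟨h, ha⟩, rfl⟩
  | succ j =>
    have h1 : (u.relabel L).word[j]? = some (L.idxOf a) ↔
        (u.word.filter (· ∈ L))[j]? = some a := by
      simp only [SMonomial.relabel, List.getElem?_map, Option.map_eq_some_iff]
      constructor
      · rintro ⟨b, hb, hba⟩
        have hbL : b ∈ L := by simpa using (List.mem_filter.1 (List.mem_of_getElem? hb)).2
        rw [← (List.idxOf_inj hbL).1 hba]
        exact hb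
      · exact fun h => ⟨a, h, rfl⟩
    rw [succ_mem_block, h1, getElem?_filter_eq_some_iff _ _ (by simpa using ha), Finset.mem_image]
    have hc : ∀ t, u.word[t]? = some a → posRank ((L.map u.block).foldr (· ∪ ·) ∅) (t + 1) =
        ((u.word.take t).filter (· ∈ L)).length + 1 := by
      intro t ht
      obtain ⟨hl, h2⟩ := List.getElem?_eq_some_iff.1 ht
      rw [posRank_eq_length_filter (by omega), List.take_succ_eq_append_getElem hl,
        List.filter_append, h2]
      simp [ha]
    constructor
    · rintro ⟨t, ht, rfl⟩
      exact ⟨t + 1, succ_mem_block.2 ht, hc t ht⟩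
    · rintro ⟨_ | t, ht, hj⟩
      · rw [posRank_zero] at hj
        omega
      · rw [succ_mem_block] at ht
        rw [hc t ht] at hj
        exact ⟨t, ht, by omega⟩

theorem stdBlocks_eq_self {I : List (Finset ℕ)}
    (h : ∃ n : ℕ, ∀ t : ℕ, t ≠ 0 → (t ≤ n ↔ ∃ B ∈ I, t ∈ B)) : stdBlocks I = I := by
  obtain ⟨n, hn⟩ := h
  have h1 : ∀ t ∈ I.foldr (· ∪ ·) ∅, posRank (I.foldr (· ∪ ·) ∅) t = t := by
    intro t ht
    have : (I.foldr (· ∪ ·) ∅).filter (fun s => 0 < s ∧ s ≤ t) = Finset.Icc 1 t := by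
      ext s
      rw [Finset.mem_filter, Finset.mem_Icc, mem_foldr_union]
      constructor
      · rintro ⟨-, h1, h2⟩
        exact ⟨h1, h2⟩
      · rintro ⟨h1, h2⟩
        have h3 : t ≤ n := (hn t (by omega)).2 (mem_foldr_union.1 ht)
        exact ⟨(hn s (by omega)).1 (by omega), by omega, h2⟩
    rw [posRank, this, Nat.card_Icc, Nat.add_sub_cancel]
  rw [stdBlocks_eq]
  conv_rhs => rw [← List.map_id I]
  refine List.map_congr_left fun B hB => ?_
  rw [Finset.image_congr (g := id), Finset.image_id, id]
  exact fun t ht => h1 t (mem_foldr_union.2 ⟨B, hB, ht⟩)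

/-- The nonzero elements of the blocks of a monomial are the positions in its word. -/
theorem exists_covering_map_block {u : SMonomial ℕ} {L : List ℕ} (hL : ∀ a ∈ u.ind, a ∈ L) :
    ∃ n : ℕ, ∀ t : ℕ, t ≠ 0 → (t ≤ n ↔ ∃ B ∈ L.map u.block, t ∈ B) := by
  refine ⟨u.word.length, fun t ht => ?_⟩
  obtain ⟨t, rfl⟩ := Nat.exists_eq_succ_of_ne_zero ht
  constructor
  · intro h
    have h1 : u.word[t] ∈ u.ind := SMonomial.mem_ind.2 (Or.inr (List.getElem_mem _))
    exact ⟨_, List.mem_map.2 ⟨_, hL _ h1, rfl⟩,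
      succ_mem_block.2 (List.getElem?_eq_getElem h)⟩
  · rintro ⟨B, hB, h⟩
    obtain ⟨a, -, rfl⟩ := List.mem_map.1 hB
    obtain ⟨hl, -⟩ := List.getElem?_eq_some_iff.1 (succ_mem_block.1 h)
    exact hl

/-- The blocks of `u` in the order of its indices. -/
theorem blocks_eq_map_block (u : SMonomial ℕ) : u.blocks = (u.ind.sort (· ≤ ·)).map u.block := by
  rw [← blocks_std, SMonomial.std_eq_relabel, blocks_relabel u.lists_sort]
  exact stdBlocks_eq_self
    (exists_covering_map_block fun a ha => (Finset.mem_sort _).2 ha)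

/-- Two distinct blocks of a monomial meet at most in `0`. -/
theorem block_inter_subset {u : SMonomial ℕ} {a b : ℕ} (h : a ≠ b) :
    u.block a ∩ u.block b ⊆ {0} := by
  rintro (_ | t) ht
  · simp
  · rw [Finset.mem_inter, succ_mem_block, succ_mem_block] at ht
    exact absurd (Option.some_inj.1 (ht.1.symm.trans ht.2)) h

/-- Every set supercomposition is the sequence of the blocks of a monomial. -/
theorem exists_monomial_of_isSetSupercomposition {I : List (Finset ℕ)}
    (hI : IsSetSupercomposition I) : ∃ u : SMonomial ℕ, u.ind = Finset.range I.length ∧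
      (List.range I.length).map u.block = I := by
  obtain ⟨h1, h2, n, hn⟩ := hI
  have hex : ∀ t, t < n → ∃ r, ∃ h : r < I.length, t + 1 ∈ I[r] := by
    intro t ht
    obtain ⟨B, hB, htB⟩ := (hn (t + 1) (by omega)).1 ht
    obtain ⟨r, hr, rfl⟩ := List.getElem_of_mem hB
    exact ⟨r, hr, htB⟩
  have huniq : ∀ (t r r' : ℕ) (h : r < I.length) (h' : r' < I.length), t + 1 ∈ I[r] →
      t + 1 ∈ I[r'] → r = r' := by
    intro t r r' h h' ht ht'
    rw [List.pairwise_iff_getElem] at h2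
    by_contra hne
    rcases lt_or_gt_of_ne hne with hlt | hlt
    · have := h2 r r' h h' hlt (Finset.mem_inter.2 ⟨ht, ht'⟩)
      simp at this
    · have := h2 r' r h' h hlt (Finset.mem_inter.2 ⟨ht', ht⟩)
      simp at this
  choose! ρ hρ hρ' using hex
  let u : SMonomial ℕ := ⟨(Finset.range I.length).filter fun r => ∃ h : r < I.length, 0 ∈ I[r],
    (List.range n).map ρ⟩
  have hblock : ∀ (r : ℕ) (h : r < I.length), u.block r = I[r] := by
    intro r h
    ext t
    cases t with
    | zero =>
      rw [zero_mem_block, Finset.mem_filter, Finset.mem_range]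
      exact ⟨fun ⟨_, _, h0⟩ => h0, fun h0 => ⟨h, h, h0⟩⟩
    | succ t =>
      rw [succ_mem_block, List.getElem?_map, Option.map_eq_some_iff]
      constructor
      · rintro ⟨t', ht', rfl⟩
        obtain ⟨hl, ht''⟩ := List.getElem?_eq_some_iff.1 ht'
        rw [List.getElem_range] at ht''
        subst ht''
        exact hρ' t (by simpa using hl)
      · intro ht
        have htn : t < n := (hn (t + 1) (by omega)).2 ⟨_, List.getElem_mem h, ht⟩
        exact ⟨t, by simp [htn], huniq t _ _ (hρ t htn) h (hρ' t htn) ht⟩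
  refine ⟨u, ?_, ?_⟩
  · ext r
    rw [Finset.mem_range]
    constructor
    · rw [SMonomial.mem_ind]
      rintro (h | h)
      · exact Finset.mem_range.1 (Finset.mem_filter.1 h).1
      · obtain ⟨t, ht, rfl⟩ := List.mem_map.1 h
        exact hρ t (List.mem_range.1 ht)
    · intro h
      rw [mem_ind_iff_block_nonempty, hblock r h]
      exact h1 _ (List.getElem_mem h)
  · apply List.ext_getElem (by simp)
    intro r hr hr'
    simpa using hblock r hr'

end Blocks

/-! ### Signed sums over orderings -/

section Orderings

/-- The orderings of a finite set: the lists without repetition whose set of entries is `A`. -/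
def orderings {γ : Type*} [DecidableEq γ] (A : Finset γ) : Finset (List γ) :=
  ⟨A.val.lists, Multiset.lists_nodup_finset A⟩

variable {γ δ : Type*} [DecidableEq γ] [DecidableEq δ]

theorem mem_orderings {A : Finset γ} {L : List γ} : L ∈ orderings A ↔ L.Nodup ∧ L.toFinset = A := by
  have h : L ∈ orderings A ↔ A.val = (L : Multiset γ) := Multiset.mem_lists_iff _ _
  rw [h]
  constructor
  · intro h
    have h1 : L.Nodup := by
      rw [← Multiset.coe_nodup, ← h]
      exact A.nodup
    exact ⟨h1, by rw [← Finset.val_inj, h, List.toFinset_val, h1.dedup]⟩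
  · rintro ⟨h1, rfl⟩
    rw [List.toFinset_val, h1.dedup]

theorem length_of_mem_orderings {A : Finset γ} {L : List γ} (h : L ∈ orderings A) :
    L.length = A.card := by
  rw [mem_orderings] at h
  rw [← h.2, List.toFinset_card_of_nodup h.1]

theorem mem_of_mem_orderings {A : Finset γ} {L : List γ} (h : L ∈ orderings A) {a : γ} :
    a ∈ L ↔ a ∈ A := by
  rw [← (mem_orderings.1 h).2, List.mem_toFinset]

theorem prod_map_of_mem_orderings {A : Finset γ} {L : List γ} (h : L ∈ orderings A) (f : γ → ℚ) :
    (L.map f).prod = ∏ a ∈ A, f a := by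
  rw [mem_orderings] at h
  rw [← h.2, List.prod_toFinset f h.1]

/-- The orderings of the set enumerated by `h` correspond to the permutations. -/
theorem sum_orderings {A : Finset γ} {k : ℕ} {M : Type*} [AddCommMonoid M] {h : Fin k → γ}
    (hinj : Function.Injective h) (hA : Finset.univ.image h = A) (G : List γ → M) :
    ∑ L ∈ orderings A, G L = ∑ σ : Equiv.Perm (Fin k), G (List.ofFn (h ∘ σ)) := by
  symm
  refine Finset.sum_bij (fun σ _ => List.ofFn (h ∘ σ)) ?_ ?_ ?_ ?_
  · intro σ _
    rw [mem_orderings, List.nodup_ofFn]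
    refine ⟨hinj.comp σ.injective, ?_⟩
    ext a
    rw [← hA]
    simp only [List.mem_toFinset, List.mem_ofFn, Function.comp, Finset.mem_image, Finset.mem_univ,
      true_and]
    exact ⟨fun ⟨r, hr⟩ => ⟨σ r, hr⟩, fun ⟨r, hr⟩ => ⟨σ.symm r, by simpa using hr⟩⟩
  · intro σ _ τ _ he
    have h1 := List.ofFn_injective he
    ext r
    exact congrArg Fin.val (hinj (congrFun h1 r))
  · intro L hL
    have hcard : A.card = k := by
      rw [← hA, Finset.card_image_of_injective _ hinj, Finset.card_univ, Fintype.card_fin]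
    have hlen : L.length = k := (length_of_mem_orderings hL).trans hcard
    subst hlen
    have hex : ∀ r : Fin L.length, ∃ s, h s = L.get r := by
      intro r
      have : L.get r ∈ A := (mem_of_mem_orderings hL).1 (List.get_mem _ _)
      rw [← hA] at this
      simpa using this
    choose s hs using hex
    have hsinj : Function.Injective s := by
      intro r r' hrr
      apply (List.nodup_iff_injective_get.1 (mem_orderings.1 hL).1)
      rw [← hs, ← hs, hrr]
    refine ⟨Equiv.ofBijective s (Finite.injective_iff_bijective.1 hsinj), Finset.mem_univ _, ?_⟩
    conv_rhs => rw [← List.ofFn_get L]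
    congr 1
    funext r
    exact hs r
  · intro σ _
    rfl

theorem map_mem_orderings (σ : γ ≃ δ) {A : Finset γ} {L : List γ} (h : L ∈ orderings A) :
    L.map σ ∈ orderings (A.image σ) := by
  rw [mem_orderings] at h ⊢
  refine ⟨h.1.map σ.injective, ?_⟩
  rw [← h.2]
  ext
  simp

end Orderings

section PairProd
variable {γ : Type*}

/-- The product of `s a b` over all pairs of entries of a list with `a` before `b`. -/
def pairProd (s : γ → γ → ℚ) : List γ → ℚ
  | [] => 1
  | a :: L => (L.map (s a)).prod * pairProd s L

theorem pairProd_append (s : γ → γ → ℚ) (L N : List γ) : pairProd s (L ++ N) =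
    pairProd s L * pairProd s N * (L.map fun a => (N.map (s a)).prod).prod := by
  induction L with
  | nil => simp [pairProd]
  | cons a L ih =>
    simp only [List.cons_append, pairProd, List.map_append, List.prod_append, ih, List.map_cons,
      List.prod_cons]
    ring

theorem pairProd_map {δ : Type*} (s : δ → δ → ℚ) (φ : γ → δ) (L : List γ) :
    pairProd s (L.map φ) = pairProd (fun a b => s (φ a) (φ b)) L := by
  induction L with
  | nil => rfl
  | cons a L ih => simp only [List.map_cons, pairProd, ih, List.map_map, Function.comp_def]

theorem pairProd_mul (s t : γ → γ → ℚ) (L : List γ) :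
    pairProd (fun a b => s a b * t a b) L = pairProd s L * pairProd t L := by
  induction L with
  | nil => simp [pairProd]
  | cons a L ih =>
    simp only [pairProd, ih, List.prod_map_mul]
    ring

theorem pairProd_congr {s t : γ → γ → ℚ} {L : List γ} (hL : L.Nodup)
    (h : ∀ a b, a ≠ b → s a b = t a b) : pairProd s L = pairProd t L := by
  induction L with
  | nil => rfl
  | cons a L ih =>
    rw [List.nodup_cons] at hL
    rw [pairProd, pairProd, ih hL.2,
      List.map_congr_left fun b hb => h a b fun hab => hL.1 (hab ▸ hb)]

theorem pairProd_ofFn (s : γ → γ → ℚ) {k : ℕ} (h : Fin k → γ) : pairProd s (List.ofFn h) =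
    ∏ i : Fin k, ∏ j : Fin k, if i < j then s (h i) (h j) else 1 := by
  induction k with
  | zero => simp [pairProd]
  | succ k ih =>
    rw [List.ofFn_succ, pairProd, ih, Fin.prod_univ_succ, Fin.prod_univ_succ, if_neg (lt_irrefl _),
      one_mul, List.map_ofFn, List.prod_ofFn]
    congr 1
    refine Finset.prod_congr rfl fun i _ => ?_
    rw [Fin.prod_univ_succ, if_neg (Fin.not_lt_zero _), one_mul]
    simp only [Fin.succ_lt_succ_iff]

/-- A product over all ordered pairs of entries is a product over all unordered pairs. -/
theorem prod_prod_eq_pairProd (t : γ → γ → ℚ) (ht : ∀ a, t a a = 1) (L : List γ) :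
    (L.map fun a => (L.map (t a)).prod).prod = pairProd (fun a b => t a b * t b a) L := by
  induction L with
  | nil => rfl
  | cons a L ih =>
    simp only [List.map_cons, List.prod_cons, pairProd, ← ih, List.prod_map_mul, ht]
    ring

end PairProd

section Signs

/-- The factor of a pair of letters `a`, `b`, in this order, in the sign that sorts the odd letters,
which are those in `F`. -/
def oddFactor {γ : Type*} [LinearOrder γ] (F : Finset γ) (a b : γ) : ℚ :=
  if a ∈ F ∧ b ∈ F ∧ b < a then -1 else 1

/-- The sign of an ordering changes under a permutation of the letters by the sign with which the
permutation acts on the product of the odd letters. -/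
theorem pairProd_map_perm (σ : Equiv.Perm ℕ) {S A : Finset ℕ} (hS : S ⊆ A) {L : List ℕ}
    (hL : L ∈ orderings A) : pairProd (oddFactor (S.image σ)) (L.map σ) =
      permSign σ S * pairProd (oddFactor S) L := by
  let t : ℕ → ℕ → ℚ := fun a b => if (a ∈ S ∧ b ∈ S) ∧ (a < b ∧ σ b < σ a) then -1 else 1
  have h1 : permSign σ S = pairProd (fun a b => t a b * t b a) L := by
    rw [← prod_prod_eq_pairProd t (by intro a; simp [t]), prod_map_of_mem_orderings hL]
    simp only [prod_map_of_mem_orderings hL]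
    rw [permSign_eq_prod]
    have h2 : ∀ a ∈ S, ∏ b ∈ S, (if a < b ∧ σ b < σ a then (-1 : ℚ) else 1) = ∏ b ∈ A, t a b := by
      intro a ha
      refine (Finset.prod_congr rfl fun b hb => ?_).trans (Finset.prod_subset hS fun b _ hb => ?_)
      · simp [t, ha, hb]
      · simp [t, hb]
    rw [Finset.prod_congr rfl h2]
    refine Finset.prod_subset hS fun a _ ha => Finset.prod_eq_one fun b _ => ?_
    simp [t, ha]
  rw [h1, pairProd_map, ← pairProd_mul]
  refine pairProd_congr (mem_orderings.1 hL).1 fun a b hab => ?_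
  have hab' : σ a ≠ σ b := σ.injective.ne hab
  have hm : ∀ c, σ c ∈ S.image σ ↔ c ∈ S := fun c => by simp
  simp only [oddFactor, t, hm]
  by_cases ha : a ∈ S <;> by_cases hb : b ∈ S <;> rcases lt_or_gt_of_ne hab with h1 | h1 <;>
    rcases lt_or_gt_of_ne hab' with h2 | h2 <;> simp [ha, hb, h1, h2, h1.not_gt, h2.not_gt]

theorem neg_one_pow_card_filter {ι : Type*} [Fintype ι] (p : ι × ι → Prop) [DecidablePred p] :
    (-1 : ℚ) ^ (Finset.univ.filter p).card = ∏ i, ∏ j, if p (i, j) then -1 else 1 := by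
  rw [← Finset.univ_product_univ,
    ← Finset.prod_product' (f := fun i j => if p (i, j) then (-1 : ℚ) else 1),
    Finset.prod_ite, Finset.prod_const, Finset.prod_const_one, mul_one]

end Signs

section MonomialSym

theorem monomialSym_apply (I : List (Finset ℕ)) (v : SMonomial ℕ) :
    (monomialSym I).1.1 v = ∑ σ : Equiv.Perm (Fin I.length), (-1 : ℚ) ^ invPerm I σ *
      if v.blocks = List.ofFn (fun r => I.get (σ r)) then 1 else 0 := by
  let ev : sNCQSym →ₗ[ℚ] ℚ :=
    { toFun := fun f => f.1.1 v, map_add' := fun _ _ => rfl, map_smul' := fun _ _ => rfl }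
  change ev (monomialSym I) = _
  rw [monomialSym, map_sum]
  rfl

/-- The coefficients of `m_I`: all orderings of the indices of `v` along which the blocks of `v` are
those of `I` contribute a sign. -/
theorem monomialSym_apply_eq_sum_orderings (I : List (Finset ℕ)) (v : SMonomial ℕ) :
    (monomialSym I).1.1 v = ∑ L ∈ orderings v.ind,
      pairProd (oddFactor v.odd) L * if L.map v.block = I then 1 else 0 := by
  rw [monomialSym_apply]
  by_cases hk : v.ind.card = I.length
  · let h := v.ind.orderEmbOfFin hk
    rw [sum_orderings (h := h) h.injective (Finset.image_orderEmbOfFin_univ _ _),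
      ← Equiv.sum_comp (Equiv.inv _)]
    refine Finset.sum_congr rfl fun σ _ => ?_
    -- The blocks of `v` in increasing order of the indices are `I` permuted by `σ⁻¹` exactly when they
    -- are `I` in the order of the indices given by `σ`; this is why the sum is reindexed by inversion.
    have hb : v.blocks = List.ofFn (v.block ∘ h) := by
      rw [blocks_eq_map_block, ← Finset.listMap_orderEmbOfFin_finRange _ hk, List.map_map,
        List.ofFn_eq_map]
    have hiff : v.blocks = List.ofFn (fun r => I.get ((Equiv.inv _ σ) r)) ↔
        (List.ofFn (h ∘ σ)).map v.block = I := by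
      have hI : (List.ofFn (h ∘ σ)).map v.block = I ↔
          List.ofFn (v.block ∘ h ∘ σ) = List.ofFn I.get := by
        rw [List.ofFn_get, List.map_ofFn]
      rw [hb, hI, List.ofFn_injective.eq_iff, List.ofFn_injective.eq_iff, funext_iff, funext_iff]
      constructor
      · intro H r
        have := H (σ r)
        simpa using this
      · intro H r
        have := H (σ.symm r)
        simpa using this
    simp only [hiff]
    split_ifs with hcond
    · congr 1
      rw [pairProd_ofFn, invPerm, neg_one_pow_card_filter]
      rw [List.map_ofFn] at hcond
      have hz : ∀ p : Fin I.length, 0 ∈ I.get p ↔ h (σ p) ∈ v.odd := by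
        intro p
        have h2 := congrFun (List.ofFn_injective (hcond.trans (List.ofFn_get I).symm)) p
        rw [← h2]
        exact zero_mem_block
      refine Finset.prod_congr rfl fun p _ => Finset.prod_congr rfl fun q _ => ?_
      simp only [hz, oddFactor, Function.comp_apply, h.lt_iff_lt]
      change (if p < q ∧ _ ∧ _ ∧ σ q < σ p then (-1 : ℚ) else 1) = _
      by_cases hpq : p < q <;> simp [hpq]
    · rw [mul_zero, mul_zero]
  · rw [Finset.sum_eq_zero, Finset.sum_eq_zero]
    · intro L hL
      rw [if_neg, mul_zero]
      intro h
      have := congrArg List.length h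
      rw [List.length_map, length_of_mem_orderings hL] at this
      exact hk this
    · intro σ _
      rw [if_neg, mul_zero]
      intro h
      have := congrArg List.length h
      rw [blocks_eq_map_block, List.length_map, Finset.length_sort, List.length_ofFn] at this
      exact hk this

theorem block_map_perm (σ : Equiv.Perm ℕ) (u : SMonomial ℕ) (a : ℕ) :
    (u.map σ).block (σ a) = u.block a := by
  ext t
  cases t with
  | zero =>
    rw [zero_mem_block, zero_mem_block]
    simp [SMonomial.map]
  | succ t =>
    rw [succ_mem_block, succ_mem_block]
    simp [SMonomial.map]

/-- The functions `m_I` are symmetric: a permutation of the variables permutes the orderings and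
changes all their signs by the same factor. -/
theorem monomialSym_mem_sNCSym (I : List (Finset ℕ)) : (monomialSym I).1 ∈ sNCSym := by
  rw [mem_sNCSym_iff]
  intro n σ _ u
  rw [monomialSym_apply_eq_sum_orderings, monomialSym_apply_eq_sum_orderings, Finset.mul_sum,
    SMonomial.ind_map]
  symm
  refine Finset.sum_bij' (fun L _ => L.map σ) (fun L _ => L.map σ.symm)
    (fun L hL => map_mem_orderings σ hL) ?_ (fun L _ => by simp) (fun L _ => by simp) ?_
  · intro L hL
    have := map_mem_orderings σ.symm hL
    simpa [Finset.image_image] using this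
  · intro L hL
    have h1 : (L.map σ).map (u.map σ).block = L.map u.block := by
      rw [List.map_map]
      exact List.map_congr_left fun a _ => block_map_perm σ u a
    have h2 : (u.map σ).odd = u.odd.image σ := rfl
    rw [h1, h2, pairProd_map_perm σ (Finset.subset_union_left : u.odd ⊆ u.ind) hL, mul_assoc]

/-- `m_J` as a signed sum over the orderings of an index set `A` for the blocks of `J`. -/
theorem monomialSym_eq_sum_orderings {γ : Type*} [LinearOrder γ] {A F : Finset γ}
    {g : γ → Finset ℕ} (hF : ∀ a ∈ A, 0 ∈ g a ↔ a ∈ F) {J : List (Finset ℕ)}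
    (hJ : J = (A.sort (· ≤ ·)).map g) :
    monomialSym J = ∑ L ∈ orderings A, pairProd (oddFactor F) L • monomialM (L.map g) := by
  have hk : A.card = J.length := by rw [hJ, List.length_map, Finset.length_sort]
  let h := A.orderEmbOfFin hk
  have hg : ∀ r, J.get r = g (h r) := by
    have h1 : J = List.ofFn (g ∘ h) := by
      conv_lhs => rw [hJ, ← Finset.listMap_orderEmbOfFin_finRange _ hk, List.map_map]
      rw [List.ofFn_eq_map]
    have h2 := List.ofFn_injective ((List.ofFn_get J).trans h1)
    exact fun r => congrFun h2 r
  rw [monomialSym, sum_orderings (h := h) h.injective (Finset.image_orderEmbOfFin_univ _ _)]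
  refine Finset.sum_congr rfl fun σ _ => ?_
  congr 1
  · rw [pairProd_ofFn, invPerm, neg_one_pow_card_filter, Finset.prod_comm,
      ← Equiv.prod_comp σ]
    refine Finset.prod_congr rfl fun i _ => ?_
    rw [← Equiv.prod_comp σ]
    refine Finset.prod_congr rfl fun j _ => ?_
    simp only [hg, hF _ (A.orderEmbOfFin_mem hk _), h, oddFactor, Function.comp_apply,
      Equiv.symm_apply_apply, OrderEmbedding.lt_iff_lt]
    by_cases h1 : i < j <;> simp [h1]
    congr 1
    apply propext
    tauto
  · rw [List.map_ofFn]
    congr 2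
    funext r
    exact hg _

end MonomialSym

/-! ### The coproduct of the monomial symmetric functions -/

section CoproductOfMonomialSym

/-- A signed sum over orderings of deconcatenations is a signed sum over subsets. -/
theorem sum_orderings_deconcatenation {γ V : Type*} [LinearOrder γ] [Fintype γ] [AddCommGroup V]
    [Module ℚ V] (s : γ → γ → ℚ) (m : List γ → V) :
    ∑ L ∈ orderings (Finset.univ : Finset γ), pairProd s L •
        ∑ i ∈ Finset.range (L.length + 1), m (L.take i) ⊗ₜ[ℚ] m (L.drop i) =
      ∑ A : Finset γ, (∏ a ∈ A, ∏ b ∈ Aᶜ, s a b) •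
        ((∑ L ∈ orderings A, pairProd s L • m L) ⊗ₜ[ℚ]
          ∑ L ∈ orderings Aᶜ, pairProd s L • m L) := by
  have hR : ∀ A : Finset γ, (∏ a ∈ A, ∏ b ∈ Aᶜ, s a b) •
        ((∑ L ∈ orderings A, pairProd s L • m L) ⊗ₜ[ℚ]
          ∑ L ∈ orderings Aᶜ, pairProd s L • m L) =
      ∑ q ∈ orderings A ×ˢ orderings Aᶜ, pairProd s (q.1 ++ q.2) • (m q.1 ⊗ₜ[ℚ] m q.2) := by
    intro A
    rw [TensorProduct.sum_tmul, Finset.smul_sum, Finset.sum_product]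
    refine Finset.sum_congr rfl fun L hL => ?_
    rw [TensorProduct.tmul_sum, Finset.smul_sum]
    refine Finset.sum_congr rfl fun N hN => ?_
    rw [TensorProduct.smul_tmul_smul, smul_smul, pairProd_append, prod_map_of_mem_orderings hL]
    simp only [prod_map_of_mem_orderings hN]
    congr 1
    ring
  simp only [hR, Finset.smul_sum]
  rw [Finset.sum_sigma', Finset.sum_sigma']
  refine Finset.sum_bij' (fun q _ => ⟨(q.1.take q.2).toFinset, (q.1.take q.2, q.1.drop q.2)⟩)
    (fun q _ => ⟨q.2.1 ++ q.2.2, q.2.1.length⟩) ?_ ?_ ?_ ?_ ?_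
  · rintro ⟨L, i⟩ hq
    simp only [Finset.mem_sigma, Finset.mem_range, mem_orderings] at hq
    simp only [Finset.mem_sigma, Finset.mem_univ, true_and, Finset.mem_product, mem_orderings,
      and_true]
    refine ⟨hq.1.1.sublist (List.take_sublist _ _), hq.1.1.sublist (List.drop_sublist _ _), ?_⟩
    have hd := List.disjoint_take_drop hq.1.1 (le_refl i)
    ext a
    rw [Finset.mem_compl, List.mem_toFinset, List.mem_toFinset]
    refine ⟨fun h1 h2 => hd h2 h1, fun h => ?_⟩
    have h1 : a ∈ L.take i ++ L.drop i := by
      rw [List.take_append_drop, ← List.mem_toFinset, hq.1.2]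
      exact Finset.mem_univ a
    exact (List.mem_append.1 h1).resolve_left h
  · rintro ⟨A, L, N⟩ hq
    simp only [Finset.mem_sigma, Finset.mem_univ, true_and, Finset.mem_product, mem_orderings] at hq
    simp only [Finset.mem_sigma, mem_orderings, Finset.mem_range, List.length_append,
      List.nodup_append', List.toFinset_append]
    refine ⟨⟨⟨hq.1.1, hq.2.1, ?_⟩, ?_⟩, by omega⟩
    · intro a h1 h2
      rw [← List.mem_toFinset, hq.1.2] at h1
      rw [← List.mem_toFinset, hq.2.2, Finset.mem_compl] at h2
      exact h2 h1
    · rw [hq.1.2, hq.2.2, Finset.union_compl]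
  · rintro ⟨L, i⟩ hq
    simp only [Finset.mem_sigma, Finset.mem_range] at hq
    simp only [List.take_append_drop, List.length_take]
    rw [min_eq_left (by omega)]
  · rintro ⟨A, L, N⟩ hq
    simp only [Finset.mem_sigma, Finset.mem_univ, true_and, Finset.mem_product, mem_orderings] at hq
    simp only [List.take_left, List.drop_left, hq.1.2]
  · rintro ⟨L, i⟩ _
    simp only [List.take_append_drop]

/-- The indices of the fermionic blocks. -/
def fermionic (I : List (Finset ℕ)) : Finset (Fin I.length) :=
  Finset.univ.filter fun r => 0 ∈ I.get r

theorem mem_fermionic {I : List (Finset ℕ)} {r : Fin I.length} :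
    r ∈ fermionic I ↔ 0 ∈ I.get r := by
  simp [fermionic]

/-- The sign of a subset: moving the odd letters of `A` before those of its complement. -/
theorem neg_one_pow_invSubset (I : List (Finset ℕ)) (A : Finset (Fin I.length)) :
    (-1 : ℚ) ^ invSubset I A = ∏ a ∈ A, ∏ b ∈ Aᶜ, oddFactor (fermionic I) a b := by
  rw [Finset.prod_comm, ← Finset.prod_product', invSubset]
  simp only [oddFactor, mem_fermionic]
  rw [Finset.prod_ite, Finset.prod_const, Finset.prod_const_one, mul_one]
  congr 2
  refine Finset.filter_congr fun p _ => ?_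
  tauto

theorem subBlocks_univ (I : List (Finset ℕ)) : subBlocks I Finset.univ = I := by
  rw [subBlocks, Fin.sort_univ, ← List.ofFn_eq_map, List.ofFn_get]

/-- For `u` with blocks `I`: the function `m` of the standardized subsequence of `I` indexed by `A`,
as a signed sum of relabellings of `u`. -/
theorem monomialSym_stdBlocks_subBlocks {I : List (Finset ℕ)} {u : SMonomial ℕ}
    (hu : u.ind = Finset.range I.length) (hb : (List.range I.length).map u.block = I)
    (A : Finset (Fin I.length)) : monomialSym (stdBlocks (subBlocks I A)) =
      ∑ L ∈ orderings A, pairProd (oddFactor (fermionic I)) L •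
        stdM (u.relabel (L.map Fin.val)) := by
  have hblock : ∀ r : Fin I.length, I.get r = u.block r := by
    intro r
    have h1 : I[r.1]? = ((List.range I.length).map u.block)[r.1]? := by rw [hb]
    simpa using h1
  have hmem : ∀ L ∈ orderings A, ∀ t, t ∈ (L.map I.get).foldr (· ∪ ·) ∅ ↔
      t ∈ (subBlocks I A).foldr (· ∪ ·) ∅ := by
    intro L hL t
    rw [mem_foldr_union, mem_foldr_union, subBlocks]
    simp only [List.mem_map, mem_of_mem_orderings hL, Finset.mem_sort]
  have hF : ∀ r ∈ A, 0 ∈ (I.get r).image (posRank ((subBlocks I A).foldr (· ∪ ·) ∅)) ↔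
      r ∈ fermionic I := by
    intro r hr
    rw [mem_fermionic, zero_mem_image_posRank]
    exact fun t ht => mem_foldr_union.2
      ⟨_, List.mem_map.2 ⟨r, (Finset.mem_sort _).2 hr, rfl⟩, ht⟩
  have hJ : stdBlocks (subBlocks I A) = (A.sort (· ≤ ·)).map fun r =>
      (I.get r).image (posRank ((subBlocks I A).foldr (· ∪ ·) ∅)) := by
    rw [stdBlocks_eq, subBlocks, List.map_map]
    rfl
  rw [monomialSym_eq_sum_orderings hF hJ]
  refine Finset.sum_congr rfl fun L hL => ?_
  have hL' : u.Lists (L.map Fin.val) := by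
    refine ⟨(mem_orderings.1 hL).1.map Fin.val_injective, fun a ha => ?_⟩
    obtain ⟨r, -, rfl⟩ := List.mem_map.1 ha
    rw [hu, Finset.mem_range]
    exact r.2
  have h1 : L.map (fun r => (I.get r).image (posRank ((subBlocks I A).foldr (· ∪ ·) ∅))) =
      (u.relabel (L.map Fin.val)).blocks := by
    have h2 : (L.map Fin.val).map u.block = L.map I.get := by
      rw [List.map_map]
      exact List.map_congr_left fun r _ => (hblock r).symm
    rw [blocks_relabel hL', h2, stdBlocks_eq, List.map_map, Finset.ext (hmem L hL)]
    rfl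
  rw [h1, monomialM_blocks, SMonomial.std_relabel hL']

/-- The coproduct of the monomial symmetric functions. -/
theorem duplicationCoproduct_monomialSym {I : List (Finset ℕ)} (hI : IsSetSupercomposition I) :
    duplicationCoproduct (monomialSym I) = ∑ A : Finset (Fin I.length),
      (-1 : ℚ) ^ invSubset I A • (monomialSym (stdBlocks (subBlocks I A)) ⊗ₜ[ℚ]
        monomialSym (stdBlocks (subBlocks I Aᶜ))) := by
  obtain ⟨u, hu, hb⟩ := exists_monomial_of_isSetSupercomposition hI
  have h1 : monomialSym I = monomialSym (stdBlocks (subBlocks I Finset.univ)) := by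
    rw [subBlocks_univ, stdBlocks_eq_self hI.2.2]
  rw [h1, monomialSym_stdBlocks_subBlocks hu hb, map_sum]
  have h2 : ∀ L ∈ orderings (Finset.univ : Finset (Fin I.length)),
      duplicationCoproduct (pairProd (oddFactor (fermionic I)) L •
        stdM (u.relabel (L.map Fin.val))) = pairProd (oddFactor (fermionic I)) L •
          ∑ i ∈ Finset.range (L.length + 1), stdM (u.relabel ((L.take i).map Fin.val)) ⊗ₜ[ℚ]
            stdM (u.relabel ((L.drop i).map Fin.val)) := by
    intro L hL
    have hL' : u.Lists (L.map Fin.val) := by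
      refine ⟨(mem_orderings.1 hL).1.map Fin.val_injective, fun a ha => ?_⟩
      obtain ⟨r, -, rfl⟩ := List.mem_map.1 ha
      rw [hu, Finset.mem_range]
      exact r.2
    rw [map_smul, duplicationCoproduct_stdM_relabel hL', List.length_map]
    simp only [List.map_take, List.map_drop]
  rw [Finset.sum_congr rfl h2, sum_orderings_deconcatenation (oddFactor (fermionic I))
    fun L => stdM (u.relabel (L.map Fin.val))]
  refine Finset.sum_congr rfl fun A _ => ?_
  rw [neg_one_pow_invSubset, monomialSym_stdBlocks_subBlocks hu hb,
    monomialSym_stdBlocks_subBlocks hu hb]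

end CoproductOfMonomialSym

/-! ### Set superpartitions and the monomial basis of the symmetric functions -/

section BlockOrder

/-- The key by which the blocks of a set superpartition are sorted: the fermionic blocks come first,
and blocks of the same kind are compared by their least nonzero elements. -/
noncomputable def blockKey (B : Finset ℕ) : ℕ ×ₗ ℕ :=
  toLex (if 0 ∈ B then 0 else 1, minZero (B.erase 0))

theorem minZero_mem {B : Finset ℕ} (h : B.Nonempty) : minZero B ∈ B :=
  Nat.sInf_mem (s := (B : Set ℕ)) h

theorem minZero_eq_zero {B : Finset ℕ} (h : 0 ∈ B) : minZero B = 0 :=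
  Nat.le_zero.1 (Nat.sInf_le (s := (B : Set ℕ)) h)

theorem minZero_pos {B : Finset ℕ} (h : B.Nonempty) (h0 : 0 ∉ B) : 0 < minZero B :=
  Nat.pos_of_ne_zero fun h1 => h0 (h1 ▸ minZero_mem h)

theorem sdiff_eq_erase_zero {B C : Finset ℕ} (h : B ∩ C ⊆ {0}) (h0 : 0 ∈ B → 0 ∈ C) :
    B \ C = B.erase 0 := by
  ext t
  rw [Finset.mem_sdiff, Finset.mem_erase]
  constructor
  · rintro ⟨h1, h2⟩
    exact ⟨fun ht => h2 (ht ▸ h0 (ht ▸ h1)), h1⟩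
  · rintro ⟨h1, h2⟩
    exact ⟨h2, fun h3 => h1 (Finset.mem_singleton.1 (h (Finset.mem_inter.2 ⟨h2, h3⟩)))⟩

/-- Sorting blocks by `blockKey` realizes the order required of a set superpartition. -/
theorem minZero_sdiff_lt_of_blockKey_lt {B C : Finset ℕ} (hC : C.Nonempty)
    (h : B ∩ C ⊆ {0}) (hlt : blockKey B < blockKey C) :
    minZero (B \ C) < minZero (C \ B) := by
  have h' : C ∩ B ⊆ {0} := by rwa [Finset.inter_comm]
  rw [blockKey, blockKey, Prod.Lex.toLex_lt_toLex] at hlt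
  by_cases hB0 : 0 ∈ B <;> by_cases hC0 : 0 ∈ C
  · rw [sdiff_eq_erase_zero h fun _ => hC0, sdiff_eq_erase_zero h' fun _ => hB0]
    simpa [hB0, hC0] using hlt
  · rw [minZero_eq_zero (Finset.mem_sdiff.2 ⟨hB0, hC0⟩),
      sdiff_eq_erase_zero h' fun h => absurd h hC0, Finset.erase_eq_of_notMem hC0]
    exact minZero_pos hC hC0
  · simp [hB0, hC0] at hlt
  · rw [sdiff_eq_erase_zero h fun h => absurd h hB0, sdiff_eq_erase_zero h' fun h => absurd h hC0]
    simpa [hB0, hC0] using hlt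

theorem eq_of_blockKey_eq {B C : Finset ℕ} (hB : B.Nonempty) (hC : C.Nonempty)
    (h : B ∩ C ⊆ {0}) (he : blockKey B = blockKey C) : B = C := by
  have h1 := Prod.ext_iff.1 (toLex.injective he)
  have h0 : 0 ∈ B ↔ 0 ∈ C := by
    have := h1.1
    by_cases hB0 : 0 ∈ B <;> by_cases hC0 : 0 ∈ C <;> simp [hB0, hC0] at this ⊢
  have hmin : minZero (B.erase 0) = minZero (C.erase 0) := h1.2
  have hempty : B.erase 0 = ∅ ∧ C.erase 0 = ∅ := by
    by_contra hne
    have hpos : 0 < minZero (B.erase 0) := by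
      rw [not_and_or, ← Ne, ← Ne, ← Finset.nonempty_iff_ne_empty,
        ← Finset.nonempty_iff_ne_empty] at hne
      rcases hne with hne | hne
      · exact minZero_pos hne (Finset.notMem_erase _ _)
      · rw [hmin]
        exact minZero_pos hne (Finset.notMem_erase _ _)
    have hmem : ∀ D : Finset ℕ, 0 < minZero D → minZero D ∈ D := fun D hD =>
      minZero_mem (Finset.nonempty_iff_ne_empty.2 fun hD' => by
        rw [hD'] at hD
        simp [minZero] at hD)
    have h2 := Finset.mem_of_mem_erase (hmem _ hpos)
    have h3 := Finset.mem_of_mem_erase (hmem _ (hmin ▸ hpos))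
    rw [← hmin] at h3
    have := Finset.mem_singleton.1 (h (Finset.mem_inter.2 ⟨h2, h3⟩))
    omega
  have hsingle : ∀ D : Finset ℕ, D.Nonempty → D.erase 0 = ∅ → D = {0} := by
    intro D hD hD'
    rw [Finset.erase_eq_empty_iff] at hD'
    exact hD'.resolve_left hD.ne_empty
  rw [hsingle B hB hempty.1, hsingle C hC hempty.2]

/-- If the blocks of `u` are distinct, then some ordering of the indices turns them into a set
superpartition. -/
theorem exists_ordering_isSetSuperpartition {u : SMonomial ℕ} (hu : Set.InjOn u.block u.ind) :
    ∃ L ∈ orderings u.ind, IsSetSuperpartition (L.map u.block) := by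
  let r : ℕ → ℕ → Prop := fun a b => blockKey (u.block a) ≤ blockKey (u.block b)
  have : Std.Total r := ⟨fun a b => le_total _ _⟩
  have : IsTrans ℕ r := ⟨fun a b c => le_trans⟩
  classical
  let L := (u.ind.sort (· ≤ ·)).insertionSort r
  have hperm : L.Perm (u.ind.sort (· ≤ ·)) := List.perm_insertionSort r _
  have hnodup : L.Nodup := hperm.nodup_iff.2 (Finset.sort_nodup _ _)
  have hmem : ∀ a, a ∈ L ↔ a ∈ u.ind := fun a => by rw [hperm.mem_iff, Finset.mem_sort]
  have hL : L ∈ orderings u.ind := by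
    rw [mem_orderings]
    exact ⟨hnodup, by ext a; rw [List.mem_toFinset, hmem]⟩
  have hne : ∀ a ∈ L, (u.block a).Nonempty := fun a ha =>
    mem_ind_iff_block_nonempty.1 ((hmem a).1 ha)
  refine ⟨L, hL, ⟨?_, ?_, exists_covering_map_block fun a ha => (hmem a).2 ha⟩, ?_⟩
  · intro B hB
    obtain ⟨a, ha, rfl⟩ := List.mem_map.1 hB
    exact hne a ha
  · rw [List.pairwise_map]
    exact hnodup.imp fun h => block_inter_subset h
  · rw [List.pairwise_map]
    have hs : L.Pairwise r := List.pairwise_insertionSort r _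
    refine (hs.and hnodup).imp_of_mem fun {a b} ha hb hab => ?_
    have hne' : u.block a ≠ u.block b := fun h => hab.2 (hu ((hmem a).1 ha) ((hmem b).1 hb) h)
    refine ⟨hne', minZero_sdiff_lt_of_blockKey_lt (hne b hb) (block_inter_subset hab.2) ?_⟩
    exact lt_of_le_of_ne hab.1 fun h =>
      hne' (eq_of_blockKey_eq (hne a ha) (hne b hb) (block_inter_subset hab.2) h)

/-- A set superpartition is determined by its set of blocks. -/
theorem eq_of_perm_of_isSetSuperpartition {I J : List (Finset ℕ)} (hI : IsSetSuperpartition I)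
    (hJ : IsSetSuperpartition J) (h : I.Perm J) : I = J :=
  h.eq_of_pairwise (fun _ _ _ _ h1 h2 => absurd h1.2 h2.2.not_gt) hI.2 hJ.2

end BlockOrder

section Vanishing

theorem pairProd_ne_zero {γ : Type*} {s : γ → γ → ℚ} (hs : ∀ a b, s a b ≠ 0) (L : List γ) :
    pairProd s L ≠ 0 := by
  induction L with
  | nil => exact one_ne_zero
  | cons a L ih =>
    refine mul_ne_zero (List.prod_ne_zero fun h => ?_) ih
    obtain ⟨b, -, hb⟩ := List.mem_map.1 h
    exact hs a b hb

theorem oddFactor_ne_zero {γ : Type*} [LinearOrder γ] (F : Finset γ) (a b : γ) :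
    oddFactor F a b ≠ 0 := by
  unfold oddFactor
  split_ifs <;> norm_num

theorem image_swap_of_mem {S : Finset ℕ} {a b : ℕ} (ha : a ∈ S) (hb : b ∈ S) :
    S.image (Equiv.swap a b) = S := by
  ext c
  rw [Finset.mem_image]
  have h : ∀ c ∈ S, Equiv.swap a b c ∈ S := by
    intro c hc
    rcases eq_or_ne c a with rfl | h1
    · rwa [Equiv.swap_apply_left]
    · rcases eq_or_ne c b with rfl | h2
      · rwa [Equiv.swap_apply_right]
      · rwa [Equiv.swap_apply_of_ne_of_ne h1 h2]
  exact ⟨fun ⟨d, hd, hdc⟩ => hdc ▸ h d hd, fun hc => ⟨_, h c hc, Equiv.swap_apply_self _ _ _⟩⟩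

/-- A transposition of two odd letters changes the sign. -/
theorem permSign_swap {S : Finset ℕ} {a b : ℕ} (ha : a ∈ S) (hb : b ∈ S) (hab : a ≠ b) :
    permSign (Equiv.swap a b) S = -1 := by
  let N := ((S.erase a).erase b).toList
  have hN : ∀ c ∈ N, c ≠ a ∧ c ≠ b := fun c hc => by
    simp only [N, Finset.mem_toList, Finset.mem_erase] at hc
    exact ⟨hc.2.1, hc.1⟩
  have hL : a :: b :: N ∈ orderings S := by
    rw [mem_orderings]
    constructor
    · rw [List.nodup_cons, List.nodup_cons]
      refine ⟨?_, fun h => (hN b h).2 rfl, Finset.nodup_toList _⟩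
      rw [List.mem_cons]
      rintro (h | h)
      · exact hab h
      · exact (hN a h).1 rfl
    · rw [List.toFinset_cons, List.toFinset_cons, Finset.toList_toFinset,
        Finset.insert_erase (Finset.mem_erase.2 ⟨hab.symm, hb⟩), Finset.insert_erase ha]
  have hmap : (a :: b :: N).map (Equiv.swap a b) = b :: a :: N := by
    have h1 : N.map (Equiv.swap a b) = N.map id := List.map_congr_left fun c hc =>
      Equiv.swap_apply_of_ne_of_ne (hN c hc).1 (hN c hc).2
    rw [List.map_cons, List.map_cons, Equiv.swap_apply_left, Equiv.swap_apply_right, h1, List.map_id]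
  have h := pairProd_map_perm (Equiv.swap a b) (le_refl S) hL
  have hs : oddFactor S b a = -oddFactor S a b := by
    unfold oddFactor
    rcases lt_or_gt_of_ne hab with h1 | h1 <;> simp [ha, hb, h1, h1.not_gt]
  rw [image_swap_of_mem ha hb, hmap] at h
  have h2 : pairProd (oddFactor S) (b :: a :: N) = -pairProd (oddFactor S) (a :: b :: N) := by
    simp only [pairProd, List.map_cons, List.prod_cons, hs]
    ring
  rw [h2] at h
  exact mul_right_cancel₀ (pairProd_ne_zero (oddFactor_ne_zero S) (a :: b :: N))
    (by rw [← h]; ring)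

/-- The coefficient of a symmetric function at a monomial with two equal blocks is `0`: both blocks
are `{0}`, and the transposition of the two indices changes the sign of the monomial. -/
theorem apply_eq_zero_of_block_eq {f : SuperSeries ℕ} (hf : f ∈ sNCSym) {v : SMonomial ℕ} {a b : ℕ}
    (ha : a ∈ v.ind) (hab : a ≠ b) (h : v.block a = v.block b) : f.1 v = 0 := by
  have h0 : ∀ t ∈ v.block a, t = 0 := fun t ht =>
    Finset.mem_singleton.1 (block_inter_subset hab (Finset.mem_inter.2 ⟨ht, h ▸ ht⟩))
  obtain ⟨t, ht⟩ := mem_ind_iff_block_nonempty.1 ha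
  obtain rfl := h0 t ht
  have ha1 : a ∈ v.odd := zero_mem_block.1 ht
  have hb1 : b ∈ v.odd := zero_mem_block.1 (h ▸ ht)
  have hw : ∀ c, v.block c = v.block a → c ∉ v.word := by
    intro c hc hcw
    obtain ⟨t, ht⟩ := List.getElem?_of_mem hcw
    exact absurd (h0 (t + 1) (hc ▸ succ_mem_block.2 ht)) (Nat.succ_ne_zero t)
  have hfix : v.map (Equiv.swap a b) = v := by
    apply SMonomial.ext
    · exact image_swap_of_mem ha1 hb1
    · change v.word.map _ = v.word
      conv_rhs => rw [← List.map_id v.word]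
      refine List.map_congr_left fun c hc => Equiv.swap_apply_of_ne_of_ne ?_ ?_
      · rintro rfl
        exact hw c rfl hc
      · rintro rfl
        exact hw c h.symm hc
  have h1 := mem_sNCSym_iff.1 hf (max a b + 1) (Equiv.swap a b)
    (fun i hi => Equiv.swap_apply_of_ne_of_ne (by omega) (by omega)) v
  rw [hfix, permSign_swap ha1 hb1 hab] at h1
  linarith

/-- A symmetric function is determined by its coefficients at the monomials whose blocks form a set
superpartition. -/
theorem eq_zero_of_mem_sNCSym {f : sNCQSym} (hf : f.1 ∈ sNCSym)
    (h : ∀ u : SMonomial ℕ, IsSetSuperpartition u.blocks → f.1.1 u = 0) : f = 0 := by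
  apply Subtype.ext; apply Subtype.ext
  funext v
  change f.1.1 v = 0
  by_cases hv : Set.InjOn v.block v.ind
  · obtain ⟨L, hL, hsp⟩ := exists_ordering_isSetSuperpartition hv
    have hmem : ∀ a ∈ v.ind, a ∈ L := fun a ha => (mem_of_mem_orderings hL).2 ha
    have hLs : v.Lists L := ⟨(mem_orderings.1 hL).1, fun a ha => (mem_of_mem_orderings hL).1 ha⟩
    obtain ⟨n, σ, h1, h2⟩ := exists_perm_extending (s := v.ind) (φ := fun a => L.idxOf a)
      fun a ha b _ hab => (List.idxOf_inj (hmem a ha)).1 hab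
    -- Renaming the indices along `L` turns the blocks of `v` into a set superpartition, and changes
    -- the coefficient only by a sign.
    have h3 : v.relabel L = v.map σ := by
      rw [SMonomial.relabel_eq_map hmem]
      exact SMonomial.map_congr fun a ha => (h2 a ha).symm
    have h4 : f.1.1 (v.relabel L) = 0 := by
      apply h
      rw [blocks_relabel hLs, stdBlocks_eq_self hsp.1.2.2]
      exact hsp
    rw [h3, mem_sNCSym_iff.1 hf n σ h1] at h4
    refine (mul_eq_zero.1 h4).resolve_left ?_
    unfold permSign
    exact pow_ne_zero _ (by norm_num)
  · simp only [Set.InjOn, not_forall] at hv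
    obtain ⟨a, ha, b, -, hab, hne⟩ := hv
    exact apply_eq_zero_of_block_eq hf ha hne hab

end Vanishing

section SymmetricBasis

/-- The coefficient of a set superpartition in the monomial functions of set superpartitions. -/
theorem monomialSym_apply_of_isSetSuperpartition {I : List (Finset ℕ)}
    (hI : IsSetSuperpartition I) {u : SMonomial ℕ} (hu : IsSetSuperpartition u.blocks) :
    (monomialSym I).1.1 u = if u.blocks = I then 1 else 0 := by
  rw [monomialSym_apply]
  have hkey : ∀ σ : Equiv.Perm (Fin I.length),
      u.blocks = List.ofFn (fun r => I.get (σ r)) → u.blocks = I := by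
    intro σ h
    refine eq_of_perm_of_isSetSuperpartition hu hI ?_
    rw [h]
    conv_rhs => rw [← List.ofFn_get I]
    exact Equiv.Perm.ofFn_comp_perm σ I.get
  split_ifs with h
  · rw [Finset.sum_eq_single 1]
    · rw [if_pos, mul_one]
      · have : invPerm I 1 = 0 := by
          unfold invPerm
          rw [Finset.card_eq_zero, Finset.filter_eq_empty_iff]
          rintro ⟨p, q⟩ - ⟨h1, -, -, h2⟩
          exact lt_asymm h1 h2
        rw [this, pow_zero]
      · rw [h]
        exact (List.ofFn_get I).symm
    · intro σ _ hσ
      rw [if_neg, mul_zero]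
      intro h1
      rw [h] at h1
      have hinj : Function.Injective I.get :=
        List.nodup_iff_injective_get.1 (hI.2.imp fun h => h.1)
      have h2 := List.ofFn_injective ((List.ofFn_get I).trans h1)
      exact hσ (Equiv.ext fun r => (hinj (congrFun h2 r)).symm)
    · simp
  · exact Finset.sum_eq_zero fun σ _ => by rw [if_neg fun h1 => h (hkey σ h1), mul_zero]

/-- A set supercomposition is the sequence of the blocks of a standard monomial. -/
theorem exists_stdMonomial_blocks_eq {I : List (Finset ℕ)} (hI : IsSetSupercomposition I) :
    ∃ s : StdMonomial, s.1.blocks = I := by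
  obtain ⟨u, hu, hb⟩ := exists_monomial_of_isSetSupercomposition hI
  exact ⟨⟨u, SMonomial.std_of_ind_eq_range hu⟩, (blocks_of_ind_eq_range hu).trans hb⟩

/-- The standard monomial with the blocks of a set superpartition. -/
noncomputable def superpartitionMonomial (I : {I : List (Finset ℕ) // IsSetSuperpartition I}) :
    StdMonomial := (exists_stdMonomial_blocks_eq I.2.1).choose

theorem blocks_superpartitionMonomial (I : {I : List (Finset ℕ) // IsSetSuperpartition I}) :
    (superpartitionMonomial I).1.blocks = I.1 := (exists_stdMonomial_blocks_eq I.2.1).choose_spec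

/-- The coefficient at the standard monomial of a set superpartition. -/
noncomputable def superpartitionCoeff (I : {I : List (Finset ℕ) // IsSetSuperpartition I}) :
    sNCQSym →ₗ[ℚ] ℚ where
  toFun f := f.1.1 (superpartitionMonomial I).1
  map_add' _ _ := rfl
  map_smul' _ _ := rfl

theorem superpartitionCoeff_monomialSym
    (I J : {I : List (Finset ℕ) // IsSetSuperpartition I}) :
    superpartitionCoeff J (monomialSym I.1) = if J = I then 1 else 0 := by
  have h := monomialSym_apply_of_isSetSuperpartition I.2 (u := (superpartitionMonomial J).1)
    ((blocks_superpartitionMonomial J).symm ▸ J.2)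
  rw [blocks_superpartitionMonomial] at h
  simp only [Subtype.ext_iff]
  exact h

theorem linearIndependent_monomialSym : LinearIndependent ℚ
    fun I : {I : List (Finset ℕ) // IsSetSuperpartition I} => monomialSym I.1 :=
  LinearIndependent.of_pairwise_dual_eq_zero_one _ superpartitionCoeff
    (fun I J h => (superpartitionCoeff_monomialSym J I).trans (if_neg h))
    fun I => (superpartitionCoeff_monomialSym I I).trans (if_pos rfl)

/-- The functions `m_I` span: a symmetric function and the combination of the `m_I` with the same
coefficients at the standard monomials of set superpartitions coincide. -/
theorem span_monomialSym : Submodule.span ℚ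
    (Set.range fun I : {I : List (Finset ℕ) // IsSetSuperpartition I} => monomialSym I.1) =
      sNCSym.comap sNCQSym.val.toLinearMap := by
  apply le_antisymm
  · rw [Submodule.span_le]
    rintro _ ⟨I, rfl⟩
    exact monomialSym_mem_sNCSym I.1
  · intro f hf
    have hinj : Function.Injective superpartitionMonomial := by
      intro I J h
      apply Subtype.ext
      rw [← blocks_superpartitionMonomial, h, blocks_superpartitionMonomial]
    -- The coefficients of `f` at the standard monomials of the set superpartitions, and the
    -- corresponding combination of the `m_I`.
    let c := (stdBasis.repr f).comapDomain superpartitionMonomial hinj.injOn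
    let g := Finsupp.linearCombination ℚ
      (fun I : {I : List (Finset ℕ) // IsSetSuperpartition I} => monomialSym I.1) c
    have hg : g ∈ Submodule.span ℚ (Set.range
        fun I : {I : List (Finset ℕ) // IsSetSuperpartition I} => monomialSym I.1) :=
      Finsupp.mem_span_range_iff_exists_finsupp.2 ⟨c, rfl⟩
    have hgs : g.1 ∈ sNCSym := by
      have hle : Submodule.span ℚ (Set.range
          fun I : {I : List (Finset ℕ) // IsSetSuperpartition I} => monomialSym I.1) ≤
          sNCSym.comap sNCQSym.val.toLinearMap := by
        rw [Submodule.span_le]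
        rintro _ ⟨I, rfl⟩
        exact monomialSym_mem_sNCSym I.1
      exact hle hg
    have hcoeff : ∀ J, superpartitionCoeff J g = superpartitionCoeff J f := by
      intro J
      simp only [g, Finsupp.linearCombination_apply, Finsupp.sum, map_sum, map_smul,
        superpartitionCoeff_monomialSym, smul_eq_mul, mul_ite, mul_one, mul_zero]
      rw [Finset.sum_ite_eq]
      split_ifs with hJ
      · rfl
      · exact (Finsupp.notMem_support_iff.1 hJ).symm
    have hfg : f - g = 0 := by
      refine eq_zero_of_mem_sNCSym (sNCSym.sub_mem hf hgs) fun u hu => ?_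
      have h1 : u.std = (superpartitionMonomial ⟨u.blocks, hu⟩).1.std :=
        std_eq_of_blocks_eq (blocks_superpartitionMonomial ⟨u.blocks, hu⟩).symm
      rw [(f - g).2 _ _ h1]
      change superpartitionCoeff ⟨u.blocks, hu⟩ (f - g) = 0
      rw [map_sub, hcoeff, sub_self]
    rw [sub_eq_zero.1 hfg]
    exact hg

theorem duplicationCoproduct_mem_sNCSym {f : sNCQSym}
    (hf : f ∈ sNCSym.comap sNCQSym.val.toLinearMap) :
    duplicationCoproduct f ∈ LinearMap.range (TensorProduct.map
      (sNCSym.comap sNCQSym.val.toLinearMap).subtype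
      (sNCSym.comap sNCQSym.val.toLinearMap).subtype) := by
  rw [← span_monomialSym] at hf
  induction hf using Submodule.span_induction with
  | mem f hf =>
    obtain ⟨I, rfl⟩ := hf
    rw [duplicationCoproduct_monomialSym I.2.1]
    refine Submodule.sum_mem _ fun A _ => Submodule.smul_mem _ _ ?_
    exact ⟨⟨_, monomialSym_mem_sNCSym _⟩ ⊗ₜ ⟨_, monomialSym_mem_sNCSym _⟩, rfl⟩
  | zero => rw [map_zero]; exact Submodule.zero_mem _
  | add f g _ _ hf hg => rw [map_add]; exact Submodule.add_mem _ hf hg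
  | smul c f _ hf => rw [map_smul]; exact Submodule.smul_mem _ _ hf

theorem isSubHopfSuperalgebra_sNCSym :
    IsSubHopfSuperalgebra hopfSuperalgebra (sNCSym.comap sNCQSym.val.toLinearMap) where
  one_mem := one_mem_sNCSym
  mul_mem _ ha _ hb := sNCSym_mul_mem ha hb
  graded f hf i := by
    rw [decompose_parityPart]
    exact parityProj_mem_sNCSym hf i
  comul_mem _ ha := duplicationCoproduct_mem_sNCSym ha
  antipode_mem _ ha := convInverse_mem convDefectNilpotent_sNCQSym one_mem_sNCSym
    (fun _ ha _ hb => sNCSym_mul_mem ha hb) (fun _ ha => duplicationCoproduct_mem_sNCSym ha) ha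

end SymmetricBasis

end SuperNC

open SuperNC in
theorem mainTheorem12 :
    ∃ H : HopfSuperalgebra (parityPart (α := ℕ)),
      IsDuplicationCoproduct H.comul ∧
      (∀ f : sNCQSym, H.counit f = f.1.1 ⟨∅, []⟩) ∧
      sNCSym ≤ Subalgebra.toSubmodule sNCQSym ∧
      IsSubHopfSuperalgebra H (sNCSym.comap sNCQSym.val.toLinearMap) ∧
      LinearIndependent ℚ
        (fun I : {I : List (Finset ℕ) // IsSetSuperpartition I} => monomialSym I.1) ∧
      Submodule.span ℚ
        (Set.range fun I : {I : List (Finset ℕ) // IsSetSuperpartition I} => monomialSym I.1) =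
          sNCSym.comap sNCQSym.val.toLinearMap ∧
      ∀ I : List (Finset ℕ), IsSetSuperpartition I →
        H.comul (monomialSym I) = ∑ A : Finset (Fin I.length), (-1 : ℚ) ^ invSubset I A •
          (monomialSym (stdBlocks (subBlocks I A)) ⊗ₜ[ℚ]
            monomialSym (stdBlocks (subBlocks I Aᶜ))) :=
  ⟨hopfSuperalgebra, isDuplicationCoproduct_duplicationCoproduct, counit_hopfSuperalgebra,
    sNCSym_le_sNCQSym, isSubHopfSuperalgebra_sNCSym, linearIndependent_monomialSym,
    span_monomialSym, fun _ hI => duplicationCoproduct_monomialSym hI.1⟩
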